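/- **Setting.** Let $f,g:\mathbb R^{d_x}\times\mathbb R^{d_y}\to\mathbb R$ be $C^2$ (Euclidean norms throughout), such that $g(x,\cdot)$ is $\mu$-strongly convex with $\mu>0$; $\nabla g$ is $L_g$-Lipschitz and $\nabla^2 g$ is $\rho_g$-Lipschitz; $f$ is $C_f$-Lipschitz in $y$ and $\nabla f$ is $L_f$-Lipschitz. Put $y^*(x)=\arg\min_y g(x,y)$ and $\varphi(x)=f(x,y^*(x))$, and assume $\inf\varphi>-\infty$. Let $\ell=\max\{C_f,L_f,L_g,\rho_g\}$ and $\kappa=\ell/\mu$. Let $\nabla f(x,y;\phi_f)$ and $\nabla g(x,y;\phi_g)$ (jointly measurable) be unbiased estimators of $\nabla f(x,y)$ and $\nabla g(x,y)$ with variances at most $\sigma_f^2$ and $\sigma_g^2$, where $\sigma_f,\sigma_g\ge 0$; for a batch size $B$ let $\nabla f(\cdot\,;B)$ and $\nabla g(\cdot\,;B)$ be averages over $B$ independent samples. Fix $x_0,y_0$ and put $\Delta=\varphi(x_0)-\inf\varphi$ and $R=\|y_0-y^*(x_0)\|^2$; assume $\Delta>0$, $R>0$. **Algorithm (F²BSA).**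 Put $z_0=y_0$. For $t=0,\dots,T-1$: set $y_t^0=y_t$, $z_t^0=z_t$; for $k=0,\dots,K_t-1$ let $$z_t^{k+1}=z_t^k-\eta_z\lambda\nabla_y g(x_t,z_t^k;B_{\rm in}),\qquad y_t^{k+1}=y_t^k-\eta_y\bigl(\nabla_y f(x_t,y_t^k;B_{\rm in})+\lambda\nabla_y g(x_t,y_t^k;B_{\rm in})\bigr);$$ then set $y_{t+1}=y_t^{K_t}$, $z_{t+1}=z_t^{K_t}$ and $$G_t=\nabla_x f(x_t,y_{t+1};B_{\rm out})+\lambda\bigl(\nabla_x g(x_t,y_{t+1};B_{\rm out})-\nabla_x g(x_t,z_{t+1};B_{\rm out})\bigr),\qquad x_{t+1}=x_t-\eta_xG_t.$$ Mini-batches of different steps are independent (within one step the $y$- and $z$-gradients of $g$ may or may not share a mini-batch). The output is $x_j$ with $j$ uniform in $\{0,\dots,T-1\}$ and independent of the samples. Every evaluation of a stochastic gradient of $f$ or $g$ is one oracle call. **Theorem.** There are absolute positive constants $a_\eta,a_\lambda,a_T,a_{\rm out},a_{\rm in},a_K,a_\delta$ and a number $C=C(\Delta,R,\sigma_f,\sigma_g)$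 such that, for all such data and all $0<\varepsilon\le\ell\kappa^2$, the following holds with $$\eta_x=\frac{a_\eta}{\ell\kappa^3},\quad \lambda=a_\lambda\max\Bigl\{\frac{\kappa}{R},\frac{\ell\kappa^2}{\Delta},\frac{\ell\kappa^3}{\varepsilon}\Bigr\},\quad \eta_y=\eta_z=\frac1{2\lambda L_g},\quad T=\Bigl\lceil a_T\frac{\Delta\,\ell\kappa^3}{\varepsilon^{2}}\Bigr\rceil,$$ $$B_{\rm out}=\max\Bigl\{1,\Bigl\lceil a_{\rm out}\frac{\sigma_f^2+\lambda^2\sigma_g^2}{\varepsilon^2}\Bigr\rceil\Bigr\},\qquad B_{\rm in}=\Bigl\lceil a_{\rm in}\frac{L_f^2+\lambda^2L_g^2}{\lambda^2\mu^2}B_{\rm out}\Bigr\rceil,$$ $$K_t=\Bigl\lceil a_K\frac{L_g}{\mu}\log\Bigl(2\kappa\Bigl(1+\frac{(L_f^2+\lambda^2L_g^2)\,\delta_t}{\varepsilon^2}\Bigr)\Bigr)\Bigr\rceil,$$ $$\delta_0=a_\delta R,\qquad \delta_{t+1}=\tfrac12\delta_t+\frac{34L_g^2}{\mu^2}\|x_{t+1}-x_t\|^2+\frac{\sigma_g^2}{2L_gB_{\rm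 in}}.$$ 1. $\varphi$ is differentiable, and the output $x$ satisfies $\mathbb E\|\nabla\varphi(x)\|\le\varepsilon$ (in particular the expectation is finite). The expected number of oracle calls is finite. 2. If moreover $\varepsilon\le 1$ and $2\varepsilon\le\ell$, then $T\le C\,\ell\kappa^3\varepsilon^{-2}$, and the expected total number of stochastic first-order oracle calls is at most $$\begin{cases}C\,\ell\kappa^{6}\varepsilon^{-4}\log(\ell\kappa/\varepsilon), & \sigma_f>0,\ \sigma_g=0,\\ C\,\ell^3\kappa^{12}\varepsilon^{-6}\log(\ell\kappa/\varepsilon), & \sigma_f>0,\ \sigma_g>0.\end{cases}$$ -/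

import Mathlib

open MeasureTheory ProbabilityTheory

noncomputable section

namespace F2BSA

/-- `ℝ^d` with the Euclidean norm. -/
abbrev Vec (d : ℕ) := EuclideanSpace ℝ (Fin d)

/-- `ℝ^{dx} × ℝ^{dy}` with the Euclidean norm `√(‖x‖² + ‖y‖²)`. -/
abbrev Joint (dx dy : ℕ) := WithLp 2 (Vec dx × Vec dy)

/-- The pair `(x, y)` as a point of `ℝ^{dx} × ℝ^{dy}`. -/
def pt {dx dy : ℕ} (x : Vec dx) (y : Vec dy) : Joint dx dy := WithLp.toLp 2 (x, y)

/-- `y*(x)`, a global minimizer of the lower-level objective `g(x, ·)`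
(unique when `g(x, ·)` is strongly convex). -/
def yStar {dx dy : ℕ} (g : Joint dx dy → ℝ) (x : Vec dx) : Vec dy :=
  Classical.epsilon fun y => ∀ y', g (pt x y) ≤ g (pt x y')

/-- The hyper-objective `φ(x) = f(x, y*(x))`. -/
def hyper {dx dy : ℕ} (f g : Joint dx dy → ℝ) (x : Vec dx) : ℝ :=
  f (pt x (yStar g x))

/-- The problem constants `μ, C_f, L_f, L_g, ρ_g` and the noise levels `σ_f, σ_g`. -/
structure Consts where
  (μ Cf Lf Lg ρg σf σg : ℝ)

/-- The largest smoothness constant `ℓ = max {C_f, L_f, L_g, ρ_g}`. -/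
def Consts.ell (c : Consts) : ℝ := max (max c.Cf c.Lf) (max c.Lg c.ρg)

/-- The condition number `κ = ℓ / μ`. -/
def Consts.kappa (c : Consts) : ℝ := c.ell / c.μ

/-- The standing assumptions on the upper-level objective `f` and the lower-level objective `g`. -/
structure Regular {dx dy : ℕ} (c : Consts) (f g : Joint dx dy → ℝ) : Prop where
  μ_pos : 0 < c.μ
  /-- `g(x, ·)` is `μ`-strongly convex. -/
  g_strongConvex : ∀ x, StrongConvexOn Set.univ c.μ fun y => g (pt x y)
  /-- `g` is twice (continuously) differentiable. -/
  g_contDiff : ContDiff ℝ 2 g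
  /-- `g` is `L_g`-gradient Lipschitz. -/
  g_gradLip : ∀ p q, ‖gradient g p - gradient g q‖ ≤ c.Lg * ‖p - q‖
  /-- `g` is `ρ_g`-Hessian Lipschitz, in operator norm. -/
  g_hessLip : ∀ p q,
    ‖fderiv ℝ (gradient g) p - fderiv ℝ (gradient g) q‖ ≤ c.ρg * ‖p - q‖
  /-- `f` is `C_f`-Lipschitz in `y`. -/
  f_lip : ∀ x y y', |f (pt x y) - f (pt x y')| ≤ c.Cf * ‖y - y'‖
  /-- `f` is `L_f`-gradient Lipschitz. -/
  f_gradLip : ∀ p q, ‖gradient f p - gradient f q‖ ≤ c.Lf * ‖p - q‖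
  /-- `f` is twice continuously differentiable. -/
  f_contDiff : ContDiff ℝ 2 f
  /-- The hyper-objective is bounded below. -/
  hyper_bddBelow : BddBelow (Set.range (hyper f g))

/-- `H p ξ`, with `ξ ∼ ν`, is an unbiased estimator of `∇h(p)` with variance at most `σ²`. -/
structure IsStochasticGradient {dx dy : ℕ} {Ξ : Type*} [MeasurableSpace Ξ] (ν : Measure Ξ)
    (h : Joint dx dy → ℝ) (H : Joint dx dy → Ξ → Joint dx dy) (σ : ℝ) : Prop where
  measurable : Measurable (Function.uncurry H)
  integrable : ∀ p, Integrable (H p) ν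
  unbiased : ∀ p, ∫ ξ, H p ξ ∂ν = gradient h p
  integrable_sq : ∀ p, Integrable (fun ξ => ‖H p ξ - gradient h p‖ ^ 2) ν
  variance_le : ∀ p, ∫ ξ, ‖H p ξ - gradient h p‖ ^ 2 ∂ν ≤ σ ^ 2

/-- The places where the method draws samples: the `i`-th element of the mini-batch of the `k`-th
inner step of iteration `t`, and the `i`-th element of the mini-batch of the outer step of
iteration `t`. -/
inductive Slot
  | inner (t k i : ℕ)
  | outer (t i : ℕ)

/-- The samples of the method. Slot `s` holds `(ϕ_f, ϕ_g, ϕ_g')`: a sample for the gradient of `f`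
at the `y`-iterate, and samples for the gradients of `g` at the `y`-iterate and at the `z`-iterate.
The slots are mutually independent and each sample has the law of its oracle. Inside
one slot any dependence is allowed, so that the `y`- and the `z`-update may share a mini-batch
(`ϕ_g = ϕ_g'`) or use separate ones. -/
structure IsSampling {Ξf Ξg Ω : Type*} [MeasurableSpace Ξf] [MeasurableSpace Ξg]
    [MeasurableSpace Ω] (νf : Measure Ξf) (νg : Measure Ξg) (P : Measure Ω)
    (S : Slot → Ω → Ξf × Ξg × Ξg) : Prop where
  measurable : ∀ s, Measurable (S s)
  law_f : ∀ s, P.map (fun ω => (S s ω).1) = νf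
  law_g_y : ∀ s, P.map (fun ω => (S s ω).2.1) = νg
  law_g_z : ∀ s, P.map (fun ω => (S s ω).2.2) = νg
  indep : iIndepFun S P

/-- Parameters of the method. `innerSteps δ` is the number of inner steps of an iteration whose
error estimate `δ_t` has the value `δ`; the estimate follows
`δ_{t+1} = δ_t / 2 + drift * ‖x_{t+1} - x_t‖² + floor`, started at `δ₀`. -/
structure Params where
  (ηx ηy ηz lam : ℝ)
  (Bin Bout : ℕ)
  (innerSteps : ℝ → ℕ)
  (δ₀ drift floor : ℝ)

/-- The mini-batch average `(1/B) ∑_{i < B} v i`. -/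
def batchMean {V : Type*} [AddCommGroup V] [Module ℝ V] (B : ℕ) (v : ℕ → V) : V :=
  (B : ℝ)⁻¹ • ∑ i ∈ Finset.range B, v i

/-- State of the inner loop: `(y_t^k, z_t^k)` and the number of oracle calls made so far. -/
structure InnerState (dy : ℕ) where
  (y z : Vec dy)
  calls : ℕ

/-- State of the outer loop: `(x_t, y_t, z_t)`, the estimate `δ_t`, and the number of oracle calls
made so far. -/
structure State (dx dy : ℕ) where
  x : Vec dx
  (y z : Vec dy)
  δ : ℝ
  calls : ℕ

section Algorithm

variable {dx dy : ℕ} {Ξf Ξg : Type*} (p : Params)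
  (F : Joint dx dy → Ξf → Joint dx dy) (G : Joint dx dy → Ξg → Joint dx dy)
  (s : Slot → Ξf × Ξg × Ξg)

/-- The `k`-th inner step of iteration `t` at `x = x_t`: mini-batch gradient steps for
`λ g(x, ·)` in `z` and for `f(x, ·) + λ g(x, ·)` in `y`. Each of the `B_in` slots costs three
oracle calls: `f` at `(x, y)`, `g` at `(x, y)` and `g` at `(x, z)`. -/
def innerStep (t : ℕ) (x : Vec dx) (k : ℕ) (u : InnerState dy) : InnerState dy where
  y := u.y - p.ηy •
    (batchMean p.Bin (fun i => (F (pt x u.y) (s (.inner t k i)).1).snd)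
      + p.lam • batchMean p.Bin (fun i => (G (pt x u.y) (s (.inner t k i)).2.1).snd))
  z := u.z - (p.ηz * p.lam) •
    batchMean p.Bin (fun i => (G (pt x u.z) (s (.inner t k i)).2.2).snd)
  calls := u.calls + 3 * p.Bin

/-- The inner loop of iteration `t`, run for the given number of steps. -/
def innerLoop (t : ℕ) (x : Vec dx) (u : InnerState dy) : ℕ → InnerState dy
  | 0 => u
  | k + 1 => innerStep p F G s t x k (innerLoop t x u k)

/-- The hyper-gradient estimator
`G_t = ∇ₓf(x,y;B_out) + λ (∇ₓg(x,y;B_out) - ∇ₓg(x,z;B_out))`. -/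
def hyperGradEst (t : ℕ) (x : Vec dx) (y z : Vec dy) : Vec dx :=
  batchMean p.Bout (fun i => (F (pt x y) (s (.outer t i)).1).fst)
    + p.lam • (batchMean p.Bout (fun i => (G (pt x y) (s (.outer t i)).2.1).fst)
      - batchMean p.Bout (fun i => (G (pt x z) (s (.outer t i)).2.2).fst))

/-- Iteration `t`: `K_t` inner steps, warm-started at `(y_t, z_t)`, then one step in `x`. -/
def outerStep (t : ℕ) (st : State dx dy) : State dx dy :=
  let u := innerLoop p F G s t st.x ⟨st.y, st.z, st.calls⟩ (p.innerSteps st.δ)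
  let x' := st.x - p.ηx • hyperGradEst p F G s t st.x u.y u.z
  { x := x'
    y := u.y
    z := u.z
    δ := st.δ / 2 + p.drift * ‖x' - st.x‖ ^ 2 + p.floor
    calls := u.calls + 3 * p.Bout }

/-- The state at the start of iteration `t`, from `x₀` and `z₀ = y₀`, along the samples `s`. -/
def run (x₀ : Vec dx) (y₀ : Vec dy) : ℕ → State dx dy
  | 0 => ⟨x₀, y₀, y₀, p.δ₀, 0⟩
  | t + 1 => outerStep p F G s t (run x₀ y₀ t)

end Algorithm

/-- The numerical factors hidden in the orders of magnitude of the parameters. -/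
structure Factors where
  (η lam T out inn K δ : ℝ)
  η_pos : 0 < η
  lam_pos : 0 < lam
  T_pos : 0 < T
  out_pos : 0 < out
  inn_pos : 0 < inn
  K_pos : 0 < K
  δ_pos : 0 < δ

/-- The penalty `λ ≍ max {κ/R, ℓκ²/Δ, ℓκ³/ε}`. -/
def penalty (a : Factors) (c : Consts) (Δ R ε : ℝ) : ℝ :=
  a.lam * max (c.kappa / R) (max (c.ell * c.kappa ^ 2 / Δ) (c.ell * c.kappa ^ 3 / ε))

/-- The outer batch size `B_out ≍ (σ_f² + λ² σ_g²) / ε²`, rounded up to a positive integer. -/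
def batchOut (a : Factors) (c : Consts) (Δ R ε : ℝ) : ℕ :=
  max 1 ⌈a.out * ((c.σf ^ 2 + penalty a c Δ R ε ^ 2 * c.σg ^ 2) / ε ^ 2)⌉₊

/-- The inner batch size `B_in ≍ (L_f² + λ² L_g²) / (λ² μ²) · B_out`, rounded up. -/
def batchIn (a : Factors) (c : Consts) (Δ R ε : ℝ) : ℕ :=
  ⌈a.inn * ((c.Lf ^ 2 + penalty a c Δ R ε ^ 2 * c.Lg ^ 2) / (penalty a c Δ R ε ^ 2 * c.μ ^ 2)
    * batchOut a c Δ R ε)⌉₊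

/-- The parameter setting: `η_x ≍ 1/(ℓκ³)`, `η_z = η_y = 1/(2 λ L_g)`, the above penalty and batch
sizes, `K_t ≍ (L_g/μ) log(2κ (1 + (L_f² + λ² L_g²) δ_t / ε²))` rounded up, and
`δ_{t+1} = δ_t/2 + (34 L_g²/μ²) ‖x_{t+1} - x_t‖² + σ_g²/(2 L_g B_in)` with `δ₀ ≍ R`. -/
def setting (a : Factors) (c : Consts) (Δ R ε : ℝ) : Params where
  ηx := a.η / (c.ell * c.kappa ^ 3)
  ηy := 1 / (2 * penalty a c Δ R ε * c.Lg)
  ηz := 1 / (2 * penalty a c Δ R ε * c.Lg)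
  lam := penalty a c Δ R ε
  Bin := batchIn a c Δ R ε
  Bout := batchOut a c Δ R ε
  innerSteps := fun δ =>
    ⌈a.K * (c.Lg / c.μ *
      Real.log (2 * c.kappa * (1 + (c.Lf ^ 2 + penalty a c Δ R ε ^ 2 * c.Lg ^ 2) * δ / ε ^ 2)))⌉₊
  δ₀ := a.δ * R
  drift := 34 * c.Lg ^ 2 / c.μ ^ 2
  floor := c.σg ^ 2 / (2 * c.Lg * batchIn a c Δ R ε)

/-- The number of iterations `T ≍ Δ ℓ κ³ / ε²`, rounded up. -/
def iterations (a : Factors) (c : Consts) (Δ ε : ℝ) : ℕ :=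
  ⌈a.T * (Δ * (c.ell * c.kappa ^ 3 / ε ^ 2))⌉₊

end F2BSA

end

/-!
The method follows the gradient of a surrogate of `φ`. Let `y*_λ(x)` minimize `g(x, ·) + f(x, ·) / λ`.
For `v = (∇²_yy g)⁻¹ ∇_y f` at `(x, y*(x))` the hyper-gradient `D` satisfies
`∇f = (D, 0) + ∇²g (0, v)`, and `y ↦ ⟨v, ∇_y g⟩` vanishes along the curve of lower-level solutions.
This gives a quadratic expansion of `φ` with constant `3 ℓ κ³` (`Regular.exists_hyper_expansion`),
hence differentiability and a descent inequality, without differentiating `y*`. Comparing the same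
identity with the stationarity of `y*_λ` shows that the exact surrogate gradient
`∇ₓf(x, y*_λ) + λ (∇ₓg(x, y*_λ) - ∇ₓg(x, y*))` has bias at most `4 ℓ κ³ / λ ≤ ε / 8`
(`Regular.norm_surrogateGrad_sub_le`).

Each inner step is an exact gradient step on a strongly convex smooth function, perturbed by
independent centered noise, so the inner loop contracts geometrically to the noise level set by
`B_in`. The number `K_t` of inner steps is random, since it depends on `δ_t`, and an error bound in
expectation cannot be compared with `δ_t` directly. What is propagated instead is the expectation of
the ratio of the squared error to `δ_t + c₀`, with `c₀ = ε² / (L_f² + λ² L_g²)`. Since the recursion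
for `δ_t` contains the drift of the exact solutions, the next ratio is at most `1` plus four times
the squared error after the inner loop divided by `δ_t + c₀`, and this denominator is known before
the inner loop starts; so the expected ratio never exceeds `2` (`lintegral_ratio_le`). As `K_t` beats the factor `1 + δ_t / c₀`, the expected squared error after
every inner loop is at most `c₀ / 48` (`lintegral_afterInner_le`).

The estimator `G_t` is therefore accurate to `ε² / 2` in mean square, and the descent inequality,
summed over the run, bounds the sums of `E‖∇φ(x_t)‖²` and of `E‖x_{t+1} - x_t‖²` (`sum_descent_le`).
The first sum gives the stationarity of the uniformly chosen iterate. The second controls the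
average of `δ_t` through its recursion, and by concavity of the logarithm the expected number of
inner steps (`integral_calls_le`). The complexity bounds are then arithmetic in the parameters.

Expectations are first taken as lower integrals of nonnegative functions, so that no integrability
has to be known in advance; it follows from the summed descent inequality.
-/

noncomputable section

namespace F2BSA

set_option linter.unusedSectionVars false

/-! ### First-order inequalities for smooth and strongly convex functions -/

section FirstOrder

variable {E : Type*} [NormedAddCommGroup E] [InnerProductSpace ℝ E] [CompleteSpace E]

theorem hasDerivAt_along_line {h : E → ℝ} {h' : E → E} (hh : ∀ p, HasGradientAt h (h' p) p)
    (p d : E) (t : ℝ) :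
    HasDerivAt (fun s : ℝ => h (p + s • d)) (inner ℝ (h' (p + t • d)) d) t := by
  have h1 : HasDerivAt (fun s : ℝ => p + s • d) d t := by
    simpa using ((hasDerivAt_id t).smul_const d).const_add p
  have h2 := (hh (p + t • d)).hasFDerivAt.comp_hasDerivAt t h1
  simpa [Function.comp_def] using h2

theorem continuous_of_hasGradientAt {h : E → ℝ} {h' : E → E}
    (hh : ∀ p, HasGradientAt h (h' p) p) : Continuous h :=
  Differentiable.continuous (𝕜 := ℝ) fun p => (hh p).differentiableAt

/-- The descent lemma: a function with `L`-Lipschitz gradient lies below its quadratic model. -/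
theorem le_quadratic_of_gradient_lipschitz {h : E → ℝ} {h' : E → E} {L : ℝ}
    (hh : ∀ p, HasGradientAt h (h' p) p) (hL : ∀ p q, ‖h' p - h' q‖ ≤ L * ‖p - q‖) (p q : E) :
    h q ≤ h p + inner ℝ (h' p) (q - p) + L / 2 * ‖q - p‖ ^ 2 := by
  set d := q - p with hd
  have hder : ∀ t : ℝ, HasDerivAt
      (fun s : ℝ => h (p + s • d) - s * inner ℝ (h' p) d - L / 2 * ‖d‖ ^ 2 * s ^ 2)
      (inner ℝ (h' (p + t • d)) d - inner ℝ (h' p) d - L * ‖d‖ ^ 2 * t) t := by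
    intro t
    have h1 := hasDerivAt_along_line hh p d t
    have h2 : HasDerivAt (fun s : ℝ => s * inner ℝ (h' p) d) (inner ℝ (h' p) d) t := by
      simpa using (hasDerivAt_id t).mul_const (inner ℝ (h' p) d)
    have h3 : HasDerivAt (fun s : ℝ => L / 2 * ‖d‖ ^ 2 * s ^ 2) (L * ‖d‖ ^ 2 * t) t := by
      have := (hasDerivAt_pow 2 t).const_mul (L / 2 * ‖d‖ ^ 2)
      refine this.congr_deriv ?_
      push_cast
      ring
    exact (h1.sub h2).sub h3
  have hanti : AntitoneOn
      (fun s : ℝ => h (p + s • d) - s * inner ℝ (h' p) d - L / 2 * ‖d‖ ^ 2 * s ^ 2)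
      (Set.Icc 0 1) := by
    apply antitoneOn_of_deriv_nonpos (convex_Icc 0 1)
    · exact fun t _ => (hder t).continuousAt.continuousWithinAt
    · exact fun t _ => (hder t).differentiableAt.differentiableWithinAt
    · intro t ht
      rw [interior_Icc] at ht
      rw [(hder t).deriv, ← inner_sub_left]
      have h1 := real_inner_le_norm (h' (p + t • d) - h' p) d
      have h2 := hL (p + t • d) p
      rw [add_sub_cancel_left, norm_smul, Real.norm_of_nonneg ht.1.le] at h2
      nlinarith [mul_le_mul_of_nonneg_right h2 (norm_nonneg d)]
  have := hanti (Set.left_mem_Icc.2 zero_le_one) (Set.right_mem_Icc.2 zero_le_one) zero_le_one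
  have hq : p + d = q := by simp [hd]
  simp only [one_smul, zero_smul, add_zero, hq] at this
  linarith

theorem quadratic_le_of_gradient_lipschitz {h : E → ℝ} {h' : E → E} {L : ℝ}
    (hh : ∀ p, HasGradientAt h (h' p) p) (hL : ∀ p q, ‖h' p - h' q‖ ≤ L * ‖p - q‖) (p q : E) :
    h p + inner ℝ (h' p) (q - p) - L / 2 * ‖q - p‖ ^ 2 ≤ h q := by
  have h1 : ∀ p, HasGradientAt (fun x => -h x) (-h' p) p := by
    intro p
    rw [hasGradientAt_iff_hasFDerivAt, map_neg]
    exact (hh p).hasFDerivAt.neg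
  have := le_quadratic_of_gradient_lipschitz (L := L) h1
    (fun p q => by rw [← neg_sub_neg, neg_neg, neg_neg, norm_sub_rev]; exact hL p q) p q
  rw [inner_neg_left] at this
  linarith

theorem quadratic_le_of_strongConvexOn {h : E → ℝ} {h' : E} {m : ℝ} {p : E}
    (hc : StrongConvexOn Set.univ m h) (hh : HasGradientAt h h' p) (q : E) :
    h p + inner ℝ h' (q - p) + m / 2 * ‖q - p‖ ^ 2 ≤ h q := by
  set d := q - p with hd
  have h1 : HasDerivAt (fun s : ℝ => p + s • d) d 0 := by
    simpa using ((hasDerivAt_id (0 : ℝ)).smul_const d).const_add p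
  have h2 : HasDerivAt (fun s : ℝ => h (p + s • d)) (inner ℝ h' d) 0 := by
    have h0 : HasFDerivAt h (InnerProductSpace.toDual ℝ E h') (p + (0 : ℝ) • d) := by
      simpa using hh.hasFDerivAt
    have := h0.comp_hasDerivAt (0 : ℝ) h1
    simpa [Function.comp_def] using this
  have h3 := h2.tendsto_slope_zero_right
  have h4 : Filter.Tendsto (fun t : ℝ => h q - h p - (1 - t) * (m / 2 * ‖d‖ ^ 2))
      (nhdsWithin 0 (Set.Ioi 0)) (nhds (h q - h p - (1 - 0) * (m / 2 * ‖d‖ ^ 2))) := by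
    apply Filter.Tendsto.mono_left _ nhdsWithin_le_nhds
    exact (Continuous.tendsto (by fun_prop) 0)
  have h5 := le_of_tendsto_of_tendsto h3 h4 (by
    filter_upwards [Ioo_mem_nhdsGT (zero_lt_one' ℝ)] with t ht
    have := hc.2 (Set.mem_univ p) (Set.mem_univ q) (sub_nonneg.2 ht.2.le) ht.1.le (by ring)
    have e : (1 - t) • p + t • q = p + t • d := by rw [hd]; module
    rw [e, norm_sub_rev] at this
    simp only [zero_add, zero_smul, add_zero, smul_eq_mul] at this ⊢
    rw [inv_mul_le_iff₀ ht.1]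
    nlinarith)
  linarith

end FirstOrder

/-! ### The product space -/

section Product

variable {dx dy : ℕ}

@[simp] theorem pt_fst (x : Vec dx) (y : Vec dy) : (pt x y).fst = x := rfl
@[simp] theorem pt_snd (x : Vec dx) (y : Vec dy) : (pt x y).snd = y := rfl

theorem pt_sub_pt (x x' : Vec dx) (y y' : Vec dy) : pt x y - pt x' y' = pt (x - x') (y - y') := rfl

theorem norm_sq_joint (p : Joint dx dy) : ‖p‖ ^ 2 = ‖p.fst‖ ^ 2 + ‖p.snd‖ ^ 2 :=
  WithLp.prod_norm_sq_eq_of_L2 p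

theorem inner_joint (p q : Joint dx dy) :
    inner ℝ p q = inner ℝ p.fst q.fst + inner ℝ p.snd q.snd :=
  WithLp.prod_inner_apply p q

theorem norm_fst_le_joint (p : Joint dx dy) : ‖p.fst‖ ≤ ‖p‖ :=
  WithLp.norm_fst_le _ p

theorem norm_snd_le_joint (p : Joint dx dy) : ‖p.snd‖ ≤ ‖p‖ :=
  WithLp.norm_snd_le _ p

@[simp] theorem norm_pt_zero_left (y : Vec dy) : ‖(pt 0 y : Joint dx dy)‖ = ‖y‖ := by
  rw [← sq_eq_sq₀ (norm_nonneg _) (norm_nonneg _), norm_sq_joint]; simp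

@[simp] theorem norm_pt_zero_right (x : Vec dx) : ‖(pt x 0 : Joint dx dy)‖ = ‖x‖ := by
  rw [← sq_eq_sq₀ (norm_nonneg _) (norm_nonneg _), norm_sq_joint]; simp

theorem continuous_pt : Continuous fun q : Vec dx × Vec dy => pt q.1 q.2 :=
  WithLp.prod_continuous_toLp 2 _ _

/-- `h` is differentiable with gradient `h'`, the gradient is `L`-Lipschitz, and `h(x, ·)`
is `m`-strongly convex, stated as the first-order lower bound. Both `g` and the penalized
objective `g + f / λ` are of this kind. -/
structure IsLowerLevel (m L : ℝ) (h : Joint dx dy → ℝ) (h' : Joint dx dy → Joint dx dy) :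
    Prop where
  m_pos : 0 < m
  grad : ∀ p, HasGradientAt h (h' p) p
  lip : ∀ p q, ‖h' p - h' q‖ ≤ L * ‖p - q‖
  lower : ∀ x y y', h (pt x y) + inner ℝ (h' (pt x y)).snd (y' - y) + m / 2 * ‖y' - y‖ ^ 2
    ≤ h (pt x y')

namespace IsLowerLevel

variable {m L : ℝ} {h : Joint dx dy → ℝ} {h' : Joint dx dy → Joint dx dy}

theorem upper (H : IsLowerLevel m L h h') (x : Vec dx) (y y' : Vec dy) :
    h (pt x y') ≤ h (pt x y) + inner ℝ (h' (pt x y)).snd (y' - y) + L / 2 * ‖y' - y‖ ^ 2 := by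
  have := le_quadratic_of_gradient_lipschitz H.grad H.lip (pt x y) (pt x y')
  rw [pt_sub_pt, sub_self, norm_pt_zero_left, inner_joint] at this
  simpa using this

theorem monotone (H : IsLowerLevel m L h h') (x : Vec dx) (y y' : Vec dy) :
    m * ‖y' - y‖ ^ 2 ≤ inner ℝ ((h' (pt x y')).snd - (h' (pt x y)).snd) (y' - y) := by
  have h1 := H.lower x y y'
  have h2 := H.lower x y' y
  rw [norm_sub_rev, ← neg_sub y' y, inner_neg_right] at h2
  rw [inner_sub_left]
  linarith

theorem mul_norm_le (H : IsLowerLevel m L h h') (x : Vec dx) (y y' : Vec dy) :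
    m * ‖y' - y‖ ≤ ‖(h' (pt x y')).snd - (h' (pt x y)).snd‖ := by
  rcases eq_or_lt_of_le (norm_nonneg (y' - y)) with h0 | h0
  · rw [← h0, mul_zero]; exact norm_nonneg _
  · have h1 := H.monotone x y y'
    have h2 := real_inner_le_norm ((h' (pt x y')).snd - (h' (pt x y)).snd) (y' - y)
    rw [← mul_le_mul_iff_left₀ h0]
    nlinarith

theorem exists_minimizer (H : IsLowerLevel m L h h') (x : Vec dx) :
    ∃ y, ∀ y', h (pt x y) ≤ h (pt x y') := by
  have hc : Continuous h := continuous_of_hasGradientAt H.grad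
  have hp : Continuous fun y : Vec dy => pt x y :=
    continuous_pt.comp (Continuous.prodMk_right x)
  have hcont : Continuous fun y => h (pt x y) := hc.comp hp
  refine hcont.exists_forall_le ?_
  have hm := H.m_pos
  set b := ‖(h' (pt x 0)).snd‖
  have h1 : ∀ y, h (pt x 0) - b * ‖y‖ + m / 2 * ‖y‖ ^ 2 ≤ h (pt x y) := by
    intro y
    have h2 := H.lower x 0 y
    rw [sub_zero] at h2
    have h3 := neg_le_of_abs_le (abs_real_inner_le_norm (h' (pt x 0)).snd y)
    linarith
  refine Filter.tendsto_atTop_mono h1 ?_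
  have h2 : Filter.Tendsto (fun r : ℝ => h (pt x 0) + r * (m / 2 * r + -b))
      Filter.atTop Filter.atTop := by
    have h3 : Filter.Tendsto (fun r : ℝ => m / 2 * r + -b) Filter.atTop Filter.atTop :=
      Filter.tendsto_atTop_add_const_right _ _
        (Filter.tendsto_id.const_mul_atTop (half_pos hm))
    have h4 : Filter.Tendsto (fun r : ℝ => r) Filter.atTop Filter.atTop := Filter.tendsto_id
    have h5 : Filter.Tendsto (fun r : ℝ => r * (m / 2 * r + -b)) Filter.atTop Filter.atTop :=
      h4.atTop_mul_atTop₀ h3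
    exact Filter.tendsto_atTop_add_const_left Filter.atTop (h (pt x 0)) h5
  refine (h2.comp (tendsto_norm_cocompact_atTop (E := Vec dy))).congr fun y => ?_
  simp only [Function.comp]; ring

theorem grad_snd_eq_zero (H : IsLowerLevel m L h h') {x : Vec dx} {y : Vec dy}
    (hy : ∀ y', h (pt x y) ≤ h (pt x y')) : (h' (pt x y)).snd = 0 := by
  set d : Joint dx dy := pt 0 (h' (pt x y)).snd with hd
  have h1 := hasDerivAt_along_line H.grad (pt x y) d 0
  have h2 : IsLocalMin (fun s : ℝ => h (pt x y + s • d)) 0 := by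
    refine Filter.Eventually.of_forall fun s => ?_
    have e : pt x y + s • d = pt x (y + s • (h' (pt x y)).snd) := by
      have : s • d = pt 0 (s • (h' (pt x y)).snd) := by
        rw [hd]; exact congrArg (fun a => pt a _) (smul_zero s)
      rw [this]; exact congrArg (fun a => pt a _) (add_zero x)
    simp only [zero_smul, add_zero]
    rw [e]
    exact hy _
  have h3 := h2.hasDerivAt_eq_zero h1
  simp only [zero_smul, add_zero] at h3
  rw [inner_joint] at h3
  simpa [hd] using h3

/-- The minimizers of `h(x, ·)` depend on `x` with Lipschitz constant `L / m`. -/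
theorem mul_norm_minimizer_sub_le (H : IsLowerLevel m L h h') {x x' : Vec dx} {y y' : Vec dy}
    (hy : (h' (pt x y)).snd = 0) (hy' : (h' (pt x' y')).snd = 0) :
    m * ‖y' - y‖ ≤ L * ‖x' - x‖ := by
  have h1 := H.mul_norm_le x y y'
  rw [hy, ← hy'] at h1
  refine h1.trans (((norm_snd_le_joint (h' (pt x y') - h' (pt x' y'))).trans
    (H.lip _ _)).trans_eq ?_)
  rw [pt_sub_pt, sub_self, norm_pt_zero_right, norm_sub_rev]

/-- A gradient step of length `α ≤ 1 / L` contracts the squared distance to the minimizer by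
`1 - α m`. -/
theorem gradient_step_contracts (H : IsLowerLevel m L h h') {α : ℝ} (hα : 0 ≤ α) (hαL : α * L ≤ 1)
    (hL : 0 < L) {x : Vec dx} {w : Vec dy} (hw : ∀ y', h (pt x w) ≤ h (pt x y')) (y : Vec dy) :
    ‖y - α • (h' (pt x y)).snd - w‖ ^ 2 ≤ (1 - α * m) * ‖y - w‖ ^ 2 := by
  set D := (h' (pt x y)).snd
  have h1 := H.lower x y w
  -- The decrease `‖D‖² / (2 L)` of one exact step bounds the gradient by the optimality gap.
  have h2 := H.upper x y (y - L⁻¹ • D)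
  have h3 := hw (y - L⁻¹ • D)
  have e1 : y - L⁻¹ • D - y = -(L⁻¹ • D) := by abel
  rw [e1, inner_neg_right, real_inner_smul_right, norm_neg, norm_smul, real_inner_self_eq_norm_sq,
    Real.norm_of_nonneg (by positivity), mul_pow] at h2
  have h4 : ‖D‖ ^ 2 ≤ 2 * L * (h (pt x y) - h (pt x w)) := by
    have e2 : L / 2 * (L⁻¹ ^ 2 * ‖D‖ ^ 2) = L⁻¹ * ‖D‖ ^ 2 / 2 := by field_simp
    rw [e2] at h2
    have h5 : L⁻¹ * ‖D‖ ^ 2 ≤ 2 * (h (pt x y) - h (pt x w)) := by linarith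
    rw [inv_mul_le_iff₀ hL] at h5
    linarith
  have e3 : y - α • D - w = (y - w) - α • D := by abel
  rw [e3, norm_sub_sq_real, real_inner_smul_right, norm_smul, Real.norm_of_nonneg hα, mul_pow,
    real_inner_comm]
  rw [← neg_sub y w, inner_neg_right, norm_neg] at h1
  have h6 : 0 ≤ h (pt x y) - h (pt x w) := sub_nonneg.2 (hw y)
  have h7 : α ^ 2 * ‖D‖ ^ 2 ≤ 2 * α * (h (pt x y) - h (pt x w)) := by
    have := mul_le_mul_of_nonneg_left h4 (sq_nonneg α)
    nlinarith [mul_nonneg hα h6]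
  nlinarith [mul_le_mul_of_nonneg_left h1 hα]

end IsLowerLevel

end Product

/-! ### Derivatives of the upper- and lower-level objectives -/

section Hessian

variable {E : Type*} [NormedAddCommGroup E] [InnerProductSpace ℝ E] [CompleteSpace E]

/-- The Riesz identification `E* ≃ E`, as a real linear isometry. -/
def rieszSymm (E : Type*) [NormedAddCommGroup E] [InnerProductSpace ℝ E] [CompleteSpace E] :
    StrongDual ℝ E →ₗᵢ[ℝ] E where
  toFun := (InnerProductSpace.toDual ℝ E).symm
  map_add' := map_add _
  map_smul' r x := by simp
  norm_map' := (InnerProductSpace.toDual ℝ E).symm.norm_map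

theorem differentiable_fderiv {E : Type*} [NormedAddCommGroup E] [NormedSpace ℝ E] {g : E → ℝ}
    (hg : ContDiff ℝ 2 g) : Differentiable ℝ (fderiv ℝ g) :=
  (hg.fderiv_right (m := 1) (by norm_num)).differentiable (by norm_num)

theorem hasFDerivAt_gradient {g : E → ℝ} (hg : ContDiff ℝ 2 g) (p : E) :
    HasFDerivAt (gradient g)
      ((rieszSymm E).toContinuousLinearMap.comp (fderiv ℝ (fderiv ℝ g) p)) p :=
  (rieszSymm E).toContinuousLinearMap.hasFDerivAt.comp p (differentiable_fderiv hg p).hasFDerivAt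

theorem differentiable_gradient {g : E → ℝ} (hg : ContDiff ℝ 2 g) :
    Differentiable ℝ (gradient g) :=
  fun p => (hasFDerivAt_gradient hg p).differentiableAt

theorem fderiv_gradient_symm {g : E → ℝ} (hg : ContDiff ℝ 2 g) (p u w : E) :
    inner ℝ (fderiv ℝ (gradient g) p u) w = inner ℝ (fderiv ℝ (gradient g) p w) u := by
  have hs : IsSymmSndFDerivAt ℝ g p :=
    hg.contDiffAt.isSymmSndFDerivAt (by simp [minSmoothness_of_isRCLikeNormedField])
  have h1 : ∀ u w, inner ℝ (fderiv ℝ (gradient g) p u) w = fderiv ℝ (fderiv ℝ g) p u w := by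
    intro u w
    rw [(hasFDerivAt_gradient hg p).fderiv]
    exact InnerProductSpace.toDual_symm_apply
  rw [h1, h1, hs.eq]

/-- First-order Taylor expansion of a gradient with `ρ`-Lipschitz derivative. -/
theorem norm_gradient_sub_sub_le {g : E → ℝ} {ρ : ℝ} (hg : ContDiff ℝ 2 g)
    (hρ : ∀ p q, ‖fderiv ℝ (gradient g) p - fderiv ℝ (gradient g) q‖ ≤ ρ * ‖p - q‖) (p q : E) :
    ‖gradient g q - gradient g p - fderiv ℝ (gradient g) p (q - p)‖ ≤ ρ * ‖q - p‖ ^ 2 := by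
  rcases eq_or_ne q p with rfl | hne
  · simp
  have hρ0 : 0 ≤ ρ := by
    have := (norm_nonneg _).trans (hρ q p)
    exact nonneg_of_mul_nonneg_left this (norm_pos_iff.2 (sub_ne_zero.2 hne))
  refine ((convex_segment p q).norm_image_sub_le_of_norm_fderiv_le' (𝕜 := ℝ)
    (C := ρ * ‖q - p‖) (fun s _ => differentiable_gradient hg s) (fun s hs => ?_)
    (left_mem_segment ℝ p q) (right_mem_segment ℝ p q)).trans_eq (by ring)
  refine (hρ s p).trans (mul_le_mul_of_nonneg_left ?_ hρ0)
  obtain ⟨t, ht, rfl⟩ := segment_eq_image_lineMap ℝ p q ▸ hs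
  rw [AffineMap.lineMap_apply, vsub_eq_sub, vadd_eq_add, add_sub_cancel_right, norm_smul,
    Real.norm_of_nonneg ht.1]
  exact mul_le_of_le_one_left (norm_nonneg _) ht.2

theorem norm_fderiv_gradient_le {g : E → ℝ} {L : ℝ} (hg : ContDiff ℝ 2 g) (hL0 : 0 ≤ L)
    (hL : ∀ p q, ‖gradient g p - gradient g q‖ ≤ L * ‖p - q‖) (p : E) :
    ‖fderiv ℝ (gradient g) p‖ ≤ L :=
  (differentiable_gradient hg p).hasFDerivAt.le_of_lip' hL0
    (Filter.Eventually.of_forall fun q => hL q p)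

end Hessian

section Objectives

variable {dx dy : ℕ}

theorem hasGradientAt_of_contDiff {g : Joint dx dy → ℝ} (hg : ContDiff ℝ 2 g) (p : Joint dx dy) :
    HasGradientAt g (gradient g p) p :=
  ((hg.differentiable (by norm_num)) p).hasGradientAt

variable {c : Consts} {f g : Joint dx dy → ℝ}

theorem pt_line (p : Joint dx dy) (w : Vec dy) (s : ℝ) :
    p + s • pt 0 w = pt p.fst (p.snd + s • w) := by
  have : s • (pt 0 w : Joint dx dy) = pt 0 (s • w) := congrArg (fun a => pt a _) (smul_zero s)
  rw [this]
  exact congrArg (fun a => pt a _) (add_zero p.fst)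

namespace Regular

theorem isLowerLevel (h : Regular c f g) : IsLowerLevel c.μ c.Lg g (gradient g) where
  m_pos := h.μ_pos
  grad := hasGradientAt_of_contDiff h.g_contDiff
  lip := h.g_gradLip
  lower x y y' := by
    have hG := hasGradientAt_of_contDiff h.g_contDiff (pt x y)
    have hp : HasFDerivAt (fun y : Vec dy => pt x y)
        (((WithLp.prodContinuousLinearEquiv 2 ℝ (Vec dx) (Vec dy)).symm :
          (Vec dx × Vec dy) →L[ℝ] Joint dx dy).comp (ContinuousLinearMap.inr ℝ (Vec dx) (Vec dy)))
        y :=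
      ((WithLp.prodContinuousLinearEquiv 2 ℝ (Vec dx) (Vec dy)).symm.hasFDerivAt).comp y
        (hasFDerivAt_prodMk_right x y)
    have hy : HasGradientAt (fun y => g (pt x y)) (gradient g (pt x y)).snd y := by
      rw [hasGradientAt_iff_hasFDerivAt]
      refine (hG.hasFDerivAt.comp y hp).congr_fderiv ?_
      ext w
      change inner ℝ (gradient g (pt x y)) (pt 0 w) = inner ℝ (gradient g (pt x y)).snd w
      rw [inner_joint]; simp
    exact quadratic_le_of_strongConvexOn (h.g_strongConvex x) hy y'

theorem yStar_le (h : Regular c f g) (x : Vec dx) (y : Vec dy) :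
    g (pt x (yStar g x)) ≤ g (pt x y) :=
  Classical.epsilon_spec (h.isLowerLevel.exists_minimizer x) y

theorem gradient_yStar (h : Regular c f g) (x : Vec dx) :
    (gradient g (pt x (yStar g x))).snd = 0 :=
  h.isLowerLevel.grad_snd_eq_zero (h.yStar_le x)

theorem Cf_nonneg [Nontrivial (Vec dy)] (h : Regular c f g) : 0 ≤ c.Cf := by
  obtain ⟨y, y', hne⟩ := exists_pair_ne (Vec dy)
  exact nonneg_of_mul_nonneg_left ((abs_nonneg _).trans (h.f_lip 0 y y'))
    (norm_pos_iff.2 (sub_ne_zero.2 hne))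

theorem Lf_nonneg [Nontrivial (Vec dy)] (h : Regular c f g) : 0 ≤ c.Lf := by
  obtain ⟨y, y', hne⟩ := exists_pair_ne (Vec dy)
  refine nonneg_of_mul_nonneg_left ((norm_nonneg _).trans (h.f_gradLip (pt 0 y) (pt 0 y'))) ?_
  rw [pt_sub_pt, sub_self, norm_pt_zero_left]
  exact norm_pos_iff.2 (sub_ne_zero.2 hne)

theorem ρg_nonneg [Nontrivial (Vec dy)] (h : Regular c f g) : 0 ≤ c.ρg := by
  obtain ⟨y, y', hne⟩ := exists_pair_ne (Vec dy)
  refine nonneg_of_mul_nonneg_left ((norm_nonneg _).trans (h.g_hessLip (pt 0 y) (pt 0 y'))) ?_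
  rw [pt_sub_pt, sub_self, norm_pt_zero_left]
  exact norm_pos_iff.2 (sub_ne_zero.2 hne)

theorem μ_le_Lg [Nontrivial (Vec dy)] (h : Regular c f g) : c.μ ≤ c.Lg := by
  obtain ⟨y, y', hne⟩ := exists_pair_ne (Vec dy)
  have h1 := (h.isLowerLevel.mul_norm_le 0 y y').trans
    ((norm_snd_le_joint (gradient g (pt 0 y') - gradient g (pt 0 y))).trans (h.g_gradLip _ _))
  rw [pt_sub_pt, sub_self, norm_pt_zero_left] at h1
  exact le_of_mul_le_mul_right h1 (norm_pos_iff.2 (sub_ne_zero.2 hne.symm))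

theorem Lg_pos [Nontrivial (Vec dy)] (h : Regular c f g) : 0 < c.Lg := h.μ_pos.trans_le h.μ_le_Lg

theorem norm_gradient_snd_le [Nontrivial (Vec dy)] (h : Regular c f g) (p : Joint dx dy) :
    ‖(gradient f p).snd‖ ≤ c.Cf := by
  set w := (gradient f p).snd with hw
  have h1 := hasDerivAt_along_line (hasGradientAt_of_contDiff h.f_contDiff) p (pt 0 w) 0
  rw [zero_smul, add_zero, inner_joint] at h1
  simp only [pt_fst, pt_snd, inner_zero_right, zero_add, ← hw, real_inner_self_eq_norm_sq] at h1
  have hC := h.Cf_nonneg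
  have h2 := h1.hasFDerivAt.le_of_lip' (C := c.Cf * ‖w‖) (by positivity)
    (Filter.Eventually.of_forall fun s => by
      rw [pt_line, pt_line, Real.norm_eq_abs]
      refine (h.f_lip _ _ _).trans_eq ?_
      rw [add_sub_add_left_eq_sub, ← sub_smul, norm_smul]; ring)
  have h3 := (ContinuousLinearMap.toSpanSingleton ℝ (‖w‖ ^ 2)).le_opNorm (1 : ℝ)
  simp only [ContinuousLinearMap.toSpanSingleton_apply, one_smul, norm_one, mul_one, norm_pow,
    norm_norm] at h3
  have h4 := h3.trans h2
  by_contra! hlt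
  nlinarith [norm_nonneg w]

end Regular

end Objectives

/-! ### Problem constants -/

section Constants

variable (c : Consts)

theorem Consts.Cf_le_ell : c.Cf ≤ c.ell := (le_max_left _ _).trans (le_max_left _ _)
theorem Consts.Lf_le_ell : c.Lf ≤ c.ell := (le_max_right _ _).trans (le_max_left _ _)
theorem Consts.Lg_le_ell : c.Lg ≤ c.ell := (le_max_left _ _).trans (le_max_right _ _)
theorem Consts.ρg_le_ell : c.ρg ≤ c.ell := (le_max_right _ _).trans (le_max_right _ _)

variable {c}

theorem Consts.kappa_mul_μ (hμ : 0 < c.μ) : c.kappa * c.μ = c.ell :=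
  div_mul_cancel₀ _ hμ.ne'

theorem Consts.one_le_kappa (hμ : 0 < c.μ) (hL : c.μ ≤ c.Lg) : 1 ≤ c.kappa :=
  (one_le_div hμ).2 (hL.trans c.Lg_le_ell)

theorem Consts.ell_pos (hμ : 0 < c.μ) (hL : c.μ ≤ c.Lg) : 0 < c.ell :=
  hμ.trans_le (hL.trans c.Lg_le_ell)

end Constants

/-! ### The hyper-gradient -/

section HyperGradient

variable {dx dy : ℕ} {c : Consts} {f g : Joint dx dy → ℝ}

/-- A function with a quadratically accurate affine model is differentiable. -/
theorem hasGradientAt_of_abs_sub_le {E : Type*} [NormedAddCommGroup E] [InnerProductSpace ℝ E]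
    [CompleteSpace E] {φ : E → ℝ} {D x : E} {K : ℝ}
    (h : ∀ x', |φ x' - φ x - inner ℝ D (x' - x)| ≤ K * ‖x' - x‖ ^ 2) : HasGradientAt φ D x := by
  rw [hasGradientAt_iff_isLittleO]
  have h1 : (fun x' => φ x' - φ x - inner ℝ D (x' - x)) =O[nhds x] fun x' => ‖x' - x‖ ^ 2 :=
    Asymptotics.IsBigO.of_bound K (Filter.Eventually.of_forall fun x' => by
      simpa using h x')
  refine h1.trans_isLittleO ?_
  have h2 : Filter.Tendsto (fun x' : E => x' - x) (nhds x) (nhds 0) := by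
    have : Continuous fun x' : E => x' - x := by fun_prop
    simpa using this.tendsto x
  exact (Asymptotics.isLittleO_norm_pow_id one_lt_two).comp_tendsto h2

namespace Regular

/-- Strong convexity of `g(x, ·)` at second order, obtained from its first-order form between `p` and
`p + t (0, w)` by letting `t → 0`. -/
theorem hessian_coercive (h : Regular c f g) (p : Joint dx dy) (w : Vec dy) :
    c.μ * ‖w‖ ≤ ‖(fderiv ℝ (gradient g) p (pt 0 w)).snd‖ := by
  refine le_of_forall_pos_le_add fun ε hε => ?_
  set K := c.ρg * ‖w‖ ^ 2
  set t := ε / (|K| + 1) with ht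
  have hK : 0 < |K| + 1 := by positivity
  have ht0 : 0 < t := by positivity
  have h6 := h.isLowerLevel.mul_norm_le p.fst p.snd (p.snd + t • w)
  rw [add_sub_cancel_left, norm_smul, Real.norm_of_nonneg ht0.le, ← pt_line] at h6
  have h7 := norm_gradient_sub_sub_le h.g_contDiff h.g_hessLip p (p + t • pt 0 w)
  rw [add_sub_cancel_left, map_smul, norm_smul, norm_pt_zero_left, Real.norm_of_nonneg ht0.le]
    at h7
  have h8 := (norm_snd_le_joint _).trans h7
  rw [WithLp.sub_snd, WithLp.sub_snd, WithLp.smul_snd] at h8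
  have h9 := norm_le_norm_add_norm_sub' ((gradient g (p + t • pt 0 w)).snd - (gradient g p).snd)
    (t • (fderiv ℝ (gradient g) p (pt 0 w)).snd)
  rw [norm_smul, Real.norm_of_nonneg ht0.le] at h9
  have h10 : t * (c.μ * ‖w‖) ≤ t * (‖(fderiv ℝ (gradient g) p (pt 0 w)).snd‖ + t * K) := by
    have : c.ρg * (t * ‖w‖) ^ 2 = t * (t * K) := by simp only [K]; ring
    have e : (gradient g (pt p.fst p.snd)) = gradient g p := rfl
    rw [e] at h6
    linarith
  refine (le_of_mul_le_mul_left h10 ht0).trans (add_le_add_right ?_ _)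
  rw [ht, div_mul_eq_mul_div, div_le_iff₀ hK]
  nlinarith [le_abs_self K]

theorem norm_yStar_sub_yStar_le (h : Regular c f g) (x x' : Vec dx) :
    ‖yStar g x' - yStar g x‖ ≤ c.Lg / c.μ * ‖x' - x‖ := by
  have h1 := h.isLowerLevel.mul_norm_minimizer_sub_le (h.gradient_yStar x) (h.gradient_yStar x')
  rw [div_mul_eq_mul_div, le_div_iff₀ h.μ_pos]
  linarith

/-- The block `∇²_yy g` is invertible, with inverse bounded by `1 / μ`. -/
theorem exists_hessian_solve (h : Regular c f g) (p : Joint dx dy) (b : Vec dy) :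
    ∃ v, (fderiv ℝ (gradient g) p (pt 0 v)).snd = b ∧ c.μ * ‖v‖ ≤ ‖b‖ := by
  let M : Vec dy →ₗ[ℝ] Vec dy :=
    { toFun := fun w => (fderiv ℝ (gradient g) p (pt 0 w)).snd
      map_add' := fun a b => by
        have : (pt 0 (a + b) : Joint dx dy) = pt 0 a + pt 0 b :=
          congrArg (fun z => pt z (a + b)) (add_zero 0).symm
        rw [this, map_add, WithLp.add_snd]
      map_smul' := fun r a => by
        have : (pt 0 (r • a) : Joint dx dy) = r • pt 0 a :=
          congrArg (fun z => pt z (r • a)) (smul_zero r).symm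
        rw [this, map_smul, WithLp.smul_snd]; rfl }
  have hinj : Function.Injective M := by
    rw [injective_iff_map_eq_zero]
    intro w hw
    have h1 := h.hessian_coercive p w
    have h2 : (fderiv ℝ (gradient g) p (pt 0 w)).snd = 0 := hw
    rw [h2, norm_zero] at h1
    exact norm_le_zero_iff.1 (nonpos_of_mul_nonpos_right h1 h.μ_pos)
  obtain ⟨v, hv⟩ := LinearMap.injective_iff_surjective.1 hinj b
  refine ⟨v, hv, ?_⟩
  have := h.hessian_coercive p v
  rwa [show (fderiv ℝ (gradient g) p (pt 0 v)).snd = b from hv] at this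

variable [Nontrivial (Vec dy)]

/-- The adjoint variable `v = (∇²_yy g)⁻¹ ∇_y f` at `(x, y*(x))` and the hyper-gradient
`D = ∇_x f - ∇²_xy g v`; together they are characterized by `∇f - ∇²g (0, v) = (D, 0)`. Since
`y ↦ ⟨v, ∇_y g⟩` vanishes along `y*`, the hyper-objective is quadratically close to its affine
model with slope `D`. -/
theorem exists_hyper_expansion (h : Regular c f g) (x : Vec dx) :
    ∃ (D : Vec dx) (v : Vec dy),
      gradient f (pt x (yStar g x)) =
        pt D 0 + fderiv ℝ (gradient g) (pt x (yStar g x)) (pt 0 v) ∧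
      ∀ x', |hyper f g x' - hyper f g x - inner ℝ D (x' - x)|
        ≤ 3 * (c.ell * c.kappa ^ 3) * ‖x' - x‖ ^ 2 := by
  set p := pt x (yStar g x) with hp
  obtain ⟨v, hv, hvn⟩ := h.exists_hessian_solve p (gradient f p).snd
  set A := fderiv ℝ (gradient g) p with hA
  refine ⟨(gradient f p - A (pt 0 v)).fst, v, ?_, fun x' => ?_⟩
  · rw [← sub_eq_iff_eq_add]
    have : (gradient f p - A (pt 0 v)).snd = 0 := by rw [WithLp.sub_snd, hv, sub_self]
    rw [← this]; rfl
  set q := pt x' (yStar g x') with hq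
  set D := (gradient f p - A (pt 0 v)).fst with hD
  have hqp : q - p = pt (x' - x) (yStar g x' - yStar g x) := pt_sub_pt _ _ _ _
  have hμ := h.μ_pos
  have hμL := h.μ_le_Lg
  have hCf := h.Cf_nonneg
  have hLf := h.Lf_nonneg
  have hρ := h.ρg_nonneg
  have hκ := Consts.one_le_kappa hμ hμL
  have hκμ := Consts.kappa_mul_μ hμ
  have hell := Consts.ell_pos hμ hμL
  have hvκ : ‖v‖ ≤ c.kappa := by
    have := hvn.trans ((h.norm_gradient_snd_le p).trans c.Cf_le_ell)
    rw [← hκμ, mul_comm] at this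
    exact le_of_mul_le_mul_right this hμ
  have hdist : ‖q - p‖ ^ 2 ≤ 2 * c.kappa ^ 2 * ‖x' - x‖ ^ 2 := by
    have h1 : ‖yStar g x' - yStar g x‖ ≤ c.kappa * ‖x' - x‖ := by
      have h2 := h.isLowerLevel.mul_norm_minimizer_sub_le (h.gradient_yStar x) (h.gradient_yStar x')
      have h3 := h2.trans (mul_le_mul_of_nonneg_right c.Lg_le_ell (norm_nonneg _))
      rw [← hκμ] at h3
      nlinarith
    have h2 := pow_le_pow_left₀ (norm_nonneg _) h1 2
    rw [hqp, norm_sq_joint, pt_fst, pt_snd]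
    nlinarith [mul_nonneg (sub_nonneg.2 (one_le_pow₀ hκ : 1 ≤ c.kappa ^ 2))
      (sq_nonneg ‖x' - x‖)]
  have hf1 := le_quadratic_of_gradient_lipschitz (hasGradientAt_of_contDiff h.f_contDiff)
    h.f_gradLip p q
  have hf2 := quadratic_le_of_gradient_lipschitz (hasGradientAt_of_contDiff h.f_contDiff)
    h.f_gradLip p q
  -- The second-order remainder of `∇_y g` along `y*`, where `∇_y g` vanishes.
  have hrem : ‖(A (q - p)).snd‖ ≤ c.ρg * ‖q - p‖ ^ 2 := by
    have h1 := (norm_snd_le_joint _).trans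
      (norm_gradient_sub_sub_le h.g_contDiff h.g_hessLip p q)
    rwa [WithLp.sub_snd, WithLp.sub_snd, h.gradient_yStar, h.gradient_yStar, sub_self, zero_sub,
      norm_neg] at h1
  have hinner : inner ℝ (gradient f p) (q - p)
      = inner ℝ D (x' - x) + inner ℝ (A (q - p)).snd v := by
    have h1 : gradient f p = (gradient f p - A (pt 0 v)) + A (pt 0 v) := by abel
    rw [h1, inner_add_left, fderiv_gradient_symm h.g_contDiff, inner_joint _ (pt 0 v),
      inner_joint (gradient f p - A (pt 0 v)), WithLp.sub_snd, hv, sub_self, hqp]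
    simp [hD, hA]
  have hcross : |inner ℝ (A (q - p)).snd v| ≤ c.ρg * ‖q - p‖ ^ 2 * ‖v‖ :=
    (abs_real_inner_le_norm _ _).trans (mul_le_mul_of_nonneg_right hrem (norm_nonneg _))
  have hmain : |f q - f p - inner ℝ D (x' - x)| ≤ (c.Lf / 2 + c.ρg * ‖v‖) * ‖q - p‖ ^ 2 := by
    rw [hinner] at hf1 hf2
    obtain ⟨h1, h2⟩ := abs_le.1 hcross
    rw [abs_le]; constructor <;> nlinarith
  refine hmain.trans ?_
  have hcoef : c.Lf / 2 + c.ρg * ‖v‖ ≤ 3 / 2 * (c.ell * c.kappa) := by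
    have h1 := c.Lf_le_ell
    have h2 := mul_le_mul c.ρg_le_ell hvκ (norm_nonneg _) hell.le
    nlinarith
  refine (mul_le_mul hcoef hdist (sq_nonneg _) (by positivity)).trans_eq (by ring)

theorem differentiable_hyper (h : Regular c f g) : Differentiable ℝ (hyper f g) := fun x => by
  obtain ⟨D, v, -, hD⟩ := h.exists_hyper_expansion x
  exact (hasGradientAt_of_abs_sub_le hD).differentiableAt

theorem hyper_le_quadratic (h : Regular c f g) (x x' : Vec dx) :
    hyper f g x' ≤ hyper f g x + inner ℝ (gradient (hyper f g) x) (x' - x)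
      + 3 * (c.ell * c.kappa ^ 3) * ‖x' - x‖ ^ 2 := by
  obtain ⟨D, v, -, hD⟩ := h.exists_hyper_expansion x
  rw [(hasGradientAt_of_abs_sub_le hD).gradient]
  have := (abs_le.1 (hD x')).2
  linarith

end Regular

end HyperGradient

/-! ### The penalized lower-level problem -/

section Penalty

variable {dx dy : ℕ} {c : Consts} {f g : Joint dx dy → ℝ}

/-- The objective `g + f / λ` of the penalized lower-level problem; its minimizer in `y` is that of
`f + λ g`. -/
def penalized (lam : ℝ) (f g : Joint dx dy → ℝ) (p : Joint dx dy) : ℝ := lam⁻¹ * f p + g p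

/-- `y*_λ(x)`, the minimizer of the penalized lower-level problem. -/
def yPen (lam : ℝ) (f g : Joint dx dy → ℝ) (x : Vec dx) : Vec dy := yStar (penalized lam f g) x

/-- The exact counterpart of the hyper-gradient estimator. -/
def surrogateGrad (lam : ℝ) (f g : Joint dx dy → ℝ) (x : Vec dx) (y z : Vec dy) : Vec dx :=
  (gradient f (pt x y)).fst + lam • ((gradient g (pt x y)).fst - (gradient g (pt x z)).fst)

variable {lam : ℝ} [Nontrivial (Vec dy)]

namespace Regular

theorem penalized_isLowerLevel (h : Regular c f g) (hl : 0 < lam) (hlam : 2 * c.Lf ≤ lam * c.μ) :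
    IsLowerLevel (c.μ / 2) (3 / 2 * c.Lg) (penalized lam f g)
      (fun p => lam⁻¹ • gradient f p + gradient g p) where
  m_pos := half_pos h.μ_pos
  grad p := by
    have h1 := (hasGradientAt_of_contDiff h.f_contDiff p).hasFDerivAt
    have h2 := (hasGradientAt_of_contDiff h.g_contDiff p).hasFDerivAt
    rw [hasGradientAt_iff_hasFDerivAt, map_add, map_smulₛₗ]
    exact (h1.const_mul lam⁻¹).add h2
  lip p q := by
    have h1 := h.f_gradLip p q
    have h2 := h.g_gradLip p q
    have e : lam⁻¹ • gradient f p + gradient g p - (lam⁻¹ • gradient f q + gradient g q)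
      = lam⁻¹ • (gradient f p - gradient f q) + (gradient g p - gradient g q) := by module
    rw [e]
    refine (norm_add_le _ _).trans ?_
    rw [norm_smul, Real.norm_of_nonneg (by positivity)]
    have h3 : lam⁻¹ * c.Lf ≤ c.Lg / 2 := by
      rw [inv_mul_le_iff₀ hl]
      nlinarith [h.μ_le_Lg]
    nlinarith [mul_le_mul_of_nonneg_left h1 (inv_pos.2 hl).le,
      mul_le_mul_of_nonneg_right h3 (norm_nonneg (p - q))]
  lower x y y' := by
    have h1 := quadratic_le_of_gradient_lipschitz (hasGradientAt_of_contDiff h.f_contDiff)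
      h.f_gradLip (pt x y) (pt x y')
    rw [pt_sub_pt, sub_self, norm_pt_zero_left, inner_joint] at h1
    simp only [pt_fst, pt_snd, inner_zero_right, zero_add] at h1
    have h2 := h.isLowerLevel.lower x y y'
    have h3 : lam⁻¹ * c.Lf ≤ c.μ / 2 := by
      rw [inv_mul_le_iff₀ hl]; linarith
    have h4 := mul_le_mul_of_nonneg_left h1 (inv_pos.2 hl).le
    have h5 := mul_le_mul_of_nonneg_right h3 (sq_nonneg ‖y' - y‖)
    simp only [penalized, WithLp.add_snd, WithLp.smul_snd, inner_add_left, real_inner_smul_left]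
    linarith

theorem yPen_le (h : Regular c f g) (hl : 0 < lam) (hlam : 2 * c.Lf ≤ lam * c.μ) (x : Vec dx)
    (y : Vec dy) : penalized lam f g (pt x (yPen lam f g x)) ≤ penalized lam f g (pt x y) :=
  Classical.epsilon_spec ((h.penalized_isLowerLevel hl hlam).exists_minimizer x) y

theorem gradient_yPen (h : Regular c f g) (hl : 0 < lam) (hlam : 2 * c.Lf ≤ lam * c.μ)
    (x : Vec dx) :
    lam⁻¹ • (gradient f (pt x (yPen lam f g x))).snd
      + (gradient g (pt x (yPen lam f g x))).snd = 0 :=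
  (h.penalized_isLowerLevel hl hlam).grad_snd_eq_zero (h.yPen_le hl hlam x)

theorem norm_yPen_sub_yPen_le (h : Regular c f g) (hl : 0 < lam) (hlam : 2 * c.Lf ≤ lam * c.μ)
    (x x' : Vec dx) :
    ‖yPen lam f g x' - yPen lam f g x‖ ≤ 3 * (c.Lg / c.μ) * ‖x' - x‖ := by
  have h1 := (h.penalized_isLowerLevel hl hlam).mul_norm_minimizer_sub_le
    (h.gradient_yPen hl hlam x) (h.gradient_yPen hl hlam x')
  have hμ := h.μ_pos
  rw [show 3 * (c.Lg / c.μ) * ‖x' - x‖ = (3 * c.Lg * ‖x' - x‖) / c.μ by ring, le_div_iff₀ hμ]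
  linarith

theorem norm_yPen_sub_yStar_le (h : Regular c f g) (hl : 0 < lam) (hlam : 2 * c.Lf ≤ lam * c.μ)
    (x : Vec dx) : ‖yPen lam f g x - yStar g x‖ ≤ c.kappa / lam := by
  have h1 := h.isLowerLevel.mul_norm_le x (yStar g x) (yPen lam f g x)
  rw [h.gradient_yStar, sub_zero, eq_neg_of_add_eq_zero_right (h.gradient_yPen hl hlam x),
    norm_neg, norm_smul, Real.norm_of_nonneg (inv_pos.2 hl).le] at h1
  have h2 := (h.norm_gradient_snd_le (pt x (yPen lam f g x))).trans c.Cf_le_ell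
  have h3 := mul_le_mul_of_nonneg_left h2 (inv_pos.2 hl).le
  rw [← Consts.kappa_mul_μ h.μ_pos] at h3
  have h4 : c.μ * ‖yPen lam f g x - yStar g x‖ ≤ c.μ * (c.kappa / lam) :=
    (h1.trans h3).trans_eq (by ring)
  exact le_of_mul_le_mul_left h4 h.μ_pos

/-- The bias of the penalty method: with exact inner solutions the surrogate gradient is
`4 ℓ κ³ / λ`-close to the hyper-gradient. -/
theorem norm_surrogateGrad_sub_le (h : Regular c f g) (hl : 0 < lam)
    (hlam : 2 * c.Lf ≤ lam * c.μ) (x : Vec dx) :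
    ‖surrogateGrad lam f g x (yPen lam f g x) (yStar g x) - gradient (hyper f g) x‖
      ≤ 4 * (c.ell * c.kappa ^ 3) / lam := by
  obtain ⟨D, v, hv, hD⟩ := h.exists_hyper_expansion x
  rw [(hasGradientAt_of_abs_sub_le hD).gradient]
  set p := pt x (yStar g x) with hp
  set q := pt x (yPen lam f g x) with hq
  set A := fderiv ℝ (gradient g) p with hA
  set d := yPen lam f g x - yStar g x with hd
  have hqp : q - p = pt 0 d := by rw [hq, hp, pt_sub_pt, sub_self]
  have hμ := h.μ_pos
  have hμL := h.μ_le_Lg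
  have hLf := h.Lf_nonneg
  have hρ := h.ρg_nonneg
  have hκ := Consts.one_le_kappa hμ hμL
  have hκμ := Consts.kappa_mul_μ hμ
  have hell := Consts.ell_pos hμ hμL
  have hdn : ‖d‖ ≤ c.kappa / lam := h.norm_yPen_sub_yStar_le hl hlam x
  set e := (gradient f q - gradient f p)
    + lam • (gradient g q - gradient g p - A (q - p)) with he
  have hen : ‖e‖ ≤ 2 * (c.ell * c.kappa ^ 2) / lam := by
    have h1 := h.f_gradLip q p
    have h2 := norm_gradient_sub_sub_le h.g_contDiff h.g_hessLip p q
    rw [hqp, norm_pt_zero_left] at h1 h2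
    have h3 : ‖e‖ ≤ c.Lf * ‖d‖ + lam * (c.ρg * ‖d‖ ^ 2) := by
      refine (norm_add_le _ _).trans (add_le_add h1 ?_)
      rw [norm_smul, Real.norm_of_nonneg hl.le, hqp]
      exact mul_le_mul_of_nonneg_left h2 hl.le
    have h4 : c.Lf * ‖d‖ ≤ c.ell * (c.kappa / lam) :=
      mul_le_mul c.Lf_le_ell hdn (norm_nonneg _) hell.le
    have h5 : lam * (c.ρg * ‖d‖ ^ 2) ≤ lam * (c.ell * (c.kappa / lam) ^ 2) := by
      have := mul_le_mul c.ρg_le_ell (pow_le_pow_left₀ (norm_nonneg _) hdn 2) (sq_nonneg _) hell.le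
      exact mul_le_mul_of_nonneg_left this hl.le
    have e1 : lam * (c.ell * (c.kappa / lam) ^ 2) = c.ell * c.kappa ^ 2 / lam := by
      field_simp
    have h6 : c.ell * (c.kappa / lam) ≤ c.ell * c.kappa ^ 2 / lam := by
      rw [mul_div_assoc]
      gcongr
      nlinarith
    rw [e1] at h5
    calc ‖e‖ ≤ _ := h3
      _ ≤ c.ell * c.kappa ^ 2 / lam + c.ell * c.kappa ^ 2 / lam := by linarith
      _ = _ := by ring
  -- Both sides of the penalized stationarity system, compared with `∇f = (D, 0) + ∇²g (0, v)`.
  have hsys : gradient f q + lam • (gradient g q - gradient g p) - pt D 0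
      = e + A (pt 0 (lam • d + v)) := by
    have h1 : (pt 0 (lam • d + v) : Joint dx dy) = lam • (q - p) + pt 0 v := by
      rw [hqp]
      have : (lam • pt 0 d : Joint dx dy) = pt 0 (lam • d) :=
        congrArg (fun a => pt a _) (smul_zero lam)
      rw [this]; exact congrArg (fun a => pt a _) (add_zero 0).symm
    rw [h1, map_add, map_smul, he, hv]
    module
  have hsnd : (A (pt 0 (lam • d + v))).snd = -e.snd := by
    have h1 := congrArg WithLp.snd hsys
    simp only [WithLp.sub_snd, WithLp.add_snd, WithLp.smul_snd, pt_snd, sub_zero] at h1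
    have h2 := h.gradient_yPen hl hlam x
    have h3 : lam • (lam⁻¹ • (gradient f q).snd + (gradient g q).snd) = 0 := by
      rw [h2, smul_zero]
    rw [smul_add, smul_smul, mul_inv_cancel₀ hl.ne', one_smul] at h3
    rw [hp, h.gradient_yStar, sub_zero, h3] at h1
    exact eq_neg_of_add_eq_zero_right h1.symm
  have hw : c.μ * ‖lam • d + v‖ ≤ ‖e‖ := by
    have h1 := h.hessian_coercive p (lam • d + v)
    rw [← hA, hsnd, norm_neg] at h1
    exact h1.trans (norm_snd_le_joint e)
  have hAn : ‖A (pt 0 (lam • d + v))‖ ≤ c.kappa * ‖e‖ := by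
    have h1 := A.le_opNorm (pt 0 (lam • d + v))
    rw [norm_pt_zero_left] at h1
    have h2 := (norm_fderiv_gradient_le h.g_contDiff h.Lg_pos.le h.g_gradLip p).trans c.Lg_le_ell
    have h3 := h1.trans (mul_le_mul_of_nonneg_right h2 (norm_nonneg _))
    rw [← hκμ] at h3
    nlinarith
  have hfst : surrogateGrad lam f g x (yPen lam f g x) (yStar g x) - D
      = (e + A (pt 0 (lam • d + v))).fst := by
    rw [← hsys]; rfl
  rw [hfst]
  refine (norm_fst_le_joint _).trans ((norm_add_le _ _).trans ?_)
  calc ‖e‖ + ‖A (pt 0 (lam • d + v))‖ ≤ 2 * c.kappa * ‖e‖ := by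
        nlinarith [norm_nonneg e]
    _ ≤ 2 * c.kappa * (2 * (c.ell * c.kappa ^ 2) / lam) := by gcongr
    _ = _ := by ring

/-- The squared bias of the surrogate gradient at inexact inner solutions. -/
theorem norm_surrogateGrad_sub_sq_le (h : Regular c f g) (hl : 0 < lam)
    (hlam : 2 * c.Lf ≤ lam * c.μ) (x : Vec dx) (y z : Vec dy) :
    ‖surrogateGrad lam f g x y z - gradient (hyper f g) x‖ ^ 2
      ≤ 6 * (c.Lf ^ 2 + lam ^ 2 * c.Lg ^ 2)
          * (‖y - yPen lam f g x‖ ^ 2 + ‖z - yStar g x‖ ^ 2)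
        + 3 * (4 * (c.ell * c.kappa ^ 3) / lam) ^ 2 := by
  set w := yPen lam f g x
  set s := yStar g x
  have h0 := h.norm_surrogateGrad_sub_le hl hlam x
  have hF : ‖(gradient f (pt x y)).fst - (gradient f (pt x w)).fst‖ ≤ c.Lf * ‖y - w‖ := by
    have := (norm_fst_le_joint _).trans (h.f_gradLip (pt x y) (pt x w))
    rwa [pt_sub_pt, sub_self, norm_pt_zero_left] at this
  have hG : ∀ y y', ‖(gradient g (pt x y)).fst - (gradient g (pt x y')).fst‖ ≤ c.Lg * ‖y - y'‖ := by
    intro y y'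
    have := (norm_fst_le_joint _).trans (h.g_gradLip (pt x y) (pt x y'))
    rwa [pt_sub_pt, sub_self, norm_pt_zero_left] at this
  set a := (gradient f (pt x y)).fst - (gradient f (pt x w)).fst
    + lam • ((gradient g (pt x y)).fst - (gradient g (pt x w)).fst) with ha
  set b := lam • ((gradient g (pt x s)).fst - (gradient g (pt x z)).fst) with hb
  set r := surrogateGrad lam f g x w s - gradient (hyper f g) x with hr
  have hdec : surrogateGrad lam f g x y z - gradient (hyper f g) x = a + b + r := by
    rw [ha, hb, hr]; simp only [surrogateGrad]; module
  have han : ‖a‖ ≤ (c.Lf + lam * c.Lg) * ‖y - w‖ := by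
    refine (norm_add_le _ _).trans ?_
    rw [norm_smul, Real.norm_of_nonneg hl.le]
    nlinarith [mul_le_mul_of_nonneg_left (hG y w) hl.le]
  have hbn : ‖b‖ ≤ lam * c.Lg * ‖z - s‖ := by
    rw [norm_smul, Real.norm_of_nonneg hl.le, norm_sub_rev z s]
    nlinarith [mul_le_mul_of_nonneg_left (hG s z) hl.le]
  have ha2 : ‖a‖ ^ 2 ≤ 2 * (c.Lf ^ 2 + lam ^ 2 * c.Lg ^ 2) * ‖y - w‖ ^ 2 := by
    have h1 := pow_le_pow_left₀ (norm_nonneg _) han 2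
    rw [mul_pow] at h1
    refine h1.trans (mul_le_mul_of_nonneg_right ?_ (sq_nonneg _))
    nlinarith [sq_nonneg (c.Lf - lam * c.Lg)]
  have hb2 : ‖b‖ ^ 2 ≤ 2 * (c.Lf ^ 2 + lam ^ 2 * c.Lg ^ 2) * ‖z - s‖ ^ 2 := by
    have h1 := pow_le_pow_left₀ (norm_nonneg _) hbn 2
    rw [mul_pow] at h1
    refine h1.trans (mul_le_mul_of_nonneg_right ?_ (sq_nonneg _))
    nlinarith [sq_nonneg c.Lf, sq_nonneg (lam * c.Lg)]
  have hr2 : ‖r‖ ^ 2 ≤ (4 * (c.ell * c.kappa ^ 3) / lam) ^ 2 :=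
    pow_le_pow_left₀ (norm_nonneg _) h0 2
  have htri : ‖a + b + r‖ ^ 2 ≤ 3 * (‖a‖ ^ 2 + ‖b‖ ^ 2 + ‖r‖ ^ 2) := by
    have h1 := pow_le_pow_left₀ (norm_nonneg _)
      ((norm_add_le (a + b) r).trans (add_le_add_left (norm_add_le a b) _)) 2
    nlinarith [sq_nonneg (‖a‖ - ‖b‖), sq_nonneg (‖a‖ - ‖r‖), sq_nonneg (‖b‖ - ‖r‖)]
  rw [hdec]
  nlinarith

end Regular

end Penalty

/-! ### Centered noise with bounded second moment -/

section Noise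

variable {Ω : Type*} [MeasurableSpace Ω] {P : Measure Ω}
  {E : Type*} [NormedAddCommGroup E] [InnerProductSpace ℝ E] [CompleteSpace E]
  [MeasurableSpace E] [BorelSpace E] [SecondCountableTopology E]
  {E' : Type*} [NormedAddCommGroup E'] [InnerProductSpace ℝ E'] [CompleteSpace E']
  [MeasurableSpace E'] [BorelSpace E'] [SecondCountableTopology E']

/-- `X` is a centered square-integrable random vector with `E‖X‖² ≤ V`. -/
structure IsNoise (P : Measure Ω) (X : Ω → E) (V : ℝ) : Prop where
  measurable : Measurable X
  memLp : MemLp X 2 P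
  mean : ∫ ω, X ω ∂P = 0
  sq_le : ∫ ω, ‖X ω‖ ^ 2 ∂P ≤ V

namespace IsNoise

theorem integrable_sq {X : Ω → E} {V : ℝ} (hX : IsNoise P X V) :
    Integrable (fun ω => ‖X ω‖ ^ 2) P :=
  hX.memLp.norm.integrable_sq

variable [IsProbabilityMeasure P]

theorem integrable {X : Ω → E} {V : ℝ} (hX : IsNoise P X V) : Integrable X P :=
  hX.memLp.integrable (by norm_num)

theorem add {X Y : Ω → E} {V W : ℝ} (hX : IsNoise P X V) (hY : IsNoise P Y W) :
    IsNoise P (fun ω => X ω + Y ω) (2 * (V + W)) where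
  measurable := hX.measurable.add hY.measurable
  memLp := hX.memLp.add hY.memLp
  mean := by rw [integral_add hX.integrable hY.integrable, hX.mean, hY.mean, add_zero]
  sq_le := by
    calc ∫ ω, ‖X ω + Y ω‖ ^ 2 ∂P ≤ ∫ ω, 2 * (‖X ω‖ ^ 2 + ‖Y ω‖ ^ 2) ∂P := by
          refine integral_mono (hX.memLp.add hY.memLp).norm.integrable_sq
            ((hX.integrable_sq.add hY.integrable_sq).const_mul 2) fun ω => ?_
          have h1 := pow_le_pow_left₀ (norm_nonneg _) (norm_add_le (X ω) (Y ω)) 2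
          dsimp only
          nlinarith [sq_nonneg (‖X ω‖ - ‖Y ω‖)]
      _ = 2 * (∫ ω, ‖X ω‖ ^ 2 ∂P + ∫ ω, ‖Y ω‖ ^ 2 ∂P) := by
          rw [integral_const_mul, integral_add hX.integrable_sq hY.integrable_sq]
      _ ≤ _ := by linarith [hX.sq_le, hY.sq_le]

theorem smul {X : Ω → E} {V : ℝ} (hX : IsNoise P X V) (r : ℝ) :
    IsNoise P (fun ω => r • X ω) (r ^ 2 * V) where
  measurable := hX.measurable.const_smul r
  memLp := hX.memLp.const_smul r
  mean := by rw [integral_smul, hX.mean, smul_zero]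
  sq_le := by
    simp_rw [norm_smul, mul_pow, integral_const_mul, Real.norm_eq_abs, sq_abs]
    exact mul_le_mul_of_nonneg_left hX.sq_le (sq_nonneg r)

theorem sub {X Y : Ω → E} {V W : ℝ} (hX : IsNoise P X V) (hY : IsNoise P Y W) :
    IsNoise P (fun ω => X ω - Y ω) (2 * (V + W)) := by
  simpa [sub_eq_add_neg] using hX.add (hY.smul (-1))

theorem clm {X : Ω → E} {V : ℝ} (hX : IsNoise P X V) (A : E →L[ℝ] E') (hA : ∀ v, ‖A v‖ ≤ ‖v‖) :
    IsNoise P (fun ω => A (X ω)) V where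
  measurable := A.measurable.comp hX.measurable
  memLp := hX.memLp.of_le (A.measurable.comp hX.measurable).aestronglyMeasurable
    (Filter.Eventually.of_forall fun _ => hA _)
  mean := by rw [A.integral_comp_comm hX.integrable, hX.mean, map_zero]
  sq_le := by
    refine (integral_mono_of_nonneg (Filter.Eventually.of_forall fun _ => sq_nonneg _)
      hX.integrable_sq (Filter.Eventually.of_forall fun ω => ?_)).trans hX.sq_le
    exact pow_le_pow_left₀ (norm_nonneg _) (hA _) 2

theorem mono {X : Ω → E} {V W : ℝ} (hX : IsNoise P X V) (h : V ≤ W) : IsNoise P X W :=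
  { hX with sq_le := hX.sq_le.trans h }

/-- Averaging `B` independent samples divides the variance by `B`. -/
theorem batchMean {X : ℕ → Ω → E} {V : ℝ} (hX : ∀ i, IsNoise P (X i) V) (hind : iIndepFun X P)
    {B : ℕ} (hB : 0 < B) :
    IsNoise P (fun ω => F2BSA.batchMean B (fun i => X i ω)) (V / B) where
  measurable := (Finset.measurable_sum _ fun i _ => (hX i).measurable).const_smul _
  memLp := (memLp_finsetSum _ fun i _ => (hX i).memLp).const_smul _
  mean := by
    simp only [F2BSA.batchMean]
    rw [integral_smul, integral_finsetSum _ fun i _ => (hX i).integrable]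
    simp [(hX _).mean]
  sq_le := by
    have hB' : (0 : ℝ) < B := Nat.cast_pos.2 hB
    have hprod : ∀ i j, Integrable (fun ω => inner ℝ (X i ω) (X j ω)) P := fun i j => by
      refine ((hX i).integrable_sq.add (hX j).integrable_sq).mono'
        ((hX i).measurable.inner (hX j).measurable).aestronglyMeasurable
        (Filter.Eventually.of_forall fun ω => ?_)
      rw [Real.norm_eq_abs]
      refine (abs_real_inner_le_norm _ _).trans ?_
      simp only [Pi.add_apply]
      nlinarith [sq_nonneg (‖X i ω‖ - ‖X j ω‖), sq_nonneg ‖X i ω‖, sq_nonneg ‖X j ω‖]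
    have hcross : ∀ i j, i ≠ j → ∫ ω, inner ℝ (X i ω) (X j ω) ∂P = 0 := fun i j hij => by
      have := (hind.indepFun hij).integral_bilin (hX i).integrable (hX j).integrable
        (isBoundedBilinearMap_inner (𝕜 := ℝ) (E := E)).toContinuousLinearMap
      rw [(hX i).mean, map_zero] at this
      exact this
    have hsum : ∀ ω, ‖F2BSA.batchMean B (fun i => X i ω)‖ ^ 2 = (B : ℝ)⁻¹ ^ 2
        * ∑ i ∈ Finset.range B, ∑ j ∈ Finset.range B, inner ℝ (X i ω) (X j ω) := fun ω => by
      rw [F2BSA.batchMean, norm_smul, mul_pow, Real.norm_of_nonneg (by positivity),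
        ← real_inner_self_eq_norm_sq, sum_inner]
      simp_rw [inner_sum]
    simp_rw [hsum]
    rw [integral_const_mul, integral_finsetSum _ fun i _ => integrable_finsetSum _ fun j _ =>
      hprod i j]
    have hdiag : ∀ i ∈ Finset.range B,
        ∫ ω, ∑ j ∈ Finset.range B, inner ℝ (X i ω) (X j ω) ∂P ≤ V := fun i hi => by
      rw [integral_finsetSum _ fun j _ => hprod i j,
        Finset.sum_eq_single_of_mem i hi fun j _ hji => hcross i j hji.symm]
      simp_rw [real_inner_self_eq_norm_sq]
      exact (hX i).sq_le
    calc (B : ℝ)⁻¹ ^ 2 * _ ≤ (B : ℝ)⁻¹ ^ 2 * ∑ i ∈ Finset.range B, V := by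
          gcongr with i hi; exact hdiag i hi
      _ = V / B := by
          rw [Finset.sum_const, Finset.card_range, nsmul_eq_mul]; field_simp

theorem integrable_quadratic {X : Ω → E} {V : ℝ} (hX : IsNoise P X V) (a k : ℝ) (b : E) :
    Integrable (fun ω => a + inner ℝ b (X ω) + k * ‖X ω‖ ^ 2) P :=
  ((integrable_const a).add (hX.integrable.const_inner b)).add (hX.integrable_sq.const_mul k)

theorem integral_quadratic_le {X : Ω → E} {V : ℝ} (hX : IsNoise P X V) {k : ℝ} (hk : 0 ≤ k)
    (a : ℝ) (b : E) :
    ∫ ω, (a + inner ℝ b (X ω) + k * ‖X ω‖ ^ 2) ∂P ≤ a + k * V := by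
  have h1 : Integrable (fun ω => inner ℝ b (X ω)) P := hX.integrable.const_inner b
  rw [integral_add (by exact (integrable_const a).add h1) (hX.integrable_sq.const_mul k),
    integral_add (integrable_const a) h1, integral_const_mul, integral_inner hX.integrable,
    hX.mean, inner_zero_right]
  have := mul_le_mul_of_nonneg_left hX.sq_le hk
  simp only [integral_const, probReal_univ, one_smul, add_zero]
  linarith

/-- A nonnegative function below a quadratic polynomial of a noise vector has expectation at most
the value obtained by dropping the linear term and bounding the second moment. -/
theorem lintegral_le {X : Ω → E} {V : ℝ} (hX : IsNoise P X V) {k : ℝ} (hk : 0 ≤ k)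
    {a : ℝ} {b : E} {u : Ω → ℝ} (h0 : ∀ ω, 0 ≤ u ω)
    (hu : ∀ ω, u ω ≤ a + inner ℝ b (X ω) + k * ‖X ω‖ ^ 2) :
    ∫⁻ ω, ENNReal.ofReal (u ω) ∂P ≤ ENNReal.ofReal (a + k * V) := by
  refine (lintegral_mono fun ω => ENNReal.ofReal_le_ofReal (hu ω)).trans ?_
  rw [← ofReal_integral_eq_lintegral_ofReal (hX.integrable_quadratic a k b)
    (Filter.Eventually.of_forall fun ω => (h0 ω).trans (hu ω))]
  exact ENNReal.ofReal_le_ofReal (hX.integral_quadratic_le hk a b)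

theorem lintegral_sq_sub_smul_le {X : Ω → E} {V : ℝ} (hX : IsNoise P X V) (a : E) (α : ℝ) :
    ∫⁻ ω, ENNReal.ofReal (‖a - α • X ω‖ ^ 2) ∂P ≤ ENNReal.ofReal (‖a‖ ^ 2 + α ^ 2 * V) := by
  refine hX.lintegral_le (sq_nonneg α) (b := (-2 * α) • a) (fun _ => sq_nonneg _) fun ω => ?_
  rw [norm_sub_sq_real, real_inner_smul_left, real_inner_smul_right, norm_smul, mul_pow,
    Real.norm_eq_abs, sq_abs]
  exact le_of_eq (by ring)

end IsNoise

theorem IsStochasticGradient.isNoise {dx dy : ℕ} {Ξ : Type*} [MeasurableSpace Ξ] {ν : Measure Ξ}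
    [IsProbabilityMeasure P] {h : Joint dx dy → ℝ} {H : Joint dx dy → Ξ → Joint dx dy} {σ : ℝ}
    (hH : IsStochasticGradient ν h H σ) {ξ : Ω → Ξ} (hξ : Measurable ξ) (hlaw : P.map ξ = ν)
    (p : Joint dx dy) : IsNoise P (fun ω => H p (ξ ω) - gradient h p) (σ ^ 2) := by
  have hm : Measurable (H p) := hH.measurable.of_uncurry_left
  have hm' : Measurable fun ω => H p (ξ ω) - gradient h p := (hm.comp hξ).sub_const _
  have hi : Integrable (fun ω => H p (ξ ω)) P := by
    have := hH.integrable p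
    rw [← hlaw, integrable_map_measure hm.aestronglyMeasurable hξ.aemeasurable] at this
    exact this
  have hsm : Measurable fun e => ‖H p e - gradient h p‖ ^ 2 := (hm.sub_const _).norm.pow_const 2
  have hi2 : Integrable (fun ω => ‖H p (ξ ω) - gradient h p‖ ^ 2) P := by
    have := hH.integrable_sq p
    rw [← hlaw, integrable_map_measure hsm.aestronglyMeasurable hξ.aemeasurable] at this
    exact this
  refine ⟨hm', (memLp_two_iff_integrable_sq_norm hm'.aestronglyMeasurable).2 hi2, ?_, ?_⟩
  · have h1 := hH.unbiased p
    rw [← hlaw, integral_map hξ.aemeasurable hm.aestronglyMeasurable] at h1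
    rw [integral_sub hi (integrable_const _), h1]
    simp
  · have h1 := hH.variance_le p
    rw [← hlaw, integral_map hξ.aemeasurable hsm.aestronglyMeasurable] at h1
    exact h1

end Noise

/-! ### Past and fresh samples -/

section Fresh

variable {Ω : Type*} [mΩ : MeasurableSpace Ω] {P : Measure Ω} {Ξ : Type*} [mΞ : MeasurableSpace Ξ]

/-- The information carried by the samples in the slots of `I`. -/
@[reducible] def pastAlg (S : Slot → Ω → Ξ) (I : Set Slot) : MeasurableSpace Ω :=
  ⨆ s ∈ I, mΞ.comap (S s)

theorem pastAlg_le {S : Slot → Ω → Ξ} (hS : ∀ s, Measurable (S s)) (I : Set Slot) :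
    pastAlg S I ≤ mΩ :=
  iSup₂_le fun s _ => (hS s).comap_le

theorem pastAlg_mono (S : Slot → Ω → Ξ) {I J : Set Slot} (h : I ⊆ J) :
    pastAlg S I ≤ pastAlg S J :=
  biSup_mono h

theorem measurable_slot (S : Slot → Ω → Ξ) {I : Set Slot} {s : Slot} (hs : s ∈ I) :
    Measurable[pastAlg S I] (S s) :=
  (comap_measurable (S s)).mono (le_biSup (fun s => mΞ.comap (S s)) hs) le_rfl

/-- Integration over fresh samples with the past frozen: a bound that holds for every fixed past
holds after averaging over the past. -/
theorem lintegral_fresh_le [IsProbabilityMeasure P] {S : Slot → Ω → Ξ}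
    (hS : ∀ s, Measurable (S s)) (hind : iIndepFun S P) {I : Set Slot} {b : ℕ → Slot}
    (hb : ∀ i, b i ∉ I) {α : Type*} [MeasurableSpace α] {X : Ω → α}
    (hX : Measurable[pastAlg S I] X) {h : α → (ℕ → Ξ) → ENNReal}
    (hh : Measurable (Function.uncurry h)) {h' : α → ENNReal}
    (hbound : ∀ a, ∫⁻ ω, h a (fun i => S (b i) ω) ∂P ≤ h' a) :
    ∫⁻ ω, h (X ω) (fun i => S (b i) ω) ∂P ≤ ∫⁻ ω, h' (X ω) ∂P := by
  set Y : Ω → ℕ → Ξ := fun ω i => S (b i) ω with hY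
  have hYm' : Measurable[pastAlg S (Set.range b)] Y :=
    @measurable_pi_lambda Ω ℕ (fun _ => Ξ) (pastAlg S (Set.range b)) _ Y
      fun i => measurable_slot S (Set.mem_range_self i)
  have hYm : Measurable Y := hYm'.mono (pastAlg_le hS _) le_rfl
  have hXm : Measurable X := hX.mono (pastAlg_le hS _) le_rfl
  have hdisj : Disjoint I (Set.range b) := by
    rw [Set.disjoint_right]
    rintro _ ⟨i, rfl⟩
    exact hb i
  have h1 : Indep (pastAlg S I) (pastAlg S (Set.range b)) P :=
    indep_iSup_of_disjoint (fun s => (hS s).comap_le) hind hdisj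
  have h2 : IndepFun X Y P := by
    rw [IndepFun_iff_Indep]
    exact indep_of_indep_of_le_left (indep_of_indep_of_le_right h1 hYm'.comap_le) hX.comap_le
  have h3 := (indepFun_iff_map_prod_eq_prod_map_map hXm.aemeasurable hYm.aemeasurable).1 h2
  have : IsProbabilityMeasure (P.map Y) := Measure.isProbabilityMeasure_map hYm.aemeasurable
  calc ∫⁻ ω, h (X ω) (Y ω) ∂P
      = ∫⁻ q, Function.uncurry h q ∂(P.map fun ω => (X ω, Y ω)) := by
        rw [lintegral_map hh (hXm.prodMk hYm)]; rfl
    _ = ∫⁻ a, ∫⁻ y, h a y ∂(P.map Y) ∂(P.map X) := by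
        rw [h3, lintegral_prod _ hh.aemeasurable]; rfl
    _ = ∫⁻ ω, ∫⁻ y, h (X ω) y ∂(P.map Y) ∂P := by
        have h4 : Measurable fun a => ∫⁻ y, h a y ∂(P.map Y) := hh.lintegral_prod_right'
        rw [lintegral_map h4 hXm]
    _ ≤ ∫⁻ ω, h' (X ω) ∂P := by
        refine lintegral_mono fun ω => ?_
        dsimp only
        rw [lintegral_map hh.of_uncurry_left hYm]
        exact hbound (X ω)

end Fresh

/-! ### Measurability of the iterates -/

section BatchMean

variable {V : Type*} [AddCommGroup V] [Module ℝ V]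

theorem batchMean_sub_const {B : ℕ} (hB : 0 < B) (v : ℕ → V) (m : V) :
    batchMean B (fun i => v i - m) = batchMean B v - m := by
  have hB' : (B : ℝ) ≠ 0 := Nat.cast_ne_zero.2 hB.ne'
  simp only [batchMean, Finset.sum_sub_distrib, Finset.sum_const, Finset.card_range]
  rw [smul_sub, ← Nat.cast_smul_eq_nsmul ℝ, smul_smul, inv_mul_cancel₀ hB', one_smul]

theorem batchMean_add (B : ℕ) (v w : ℕ → V) :
    batchMean B (fun i => v i + w i) = batchMean B v + batchMean B w := by
  simp only [batchMean, Finset.sum_add_distrib, smul_add]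

theorem batchMean_sub (B : ℕ) (v w : ℕ → V) :
    batchMean B (fun i => v i - w i) = batchMean B v - batchMean B w := by
  simp only [batchMean, Finset.sum_sub_distrib, smul_sub]

theorem batchMean_smul (B : ℕ) (r : ℝ) (v : ℕ → V) :
    batchMean B (fun i => r • v i) = r • batchMean B v := by
  simp only [batchMean, ← Finset.smul_sum, smul_comm r]

end BatchMean

section Measurability

variable {Ω : Type*} {Ξf Ξg : Type*} [MeasurableSpace Ξf] [MeasurableSpace Ξg] {dx dy : ℕ}

section Basic

variable [MeasurableSpace Ω]

theorem measurable_batchMean {d B : ℕ} {v : ℕ → Ω → Vec d} (hv : ∀ i, Measurable (v i)) :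
    Measurable fun ω => batchMean B (fun i => v i ω) :=
  (Finset.measurable_sum (Finset.range B) fun i _ => hv i).const_smul (B : ℝ)⁻¹

theorem measurable_oracle {Ξ : Type*} [MeasurableSpace Ξ] {H : Joint dx dy → Ξ → Joint dx dy}
    (hH : Measurable (Function.uncurry H)) {x : Ω → Vec dx} {y : Ω → Vec dy} {ξ : Ω → Ξ}
    (hx : Measurable x) (hy : Measurable y) (hξ : Measurable ξ) :
    Measurable fun ω => H (pt (x ω) (y ω)) (ξ ω) := by
  have h1 : Measurable fun ω => pt (x ω) (y ω) :=
    (WithLp.measurable_toLp 2 (Vec dx × Vec dy)).comp (hx.prodMk hy)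
  exact hH.comp (h1.prodMk hξ)

theorem measurable_joint_fst {v : Ω → Joint dx dy} (hv : Measurable v) :
    Measurable fun ω => (v ω).fst :=
  (WithLp.fstL 2 ℝ (Vec dx) (Vec dy)).measurable.comp hv

theorem measurable_joint_snd {v : Ω → Joint dx dy} (hv : Measurable v) :
    Measurable fun ω => (v ω).snd :=
  (WithLp.sndL 2 ℝ (Vec dx) (Vec dy)).measurable.comp hv

/-- Evaluation of a sequence of measurable functions at a measurable random index. -/
theorem measurable_random_index {β : Type*} [MeasurableSpace β] {u : ℕ → Ω → β} {N : Ω → ℕ}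
    (hu : ∀ n, Measurable (u n)) (hN : Measurable N) : Measurable fun ω => u (N ω) ω :=
  (measurable_from_prod_countable_right (f := fun q : ℕ × Ω => u q.1 q.2) hu).comp
    (hN.prodMk measurable_id)

end Basic

/-- All components of a random inner state are measurable. -/
abbrev MeasurableInner [m : MeasurableSpace Ω] (u : Ω → InnerState dy) : Prop :=
  (Measurable fun ω => (u ω).y) ∧ (Measurable fun ω => (u ω).z) ∧ Measurable fun ω => (u ω).calls

/-- All components of a random outer state are measurable. -/
abbrev MeasurableState [m : MeasurableSpace Ω] (u : Ω → State dx dy) : Prop :=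
  (Measurable fun ω => (u ω).x) ∧ (Measurable fun ω => (u ω).y) ∧ (Measurable fun ω => (u ω).z) ∧
    (Measurable fun ω => (u ω).δ) ∧ Measurable fun ω => (u ω).calls

namespace MeasurableInner

variable {m m' : MeasurableSpace Ω} {u : Ω → InnerState dy}

theorem y (hu : MeasurableInner u) : Measurable fun ω => (u ω).y := hu.1
theorem z (hu : MeasurableInner u) : Measurable fun ω => (u ω).z := hu.2.1
theorem calls (hu : MeasurableInner u) : Measurable fun ω => (u ω).calls := hu.2.2

theorem mono (hu : MeasurableInner (m := m) u) (h : m ≤ m') : MeasurableInner (m := m') u :=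
  ⟨hu.1.mono h le_rfl, hu.2.1.mono h le_rfl, hu.2.2.mono h le_rfl⟩

end MeasurableInner

namespace MeasurableState

variable {m m' : MeasurableSpace Ω} {u : Ω → State dx dy}

theorem x (hu : MeasurableState u) : Measurable fun ω => (u ω).x := hu.1
theorem y (hu : MeasurableState u) : Measurable fun ω => (u ω).y := hu.2.1
theorem z (hu : MeasurableState u) : Measurable fun ω => (u ω).z := hu.2.2.1
theorem δ (hu : MeasurableState u) : Measurable fun ω => (u ω).δ := hu.2.2.2.1
theorem calls (hu : MeasurableState u) : Measurable fun ω => (u ω).calls := hu.2.2.2.2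

theorem mono (hu : MeasurableState (m := m) u) (h : m ≤ m') : MeasurableState (m := m') u :=
  ⟨hu.1.mono h le_rfl, hu.2.1.mono h le_rfl, hu.2.2.1.mono h le_rfl, hu.2.2.2.1.mono h le_rfl,
    hu.2.2.2.2.mono h le_rfl⟩

end MeasurableState

variable [MeasurableSpace Ω] {p : Params} {F : Joint dx dy → Ξf → Joint dx dy}
  {G : Joint dx dy → Ξg → Joint dx dy}
  {S : Slot → Ω → Ξf × Ξg × Ξg}

theorem measurable_innerStep (hF : Measurable (Function.uncurry F))
    (hG : Measurable (Function.uncurry G)) {t k : ℕ} (hS : ∀ i, Measurable (S (.inner t k i)))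
    {x : Ω → Vec dx} (hx : Measurable x) {u : Ω → InnerState dy} (hu : MeasurableInner u) :
    MeasurableInner fun ω => innerStep p F G (fun s => S s ω) t (x ω) k (u ω) :=
  ⟨hu.y.sub (((measurable_batchMean fun i =>
      measurable_joint_snd (measurable_oracle hF hx hu.y (hS i).fst)).add
    ((measurable_batchMean fun i =>
      measurable_joint_snd (measurable_oracle hG hx hu.y (hS i).snd.fst)).const_smul
        p.lam)).const_smul p.ηy),
  hu.z.sub ((measurable_batchMean fun i =>
      measurable_joint_snd (measurable_oracle hG hx hu.z (hS i).snd.snd)).const_smul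
        (p.ηz * p.lam)),
  hu.calls.add_const _⟩

theorem measurable_innerLoop (hF : Measurable (Function.uncurry F))
    (hG : Measurable (Function.uncurry G)) {t : ℕ} {x : Ω → Vec dx} (hx : Measurable x)
    {u : Ω → InnerState dy} (hu : MeasurableInner u) (n : ℕ)
    (hS : ∀ k < n, ∀ i, Measurable (S (.inner t k i))) :
    MeasurableInner fun ω => innerLoop p F G (fun s => S s ω) t (x ω) (u ω) n := by
  induction n with
  | zero => exact hu
  | succ n ih =>
    exact measurable_innerStep hF hG (hS n n.lt_succ_self) hx
      (ih fun k hk => hS k (hk.trans n.lt_succ_self))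

theorem measurable_innerLoop_random (hF : Measurable (Function.uncurry F))
    (hG : Measurable (Function.uncurry G)) {t : ℕ} {x : Ω → Vec dx} (hx : Measurable x)
    {u : Ω → InnerState dy} (hu : MeasurableInner u) {N : Ω → ℕ} (hN : Measurable N)
    (hS : ∀ k i, Measurable (S (.inner t k i))) :
    MeasurableInner fun ω => innerLoop p F G (fun s => S s ω) t (x ω) (u ω) (N ω) := by
  have h := fun n => measurable_innerLoop (p := p) hF hG hx hu n fun k _ => hS k
  exact ⟨measurable_random_index (fun n => (h n).y) hN,
    measurable_random_index (fun n => (h n).z) hN,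
    measurable_random_index (fun n => (h n).calls) hN⟩

theorem measurable_hyperGradEst (hF : Measurable (Function.uncurry F))
    (hG : Measurable (Function.uncurry G)) {t : ℕ} (hS : ∀ i, Measurable (S (.outer t i)))
    {x : Ω → Vec dx} {y z : Ω → Vec dy} (hx : Measurable x) (hy : Measurable y)
    (hz : Measurable z) :
    Measurable fun ω => hyperGradEst p F G (fun s => S s ω) t (x ω) (y ω) (z ω) :=
  (measurable_batchMean fun i =>
      measurable_joint_fst (measurable_oracle hF hx hy (hS i).fst)).add
    (((measurable_batchMean fun i =>
      measurable_joint_fst (measurable_oracle hG hx hy (hS i).snd.fst)).sub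
    (measurable_batchMean fun i =>
      measurable_joint_fst (measurable_oracle hG hx hz (hS i).snd.snd))).const_smul p.lam)

/-- The slots drawn before iteration `t`. -/
def beforeIter (t : ℕ) : Set Slot :=
  {s | match s with | .inner t' _ _ => t' < t | .outer t' _ => t' < t}

/-- The slots drawn before the `k`-th inner step of iteration `t`. -/
def beforeInner (t k : ℕ) : Set Slot :=
  {s | match s with | .inner t' k' _ => t' < t ∨ t' = t ∧ k' < k | .outer t' _ => t' < t}

/-- The slots drawn before the outer step of iteration `t`. -/
def beforeOuter (t : ℕ) : Set Slot :=
  {s | match s with | .inner t' _ _ => t' ≤ t | .outer t' _ => t' < t}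

theorem beforeIter_subset_beforeInner (t k : ℕ) : beforeIter t ⊆ beforeInner t k := by
  intro s h
  cases s with
  | inner t' k' i => exact Or.inl h
  | outer t' i => exact h

theorem beforeIter_subset_beforeOuter (t : ℕ) : beforeIter t ⊆ beforeOuter t := by
  intro s h
  cases s with
  | inner t' k' i => exact le_of_lt (show t' < t from h)
  | outer t' i => exact h

/-- The state after the inner loop of iteration `t`, started from the outer state `st`. -/
def afterInner (p : Params) (F : Joint dx dy → Ξf → Joint dx dy)
    (G : Joint dx dy → Ξg → Joint dx dy) (s : Slot → Ξf × Ξg × Ξg) (t : ℕ) (st : State dx dy) :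
    InnerState dy :=
  innerLoop p F G s t st.x ⟨st.y, st.z, st.calls⟩ (p.innerSteps st.δ)

theorem measurable_afterInner (hF : Measurable (Function.uncurry F))
    (hG : Measurable (Function.uncurry G)) (hK : Measurable p.innerSteps) {t : ℕ}
    (hS : ∀ k i, Measurable (S (.inner t k i))) {st : Ω → State dx dy} (hst : MeasurableState st) :
    MeasurableInner fun ω => afterInner p F G (fun s => S s ω) t (st ω) :=
  measurable_innerLoop_random hF hG hst.x ⟨hst.y, hst.z, hst.calls⟩ (hK.comp hst.δ) hS

theorem measurable_run (hF : Measurable (Function.uncurry F))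
    (hG : Measurable (Function.uncurry G)) (hK : Measurable p.innerSteps) (x₀ : Vec dx)
    (y₀ : Vec dy) (t : ℕ) (hS : ∀ s ∈ beforeIter t, Measurable (S s)) :
    MeasurableState fun ω => run p F G (fun s => S s ω) x₀ y₀ t := by
  induction t with
  | zero =>
    exact ⟨measurable_const, measurable_const, measurable_const, measurable_const,
      measurable_const⟩
  | succ t ih =>
    have hst := ih fun s hs => hS s (by
      cases s with
      | inner t' k' i => exact Nat.lt_succ_of_lt (show t' < t from hs)
      | outer t' i => exact Nat.lt_succ_of_lt (show t' < t from hs))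
    have hu := measurable_afterInner hF hG hK
      (fun k i => hS (.inner t k i) t.lt_succ_self) hst
    have hx := hst.x.sub ((measurable_hyperGradEst (p := p) hF hG
      (fun i => hS (.outer t i) t.lt_succ_self) hst.x hu.y hu.z).const_smul p.ηx)
    exact ⟨hx, hu.y, hu.z,
      ((hst.δ.div_const 2).add (((hx.sub hst.x).norm.pow_const 2).const_mul _)).add_const _,
      hu.calls.add_const _⟩

end Measurability

/-! ### One inner step -/

section InnerStep

variable {Ω : Type*} [MeasurableSpace Ω] {P : Measure Ω} [IsProbabilityMeasure P]
  {Ξf Ξg : Type*} [MeasurableSpace Ξf] [MeasurableSpace Ξg]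
  {νf : Measure Ξf} {νg : Measure Ξg} {dx dy : ℕ} {c : Consts} {f g : Joint dx dy → ℝ} {p : Params}
  {F : Joint dx dy → Ξf → Joint dx dy} {G : Joint dx dy → Ξg → Joint dx dy}
  {S : Slot → Ω → Ξf × Ξg × Ξg}

/-- Parameters for which the inner loop contracts: the penalty dominates the upper-level
objective and the inner step size is `1 / (2 λ L_g)`. -/
structure Params.Admissible (p : Params) (c : Consts) : Prop where
  lam_pos : 0 < p.lam
  lam_large : 2 * c.Lf ≤ p.lam * c.μ
  ηy_eq : p.ηy = 1 / (2 * p.lam * c.Lg)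
  ηz_eq : p.ηz = 1 / (2 * p.lam * c.Lg)
  Bin_pos : 0 < p.Bin
  Bout_pos : 0 < p.Bout
  innerSteps_measurable : Measurable p.innerSteps

/-- The squared distance of the inner state to the exact solutions `(y*_λ(x), y*(x))`. -/
def innerErr (lam : ℝ) (f g : Joint dx dy → ℝ) (x : Vec dx) (u : InnerState dy) : ℝ :=
  ‖u.y - yPen lam f g x‖ ^ 2 + ‖u.z - yStar g x‖ ^ 2

theorem innerErr_nonneg (lam : ℝ) (f g : Joint dx dy → ℝ) (x : Vec dx) (u : InnerState dy) :
    0 ≤ innerErr lam f g x u := by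
  unfold innerErr; positivity

/-- A bound for the expected increase of the inner error caused by the noise of one inner step. -/
def innerNoise (c : Consts) (p : Params) : ℝ :=
  3 * (c.σf ^ 2 / p.lam ^ 2 + c.σg ^ 2) / (4 * c.Lg ^ 2 * p.Bin)

variable [Nontrivial (Vec dy)]

theorem Params.Admissible.ηy_mul (hp : p.Admissible c) (hLg : 0 < c.Lg) :
    p.ηy = 1 / (2 * c.Lg) * p.lam⁻¹ := by
  have hl := hp.lam_pos
  rw [hp.ηy_eq]; field_simp

theorem Params.Admissible.ηz_mul (hp : p.Admissible c) (hLg : 0 < c.Lg) :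
    p.ηz * p.lam = 1 / (2 * c.Lg) := by
  have hl := hp.lam_pos
  rw [hp.ηz_eq]; field_simp

theorem iIndepFun_inner_batch (hS : IsSampling νf νg P S) (t k : ℕ) :
    iIndepFun (fun i => S (.inner t k i)) P :=
  hS.indep.precomp (g := fun i => Slot.inner t k i) fun i j h => by injection h

theorem iIndepFun_outer_batch (hS : IsSampling νf νg P S) (t : ℕ) :
    iIndepFun (fun i => S (.outer t i)) P :=
  hS.indep.precomp (g := fun i => Slot.outer t i) fun i j h => by injection h

/-- The `y`-update is an exact contracting gradient step perturbed by centered noise. -/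
theorem lintegral_innerStep_y_le (hr : Regular c f g) (hF : IsStochasticGradient νf f F c.σf)
    (hG : IsStochasticGradient νg g G c.σg) (hS : IsSampling νf νg P S) (hp : p.Admissible c)
    (t k : ℕ) (x : Vec dx) (u : InnerState dy) :
    ∫⁻ ω, ENNReal.ofReal
        (‖(innerStep p F G (fun s => S s ω) t x k u).y - yPen p.lam f g x‖ ^ 2) ∂P
      ≤ ENNReal.ofReal ((1 - c.μ / (4 * c.Lg)) * ‖u.y - yPen p.lam f g x‖ ^ 2
        + (1 / (2 * c.Lg)) ^ 2 * (2 * (p.lam⁻¹ ^ 2 * c.σf ^ 2 + c.σg ^ 2) / p.Bin)) := by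
  have hl := hp.lam_pos
  have hLg := hr.Lg_pos
  have hB := hp.Bin_pos
  have hηy := hp.ηy_mul hLg
  set α := 1 / (2 * c.Lg) with hα
  have hα0 : 0 < α := by positivity
  have hm := fun i => hS.measurable (.inner t k i)
  let sndL := WithLp.sndL 2 ℝ (Vec dx) (Vec dy)
  set N : ℕ → Ω → Vec dy := fun i ω =>
    p.lam⁻¹ • sndL (F (pt x u.y) (S (.inner t k i) ω).1 - gradient f (pt x u.y))
      + sndL (G (pt x u.y) (S (.inner t k i) ω).2.1 - gradient g (pt x u.y)) with hN
  have hN_noise : ∀ i, IsNoise P (N i) (2 * (p.lam⁻¹ ^ 2 * c.σf ^ 2 + c.σg ^ 2)) := fun i =>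
    (((hF.isNoise (hm i).fst (hS.law_f _) _).clm sndL norm_snd_le_joint).smul p.lam⁻¹).add
      ((hG.isNoise (hm i).snd.fst (hS.law_g_y _) _).clm sndL norm_snd_le_joint)
  have hFm : Measurable (F (pt x u.y)) := hF.measurable.of_uncurry_left
  have hGm : Measurable (G (pt x u.y)) := hG.measurable.of_uncurry_left
  have hζ : Measurable fun ξ : Ξf × Ξg × Ξg =>
      p.lam⁻¹ • sndL (F (pt x u.y) ξ.1 - gradient f (pt x u.y))
        + sndL (G (pt x u.y) ξ.2.1 - gradient g (pt x u.y)) :=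
    ((sndL.measurable.comp ((hFm.comp measurable_fst).sub_const _)).const_smul p.lam⁻¹).add
      (sndL.measurable.comp ((hGm.comp measurable_snd.fst).sub_const _))
  have hN_ind : iIndepFun N P := (iIndepFun_inner_batch hS t k).comp _ fun _ => hζ
  have hnoise := IsNoise.batchMean hN_noise hN_ind hB
  set a := u.y - α • (p.lam⁻¹ • gradient f (pt x u.y) + gradient g (pt x u.y)).snd
    - yPen p.lam f g x with ha
  have ha_le : ‖a‖ ^ 2 ≤ (1 - c.μ / (4 * c.Lg)) * ‖u.y - yPen p.lam f g x‖ ^ 2 := by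
    have h1 := (hr.penalized_isLowerLevel hl hp.lam_large).gradient_step_contracts hα0.le
      (by rw [hα]; field_simp; norm_num) (by positivity) (hr.yPen_le hl hp.lam_large x) u.y
    refine h1.trans_eq ?_
    rw [hα]; field_simp; norm_num; ring
  have hstep : ∀ ω, (innerStep p F G (fun s => S s ω) t x k u).y - yPen p.lam f g x
      = a - α • batchMean p.Bin (fun i => N i ω) := fun ω => by
    have e : batchMean p.Bin (fun i => N i ω)
        = p.lam⁻¹ • (batchMean p.Bin (fun i => (F (pt x u.y) (S (.inner t k i) ω).1).snd)
            - (gradient f (pt x u.y)).snd)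
          + (batchMean p.Bin (fun i => (G (pt x u.y) (S (.inner t k i) ω).2.1).snd)
            - (gradient g (pt x u.y)).snd) := by
      rw [← batchMean_sub_const hB, ← batchMean_sub_const hB, ← batchMean_smul, ← batchMean_add]
      rfl
    rw [e, ha]
    simp only [innerStep]
    have e3 : ∀ v : Vec dy, p.ηy • (p.lam • v) = α • v := fun v => by
      rw [smul_smul, hηy, mul_assoc, inv_mul_cancel₀ hl.ne', mul_one]
    rw [smul_add, e3, hηy, WithLp.add_snd, WithLp.smul_snd]
    module
  simp only [hstep]
  exact (hnoise.lintegral_sq_sub_smul_le a α).trans (ENNReal.ofReal_le_ofReal (by linarith))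

/-- The `z`-update is an exact contracting gradient step perturbed by centered noise. -/
theorem lintegral_innerStep_z_le (hr : Regular c f g)
    (hG : IsStochasticGradient νg g G c.σg) (hS : IsSampling νf νg P S) (hp : p.Admissible c)
    (t k : ℕ) (x : Vec dx) (u : InnerState dy) :
    ∫⁻ ω, ENNReal.ofReal
        (‖(innerStep p F G (fun s => S s ω) t x k u).z - yStar g x‖ ^ 2) ∂P
      ≤ ENNReal.ofReal ((1 - c.μ / (4 * c.Lg)) * ‖u.z - yStar g x‖ ^ 2
        + (1 / (2 * c.Lg)) ^ 2 * (c.σg ^ 2 / p.Bin)) := by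
  have hLg := hr.Lg_pos
  have hμ := hr.μ_pos
  have hB := hp.Bin_pos
  have hηz := hp.ηz_mul hLg
  set α := 1 / (2 * c.Lg) with hα
  have hα0 : 0 < α := by positivity
  have hm := fun i => hS.measurable (.inner t k i)
  let sndL := WithLp.sndL 2 ℝ (Vec dx) (Vec dy)
  set N : ℕ → Ω → Vec dy := fun i ω =>
    sndL (G (pt x u.z) (S (.inner t k i) ω).2.2 - gradient g (pt x u.z)) with hN
  have hN_noise : ∀ i, IsNoise P (N i) (c.σg ^ 2) := fun i =>
    (hG.isNoise (hm i).snd.snd (hS.law_g_z _) _).clm sndL norm_snd_le_joint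
  have hGm : Measurable (G (pt x u.z)) := hG.measurable.of_uncurry_left
  have hζ : Measurable fun ξ : Ξf × Ξg × Ξg =>
      sndL (G (pt x u.z) ξ.2.2 - gradient g (pt x u.z)) :=
    sndL.measurable.comp ((hGm.comp measurable_snd.snd).sub_const _)
  have hN_ind : iIndepFun N P := (iIndepFun_inner_batch hS t k).comp _ fun _ => hζ
  have hnoise := IsNoise.batchMean hN_noise hN_ind hB
  set a := u.z - α • (gradient g (pt x u.z)).snd - yStar g x with ha
  have ha_le : ‖a‖ ^ 2 ≤ (1 - c.μ / (4 * c.Lg)) * ‖u.z - yStar g x‖ ^ 2 := by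
    have h1 := hr.isLowerLevel.gradient_step_contracts hα0.le
      (by rw [hα]; field_simp; norm_num) hLg (hr.yStar_le x) u.z
    refine h1.trans (mul_le_mul_of_nonneg_right ?_ (sq_nonneg _))
    have : α * c.μ = 2 * (c.μ / (4 * c.Lg)) := by rw [hα]; field_simp; norm_num
    have h2 : 0 < c.μ / (4 * c.Lg) := by positivity
    linarith
  have hstep : ∀ ω, (innerStep p F G (fun s => S s ω) t x k u).z - yStar g x
      = a - α • batchMean p.Bin (fun i => N i ω) := fun ω => by
    have e : batchMean p.Bin (fun i => N i ω)
        = batchMean p.Bin (fun i => (G (pt x u.z) (S (.inner t k i) ω).2.2).snd)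
            - (gradient g (pt x u.z)).snd := by
      rw [← batchMean_sub_const hB]
      rfl
    rw [e, ha]
    simp only [innerStep]
    rw [hηz]
    module
  simp only [hstep]
  exact (hnoise.lintegral_sq_sub_smul_le a α).trans (ENNReal.ofReal_le_ofReal (by linarith))

theorem lintegral_innerStep_le (hr : Regular c f g) (hF : IsStochasticGradient νf f F c.σf)
    (hG : IsStochasticGradient νg g G c.σg) (hS : IsSampling νf νg P S) (hp : p.Admissible c)
    (t k : ℕ) (x : Vec dx) (u : InnerState dy) :
    ∫⁻ ω, ENNReal.ofReal (innerErr p.lam f g x (innerStep p F G (fun s => S s ω) t x k u)) ∂P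
      ≤ ENNReal.ofReal ((1 - c.μ / (4 * c.Lg)) * innerErr p.lam f g x u + innerNoise c p) := by
  have hl := hp.lam_pos
  have hLg := hr.Lg_pos
  have hμL := hr.μ_le_Lg
  have hB' : (0 : ℝ) < p.Bin := Nat.cast_pos.2 hp.Bin_pos
  have hmeas : Measurable fun ω => ENNReal.ofReal
      (‖(innerStep p F G (fun s => S s ω) t x k u).y - yPen p.lam f g x‖ ^ 2) :=
    (((measurable_innerStep (p := p) hF.measurable hG.measurable
      (fun i => hS.measurable (.inner t k i)) (measurable_const (a := x))
      (u := fun _ => u) ⟨measurable_const, measurable_const, measurable_const⟩).y.sub_const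
        _).norm.pow_const 2).ennreal_ofReal
  simp only [innerErr]
  simp_rw [ENNReal.ofReal_add (sq_nonneg _) (sq_nonneg _)]
  rw [lintegral_add_left hmeas]
  refine (add_le_add (lintegral_innerStep_y_le hr hF hG hS hp t k x u)
    (lintegral_innerStep_z_le hr hG hS hp t k x u)).trans ?_
  have hθ : 0 ≤ 1 - c.μ / (4 * c.Lg) := by
    rw [sub_nonneg, div_le_one (by positivity)]; linarith
  rw [← ENNReal.ofReal_add (by positivity) (by positivity)]
  refine ENNReal.ofReal_le_ofReal ?_
  have hnoise : (1 / (2 * c.Lg)) ^ 2 * (2 * (p.lam⁻¹ ^ 2 * c.σf ^ 2 + c.σg ^ 2) / p.Bin)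
      + (1 / (2 * c.Lg)) ^ 2 * (c.σg ^ 2 / p.Bin) ≤ innerNoise c p := by
    have e : innerNoise c p
        = (1 / (2 * c.Lg)) ^ 2 * (3 * (p.lam⁻¹ ^ 2 * c.σf ^ 2 + c.σg ^ 2) / p.Bin) := by
      rw [innerNoise]; field_simp; norm_num
    rw [e, ← mul_add, ← add_div]
    gcongr
    nlinarith [mul_nonneg (sq_nonneg p.lam⁻¹) (sq_nonneg c.σf)]
  linarith

end InnerStep

/-! ### The inner loop -/

section InnerLoop

variable {Ω : Type*} [mΩ : MeasurableSpace Ω] {P : Measure Ω} [IsProbabilityMeasure P]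
  {Ξf Ξg : Type*} [MeasurableSpace Ξf] [MeasurableSpace Ξg]
  {νf : Measure Ξf} {νg : Measure Ξg} {dx dy : ℕ} {c : Consts} {f g : Joint dx dy → ℝ} {p : Params}
  {F : Joint dx dy → Ξf → Joint dx dy} {G : Joint dx dy → Ξg → Joint dx dy}
  {S : Slot → Ω → Ξf × Ξg × Ξg}

/-- The position of a slot within its mini-batch. -/
def Slot.index : Slot → ℕ
  | .inner _ _ i => i
  | .outer _ i => i

variable [Nontrivial (Vec dy)]

theorem measurable_yStar (hr : Regular c f g) : Measurable (yStar g) := by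
  have h : LipschitzWith (Real.toNNReal (c.Lg / c.μ)) (yStar g) :=
    LipschitzWith.of_dist_le' fun x x' => by
      rw [dist_eq_norm, dist_eq_norm, norm_sub_rev, norm_sub_rev x]
      exact hr.norm_yStar_sub_yStar_le x x'
  exact h.continuous.measurable

theorem measurable_yPen (hr : Regular c f g) {lam : ℝ} (hl : 0 < lam)
    (hlam : 2 * c.Lf ≤ lam * c.μ) : Measurable (yPen lam f g) := by
  have h : LipschitzWith (Real.toNNReal (3 * (c.Lg / c.μ))) (yPen lam f g) :=
    LipschitzWith.of_dist_le' fun x x' => by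
      rw [dist_eq_norm, dist_eq_norm, norm_sub_rev, norm_sub_rev x]
      exact hr.norm_yPen_sub_yPen_le hl hlam x x'
  exact h.continuous.measurable

theorem measurable_innerErr {Ω' : Type*} [MeasurableSpace Ω'] (hr : Regular c f g) {lam : ℝ}
    (hl : 0 < lam) (hlam : 2 * c.Lf ≤ lam * c.μ) {x : Ω' → Vec dx} (hx : Measurable x)
    {u : Ω' → InnerState dy} (hy : Measurable fun ω => (u ω).y)
    (hz : Measurable fun ω => (u ω).z) :
    Measurable fun ω => innerErr lam f g (x ω) (u ω) :=
  ((hy.sub ((measurable_yPen hr hl hlam).comp hx)).norm.pow_const 2).add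
    ((hz.sub ((measurable_yStar hr).comp hx)).norm.pow_const 2)

/-- One inner step, averaged over a random past with a weight known in the past. -/
theorem lintegral_weighted_innerStep_le (hr : Regular c f g)
    (hF : IsStochasticGradient νf f F c.σf) (hG : IsStochasticGradient νg g G c.σg)
    (hS : IsSampling νf νg P S) (hp : p.Admissible c) (t k : ℕ)
    {W : Ω → ENNReal} (hW : Measurable[pastAlg S (beforeInner t k)] W)
    {x : Ω → Vec dx} (hx : Measurable[pastAlg S (beforeInner t k)] x)
    {u : Ω → InnerState dy} (hy : Measurable[pastAlg S (beforeInner t k)] fun ω => (u ω).y)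
    (hz : Measurable[pastAlg S (beforeInner t k)] fun ω => (u ω).z) :
    ∫⁻ ω, W ω * ENNReal.ofReal
        (innerErr p.lam f g (x ω) (innerStep p F G (fun s => S s ω) t (x ω) k (u ω))) ∂P
      ≤ ∫⁻ ω, W ω * ENNReal.ofReal
        ((1 - c.μ / (4 * c.Lg)) * innerErr p.lam f g (x ω) (u ω) + innerNoise c p) ∂P := by
  have hX : Measurable[pastAlg S (beforeInner t k)] fun ω => (W ω, x ω, (u ω).y, (u ω).z) :=
    hW.prodMk (hx.prodMk (hy.prodMk hz))
  -- The step reads only the slots of its own mini-batch, so the samples `S` may be replaced by the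
  -- sequence `ξ` of the samples of that batch, extended to all slots through `Slot.index`.
  refine lintegral_fresh_le hS.measurable hS.indep (b := fun i => .inner t k i)
    (I := beforeInner t k) (X := fun ω => (W ω, x ω, (u ω).y, (u ω).z))
    (h := fun a ξ => a.1 * ENNReal.ofReal (innerErr p.lam f g a.2.1
      (innerStep p F G (fun s => ξ s.index) t a.2.1 k ⟨a.2.2.1, a.2.2.2, 0⟩)))
    (h' := fun a => a.1 * ENNReal.ofReal ((1 - c.μ / (4 * c.Lg)) *
      innerErr p.lam f g a.2.1 ⟨a.2.2.1, a.2.2.2, 0⟩ + innerNoise c p)) ?_ hX ?_ ?_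
  · rintro i (h | h)
    · exact lt_irrefl _ h
    · exact lt_irrefl _ h.2
  · have hx' : Measurable fun q : (ENNReal × Vec dx × Vec dy × Vec dy) × (ℕ → Ξf × Ξg × Ξg) =>
        q.1.2.1 := measurable_fst.snd.fst
    have hu' := measurable_innerStep (p := p) (t := t) (k := k) hF.measurable hG.measurable
      (S := fun s (q : (ENNReal × Vec dx × Vec dy × Vec dy) × (ℕ → Ξf × Ξg × Ξg)) => q.2 s.index)
      (fun i => (measurable_pi_apply i).comp measurable_snd) hx'
      (u := fun q => ⟨q.1.2.2.1, q.1.2.2.2, 0⟩)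
      ⟨measurable_fst.snd.snd.fst, measurable_fst.snd.snd.snd, measurable_const⟩
    exact measurable_fst.fst.mul
      (measurable_innerErr hr hp.lam_pos hp.lam_large hx' hu'.y hu'.z).ennreal_ofReal
  · rintro ⟨w, x, y, z⟩
    have hm := measurable_innerStep (p := p) (t := t) (k := k) hF.measurable hG.measurable
      (fun i => hS.measurable (.inner t k i)) (measurable_const (a := x))
      (u := fun _ => (⟨y, z, 0⟩ : InnerState dy))
      ⟨measurable_const, measurable_const, measurable_const⟩
    have h1 := measurable_innerErr hr hp.lam_pos hp.lam_large (measurable_const (a := x)) hm.y hm.z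
    have h2 := lintegral_innerStep_le hr hF hG hS hp t k x ⟨y, z, 0⟩
    calc _ = w * ∫⁻ ω, ENNReal.ofReal (innerErr p.lam f g x
          (innerStep p F G (fun s => S s ω) t x k ⟨y, z, 0⟩)) ∂P :=
        lintegral_const_mul w h1.ennreal_ofReal
      _ ≤ _ := mul_le_mul_right h2 w

/-- The contraction factor of one inner step. -/
def innerRate (c : Consts) : ℝ := 1 - c.μ / (4 * c.Lg)

theorem innerRate_nonneg (hr : Regular c f g) : 0 ≤ innerRate c := by
  have hLg := hr.Lg_pos
  have hμL := hr.μ_le_Lg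
  rw [innerRate, sub_nonneg, div_le_one (by positivity)]; linarith

/-- The stationary error level `innerNoise / (1 - innerRate)` of the inner loop. -/
def innerFloor (c : Consts) (p : Params) : ℝ := innerNoise c p / (c.μ / (4 * c.Lg))

theorem innerFloor_nonneg (hr : Regular c f g) : 0 ≤ innerFloor c p := by
  have hLg := hr.Lg_pos
  have hμ := hr.μ_pos
  unfold innerFloor innerNoise
  positivity

theorem innerFloor_step (hr : Regular c f g) :
    innerRate c * innerFloor c p + innerNoise c p = innerFloor c p := by
  have hLg := hr.Lg_pos
  have hμ := hr.μ_pos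
  unfold innerRate innerFloor
  field_simp
  ring

/-- Geometric convergence of the inner loop, for a fixed number of steps. -/
theorem lintegral_weighted_innerLoop_le (hr : Regular c f g)
    (hF : IsStochasticGradient νf f F c.σf) (hG : IsStochasticGradient νg g G c.σg)
    (hS : IsSampling νf νg P S) (hp : p.Admissible c) (t : ℕ)
    {W : Ω → ENNReal} (hW : Measurable[pastAlg S (beforeIter t)] W)
    {x : Ω → Vec dx} (hx : Measurable[pastAlg S (beforeIter t)] x)
    {u : Ω → InnerState dy} (hu : MeasurableInner (m := pastAlg S (beforeIter t)) u) (n : ℕ) :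
    ∫⁻ ω, W ω * ENNReal.ofReal
        (innerErr p.lam f g (x ω) (innerLoop p F G (fun s => S s ω) t (x ω) (u ω) n)) ∂P
      ≤ ∫⁻ ω, W ω * ENNReal.ofReal
        (innerRate c ^ n * innerErr p.lam f g (x ω) (u ω) + innerFloor c p) ∂P := by
  have hq := innerRate_nonneg hr
  have hN := innerFloor_nonneg (p := p) hr
  have hν : 0 ≤ innerNoise c p := by
    have := hr.Lg_pos
    unfold innerNoise; positivity
  have hle := fun k => pastAlg_mono S (beforeIter_subset_beforeInner t k)
  have hWm : Measurable W := hW.mono (pastAlg_le hS.measurable _) le_rfl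
  induction n with
  | zero =>
    refine lintegral_mono fun ω => mul_le_mul_right (ENNReal.ofReal_le_ofReal ?_) _
    simp only [innerLoop, pow_zero, one_mul]
    linarith
  | succ n ih =>
    have hx' := hx.mono (hle n) le_rfl
    have hu' := hu.mono (hle n)
    have hun := @measurable_innerLoop Ω Ξf Ξg _ _ dx dy (pastAlg S (beforeInner t n)) p F G S
      hF.measurable hG.measurable t x hx' u hu' n
      fun k hk i => measurable_slot S (Or.inr ⟨rfl, hk⟩)
    have h1 := lintegral_weighted_innerStep_le hr hF hG hS hp t n (hW.mono (hle n) le_rfl) hx'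
      hun.y hun.z
    refine h1.trans ?_
    have e1 : ∀ e : ℝ, 0 ≤ e → ∀ w : ENNReal,
        w * ENNReal.ofReal (innerRate c * e + innerNoise c p)
        = ENNReal.ofReal (innerRate c) * (w * ENNReal.ofReal e)
          + w * ENNReal.ofReal (innerNoise c p) := fun e he w => by
      rw [ENNReal.ofReal_add (mul_nonneg hq he) hν, ENNReal.ofReal_mul hq]; ring
    have e2 : ∀ J : Ω → ℝ, (∀ ω, 0 ≤ J ω) →
        ∫⁻ ω, W ω * ENNReal.ofReal (innerRate c * J ω + innerNoise c p) ∂P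
        = ENNReal.ofReal (innerRate c) * ∫⁻ ω, W ω * ENNReal.ofReal (J ω) ∂P
          + ∫⁻ ω, W ω * ENNReal.ofReal (innerNoise c p) ∂P := fun J hJ => by
      simp_rw [e1 _ (hJ _)]
      rw [lintegral_add_right _ (hWm.mul_const _), lintegral_const_mul' _ _ ENNReal.ofReal_ne_top]
    change ∫⁻ ω, W ω * ENNReal.ofReal (innerRate c * innerErr p.lam f g (x ω)
      (innerLoop p F G (fun s => S s ω) t (x ω) (u ω) n) + innerNoise c p) ∂P ≤ _
    rw [e2 _ fun ω => innerErr_nonneg _ _ _ _ _]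
    have e3 : ∀ ω, innerRate c ^ (n + 1) * innerErr p.lam f g (x ω) (u ω) + innerFloor c p
        = innerRate c * (innerRate c ^ n * innerErr p.lam f g (x ω) (u ω) + innerFloor c p)
          + innerNoise c p := fun ω => by
      linear_combination (-1 : ℝ) * innerFloor_step (p := p) hr
    simp_rw [e3]
    rw [e2 _ fun ω => add_nonneg (mul_nonneg (pow_nonneg hq n) (innerErr_nonneg _ _ _ _ _)) hN]
    gcongr

/-- Geometric convergence of the inner loop, for a number of steps known in the past. -/
theorem lintegral_weighted_innerLoop_random_le (hr : Regular c f g)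
    (hF : IsStochasticGradient νf f F c.σf) (hG : IsStochasticGradient νg g G c.σg)
    (hS : IsSampling νf νg P S) (hp : p.Admissible c) (t : ℕ)
    {W : Ω → ENNReal} (hW : Measurable[pastAlg S (beforeIter t)] W)
    {x : Ω → Vec dx} (hx : Measurable[pastAlg S (beforeIter t)] x)
    {u : Ω → InnerState dy} (hu : MeasurableInner (m := pastAlg S (beforeIter t)) u)
    {K : Ω → ℕ} (hK : Measurable[pastAlg S (beforeIter t)] K) :
    ∫⁻ ω, W ω * ENNReal.ofReal
        (innerErr p.lam f g (x ω) (innerLoop p F G (fun s => S s ω) t (x ω) (u ω) (K ω))) ∂P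
      ≤ ∫⁻ ω, W ω * ENNReal.ofReal
        (innerRate c ^ K ω * innerErr p.lam f g (x ω) (u ω) + innerFloor c p) ∂P := by
  have hle := pastAlg_le hS.measurable (beforeIter t)
  have hxm : Measurable x := hx.mono hle le_rfl
  have hum : MeasurableInner u := hu.mono hle
  -- the weights `W · 1{K = n}`
  set Wn : ℕ → Ω → ENNReal := fun n ω => if K ω = n then W ω else 0 with hWn
  have hWn_past : ∀ n, Measurable[pastAlg S (beforeIter t)] (Wn n) := fun n =>
    Measurable.ite (hK (measurableSet_singleton n)) hW measurable_const
  have hWn_meas : ∀ n, Measurable (Wn n) := fun n => (hWn_past n).mono hle le_rfl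
  have hsplit : ∀ J : ℕ → Ω → ENNReal, (∀ n, Measurable (J n)) →
      ∫⁻ ω, W ω * J (K ω) ω ∂P = ∑' n, ∫⁻ ω, Wn n ω * J n ω ∂P := fun J hJ => by
    have hm : ∀ n, AEMeasurable (fun ω => Wn n ω * J n ω) P := fun n =>
      ((hWn_meas n).mul (hJ n)).aemeasurable
    rw [← lintegral_tsum hm]
    refine lintegral_congr fun ω => ?_
    rw [tsum_eq_single (K ω) fun n hn => by simp [hWn, hn.symm]]
    simp [hWn]
  rw [hsplit (fun n ω => ENNReal.ofReal
      (innerErr p.lam f g (x ω) (innerLoop p F G (fun s => S s ω) t (x ω) (u ω) n))),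
    hsplit (fun n ω => ENNReal.ofReal
      (innerRate c ^ n * innerErr p.lam f g (x ω) (u ω) + innerFloor c p))]
  · exact ENNReal.tsum_le_tsum fun n =>
      lintegral_weighted_innerLoop_le hr hF hG hS hp t (hWn_past n) hx hu n
  · exact fun n => (((measurable_innerErr hr hp.lam_pos hp.lam_large hxm hum.y hum.z).const_mul
      _).add_const _).ennreal_ofReal
  · intro n
    have h := measurable_innerLoop (p := p) (t := t) hF.measurable hG.measurable hxm hum n
      fun k _ i => hS.measurable (.inner t k i)
    exact (measurable_innerErr hr hp.lam_pos hp.lam_large hxm h.y h.z).ennreal_ofReal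

end InnerLoop

section OuterStep

variable {Ω : Type*} [mΩ : MeasurableSpace Ω] {P : Measure Ω} [IsProbabilityMeasure P]
  {Ξf Ξg : Type*} [MeasurableSpace Ξf] [MeasurableSpace Ξg]
  {νf : Measure Ξf} {νg : Measure Ξg} {dx dy : ℕ} {c : Consts} {f g : Joint dx dy → ℝ} {p : Params}
  {F : Joint dx dy → Ξf → Joint dx dy} {G : Joint dx dy → Ξg → Joint dx dy}
  {S : Slot → Ω → Ξf × Ξg × Ξg} [Nontrivial (Vec dy)]

/-! ### The error of the warm-started inner loop along the run -/

/-- The squared distance of the warm start `(y_t, z_t)` to the exact inner solutions at `x_t`. -/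
def stateErr (lam : ℝ) (f g : Joint dx dy → ℝ) (st : State dx dy) : ℝ :=
  innerErr lam f g st.x ⟨st.y, st.z, st.calls⟩

/-- Parameters for which the squared inner error after each inner loop is of order `c₀`: the
number of inner steps beats the factor `1 + δ / c₀`, the error level caused by the inner noise lies
below `c₀`, and the estimates `δ_t` follow the recursion of the method. -/
structure Params.Accurate (p : Params) (c : Consts) (c₀ : ℝ) : Prop extends p.Admissible c where
  c₀_pos : 0 < c₀
  rate_le : ∀ δ, 0 ≤ δ → innerRate c ^ p.innerSteps δ * (1 + δ / c₀) ≤ 1 / 256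
  floor_le : innerFloor c p ≤ c₀ / 96
  drift_eq : p.drift = 34 * c.Lg ^ 2 / c.μ ^ 2
  δ₀_nonneg : 0 ≤ p.δ₀
  noise_nonneg : 0 ≤ p.floor

theorem run_δ_nonneg {c₀ : ℝ} (hp : p.Accurate c c₀) (s : Slot → Ξf × Ξg × Ξg)
    (x₀ : Vec dx) (y₀ : Vec dy) (t : ℕ) : 0 ≤ (run p F G s x₀ y₀ t).δ := by
  induction t with
  | zero => exact hp.δ₀_nonneg
  | succ t ih =>
    have h1 := hp.noise_nonneg
    have h2 : 0 ≤ p.drift := by rw [hp.drift_eq]; positivity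
    have h3 : 0 ≤ (run p F G s x₀ y₀ t).δ / 2 := by positivity
    simp only [run, outerStep]
    positivity

/-- The exact inner solutions move by at most a multiple of `‖x_{t+1} - x_t‖`. -/
theorem stateErr_succ_le (hr : Regular c f g) {c₀ : ℝ} (hp : p.Accurate c c₀)
    (s : Slot → Ξf × Ξg × Ξg) (t : ℕ) (st : State dx dy) :
    stateErr p.lam f g (outerStep p F G s t st)
      ≤ 2 * innerErr p.lam f g st.x (afterInner p F G s t st)
        + p.drift * ‖(outerStep p F G s t st).x - st.x‖ ^ 2 := by
  have hsq : ∀ a b d : Vec dy, ‖a - d‖ ^ 2 ≤ 2 * ‖a - b‖ ^ 2 + 2 * ‖d - b‖ ^ 2 := fun a b d => by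
    have h := pow_le_pow_left₀ (norm_nonneg _) (norm_sub_le (a - b) (d - b)) 2
    rw [sub_sub_sub_cancel_right] at h
    nlinarith [sq_nonneg (‖a - b‖ - ‖d - b‖)]
  set x' := (outerStep p F G s t st).x
  set u := afterInner p F G s t st
  have h1 := hsq u.y (yPen p.lam f g st.x) (yPen p.lam f g x')
  have h2 := hsq u.z (yStar g st.x) (yStar g x')
  have h3 := pow_le_pow_left₀ (norm_nonneg _)
    (hr.norm_yPen_sub_yPen_le hp.lam_pos hp.lam_large st.x x') 2
  have h4 := pow_le_pow_left₀ (norm_nonneg _) (hr.norm_yStar_sub_yStar_le st.x x') 2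
  have h5 : stateErr p.lam f g (outerStep p F G s t st)
      = ‖u.y - yPen p.lam f g x'‖ ^ 2 + ‖u.z - yStar g x'‖ ^ 2 := rfl
  have h6 : p.drift = 34 * (c.Lg / c.μ) ^ 2 := by rw [hp.drift_eq]; ring
  rw [h5, h6, innerErr]
  -- The two drifts contribute `2 (3² + 1) = 20 ≤ 34` times `(L_g / μ)² ‖x' - x‖²`.
  have h7 : 0 ≤ (c.Lg / c.μ) ^ 2 * ‖x' - st.x‖ ^ 2 := by positivity
  have e1 : (3 * (c.Lg / c.μ) * ‖x' - st.x‖) ^ 2 = 9 * ((c.Lg / c.μ) ^ 2 * ‖x' - st.x‖ ^ 2) := by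
    ring
  have e2 : (c.Lg / c.μ * ‖x' - st.x‖) ^ 2 = (c.Lg / c.μ) ^ 2 * ‖x' - st.x‖ ^ 2 := by ring
  rw [e1] at h3
  rw [e2] at h4
  linarith

theorem measurable_run_past (hF : IsStochasticGradient νf f F c.σf)
    (hG : IsStochasticGradient νg g G c.σg) (hp : p.Admissible c) (x₀ : Vec dx) (y₀ : Vec dy)
    (t : ℕ) : MeasurableState (m := pastAlg S (beforeIter t))
      fun ω => run p F G (fun s => S s ω) x₀ y₀ t :=
  @measurable_run Ω Ξf Ξg _ _ dx dy (pastAlg S (beforeIter t)) p F G S hF.measurable hG.measurable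
    hp.innerSteps_measurable x₀ y₀ t fun _ hs => measurable_slot S hs

theorem measurable_afterInner_past (hF : IsStochasticGradient νf f F c.σf)
    (hG : IsStochasticGradient νg g G c.σg) (hp : p.Admissible c) (x₀ : Vec dx) (y₀ : Vec dy)
    (t : ℕ) : MeasurableInner (m := pastAlg S (beforeOuter t))
      fun ω => afterInner p F G (fun s => S s ω) t (run p F G (fun s => S s ω) x₀ y₀ t) :=
  @measurable_afterInner Ω Ξf Ξg _ _ dx dy (pastAlg S (beforeOuter t)) p F G S hF.measurable
    hG.measurable hp.innerSteps_measurable t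
    (fun k i => measurable_slot S (show Slot.inner t k i ∈ beforeOuter t from le_refl t)) _
    ((measurable_run_past hF hG hp x₀ y₀ t).mono
      (pastAlg_mono S (beforeIter_subset_beforeOuter t)))

/-- The inner loop of iteration `t`, with a weight `W` known at its start. -/
theorem lintegral_weighted_afterInner_le (hr : Regular c f g)
    (hF : IsStochasticGradient νf f F c.σf) (hG : IsStochasticGradient νg g G c.σg)
    (hS : IsSampling νf νg P S) (hp : p.Admissible c) (x₀ : Vec dx) (y₀ : Vec dy) (t : ℕ)
    {W : Ω → ENNReal} (hW : Measurable[pastAlg S (beforeIter t)] W) :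
    ∫⁻ ω, W ω * ENNReal.ofReal (innerErr p.lam f g (run p F G (fun s => S s ω) x₀ y₀ t).x
        (afterInner p F G (fun s => S s ω) t (run p F G (fun s => S s ω) x₀ y₀ t))) ∂P
      ≤ ∫⁻ ω, W ω * ENNReal.ofReal
        (innerRate c ^ p.innerSteps (run p F G (fun s => S s ω) x₀ y₀ t).δ
          * stateErr p.lam f g (run p F G (fun s => S s ω) x₀ y₀ t) + innerFloor c p) ∂P := by
  have hst := measurable_run_past (S := S) hF hG hp x₀ y₀ t
  exact lintegral_weighted_innerLoop_random_le hr hF hG hS hp t hW hst.x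
    (u := fun ω => ⟨(run p F G (fun s => S s ω) x₀ y₀ t).y, (run p F G (fun s => S s ω) x₀ y₀ t).z,
      (run p F G (fun s => S s ω) x₀ y₀ t).calls⟩) ⟨hst.y, hst.z, hst.calls⟩
    (hp.innerSteps_measurable.comp hst.δ)

theorem rate_le_of_accurate (hr : Regular c f g) {c₀ : ℝ} (hp : p.Accurate c c₀) {δ : ℝ}
    (hδ : 0 ≤ δ) : innerRate c ^ p.innerSteps δ ≤ 1 / 256 := by
  have h1 := hp.rate_le δ hδ
  have h2 : 0 ≤ innerRate c ^ p.innerSteps δ := pow_nonneg (innerRate_nonneg hr) _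
  have h3 : 0 ≤ δ / c₀ := div_nonneg hδ hp.c₀_pos.le
  nlinarith [mul_nonneg h2 h3]

/-- The inner error stays comparable to the estimate `δ_t` that sets the number of inner steps:
the expected ratio `‖error‖² / (δ_t + c₀)` is bounded along the run. The ratio, rather than the
error itself, is controlled because the number of inner steps is random and depends on `δ_t`. -/
theorem lintegral_ratio_le (hr : Regular c f g) (hF : IsStochasticGradient νf f F c.σf)
    (hG : IsStochasticGradient νg g G c.σg) (hS : IsSampling νf νg P S) {c₀ : ℝ}
    (hp : p.Accurate c c₀) {x₀ : Vec dx} {y₀ : Vec dy}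
    (h0 : innerErr p.lam f g x₀ ⟨y₀, y₀, 0⟩ ≤ p.δ₀) (t : ℕ) :
    ∫⁻ ω, ENNReal.ofReal (stateErr p.lam f g (run p F G (fun s => S s ω) x₀ y₀ t)
      / ((run p F G (fun s => S s ω) x₀ y₀ t).δ + c₀)) ∂P ≤ 2 := by
  have hc := hp.c₀_pos
  induction t with
  | zero =>
    have h1 : innerErr p.lam f g x₀ ⟨y₀, y₀, 0⟩ / (p.δ₀ + c₀) ≤ 1 :=
      (div_le_one (by linarith [hp.δ₀_nonneg])).2 (by linarith)
    have h2 : ENNReal.ofReal (innerErr p.lam f g x₀ ⟨y₀, y₀, 0⟩ / (p.δ₀ + c₀)) ≤ 1 := by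
      rw [← ENNReal.ofReal_one]; exact ENNReal.ofReal_le_ofReal h1
    change ∫⁻ ω, ENNReal.ofReal (innerErr p.lam f g x₀ ⟨y₀, y₀, 0⟩ / (p.δ₀ + c₀)) ∂P ≤ 2
    rw [lintegral_const, measure_univ, mul_one]
    exact h2.trans one_le_two
  | succ t ih =>
    set st : Ω → State dx dy := fun ω => run p F G (fun s => S s ω) x₀ y₀ t with hst
    set E : Ω → ℝ := fun ω => innerErr p.lam f g (st ω).x
      (afterInner p F G (fun s => S s ω) t (st ω)) with hE
    have hδ : ∀ ω, 0 ≤ (st ω).δ := fun ω => run_δ_nonneg hp _ _ _ _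
    have hstm := measurable_run_past (S := S) hF hG hp.toAdmissible x₀ y₀ t
    have hE0 : ∀ ω, 0 ≤ E ω := fun ω => innerErr_nonneg _ _ _ _ _
    -- The factor `2` in front of the error after the inner loop, over a denominator that is at least
    -- half of `δ_t + c₀`.
    set W : Ω → ENNReal := fun ω => ENNReal.ofReal (4 / ((st ω).δ + c₀)) with hW
    have hWm : Measurable[pastAlg S (beforeIter t)] W :=
      ((hstm.δ.add_const c₀).const_div 4).ennreal_ofReal
    have hstep : ∀ ω, ENNReal.ofReal (stateErr p.lam f g (outerStep p F G (fun s => S s ω) t (st ω))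
        / ((outerStep p F G (fun s => S s ω) t (st ω)).δ + c₀)) ≤ 1 + W ω * ENNReal.ofReal (E ω) := by
      intro ω
      have h1 := stateErr_succ_le (F := F) (G := G) hr hp (fun s => S s ω) t (st ω)
      set D := p.drift * ‖(outerStep p F G (fun s => S s ω) t (st ω)).x - (st ω).x‖ ^ 2 with hD
      have hD0 : 0 ≤ D := by
        have : 0 ≤ p.drift := by rw [hp.drift_eq]; positivity
        positivity
      have h2 : (outerStep p F G (fun s => S s ω) t (st ω)).δ = (st ω).δ / 2 + D + p.floor := rfl
      have h3 := hp.noise_nonneg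
      have h4 := hδ ω
      have h5 := hE0 ω
      rw [← ENNReal.ofReal_mul (by positivity), ← ENNReal.ofReal_one,
        ← ENNReal.ofReal_add zero_le_one (by positivity), h2]
      refine ENNReal.ofReal_le_ofReal ?_
      rw [div_le_iff₀ (by positivity)]
      refine h1.trans ?_
      have h6 : 4 / ((st ω).δ + c₀) * E ω * ((st ω).δ / 2 + c₀ / 2) = 2 * E ω := by
        have : (st ω).δ + c₀ ≠ 0 := by positivity
        field_simp; norm_num; ring
      have h7 : 0 ≤ 4 / ((st ω).δ + c₀) * E ω := by positivity
      have h8 : 0 ≤ 4 / ((st ω).δ + c₀) * E ω * (D + p.floor + c₀ / 2) := by positivity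
      change 2 * E ω + D ≤ _
      nlinarith
    have hpath : ∀ ω, W ω * ENNReal.ofReal (innerRate c ^ p.innerSteps (st ω).δ
        * stateErr p.lam f g (st ω) + innerFloor c p)
        ≤ ENNReal.ofReal (1 / 64) * ENNReal.ofReal (stateErr p.lam f g (st ω) / ((st ω).δ + c₀))
          + ENNReal.ofReal (1 / 24) := by
      intro ω
      have h1 := rate_le_of_accurate hr hp (hδ ω)
      have h2 := hp.floor_le
      have h3 : 0 ≤ stateErr p.lam f g (st ω) := innerErr_nonneg _ _ _ _ _
      have h4 := hδ ω
      have h5 : 0 < (st ω).δ + c₀ := by positivity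
      rw [← ENNReal.ofReal_mul (by positivity), ← ENNReal.ofReal_mul (by norm_num),
        ← ENNReal.ofReal_add (by positivity) (by norm_num)]
      refine ENNReal.ofReal_le_ofReal ?_
      rw [div_mul_eq_mul_div, div_le_iff₀ h5, add_mul, mul_assoc, div_mul_cancel₀ _ h5.ne']
      nlinarith [mul_le_mul_of_nonneg_right h1 h3]
    calc ∫⁻ ω, ENNReal.ofReal (stateErr p.lam f g (outerStep p F G (fun s => S s ω) t (st ω))
          / ((outerStep p F G (fun s => S s ω) t (st ω)).δ + c₀)) ∂P
        ≤ ∫⁻ ω, (1 + W ω * ENNReal.ofReal (E ω)) ∂P := lintegral_mono hstep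
      _ = 1 + ∫⁻ ω, W ω * ENNReal.ofReal (E ω) ∂P := by
          rw [lintegral_add_left measurable_const, lintegral_one, measure_univ]
      _ ≤ 1 + ∫⁻ ω, (ENNReal.ofReal (1 / 64)
            * ENNReal.ofReal (stateErr p.lam f g (st ω) / ((st ω).δ + c₀))
            + ENNReal.ofReal (1 / 24)) ∂P := by
          gcongr 1 + ?_
          exact (lintegral_weighted_afterInner_le hr hF hG hS hp.toAdmissible x₀ y₀ t hWm).trans
            (lintegral_mono hpath)
      _ = 1 + (ENNReal.ofReal (1 / 64)
            * ∫⁻ ω, ENNReal.ofReal (stateErr p.lam f g (st ω) / ((st ω).δ + c₀)) ∂P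
            + ENNReal.ofReal (1 / 24)) := by
          rw [lintegral_add_right _ measurable_const,
            lintegral_const_mul' _ _ ENNReal.ofReal_ne_top, lintegral_const, measure_univ, mul_one]
      _ ≤ 1 + (ENNReal.ofReal (1 / 64) * ENNReal.ofReal 2 + ENNReal.ofReal (1 / 24)) := by
          rw [show ENNReal.ofReal 2 = 2 by norm_num]
          gcongr
      _ ≤ 2 := by
          rw [← ENNReal.ofReal_mul (by norm_num), ← ENNReal.ofReal_add (by norm_num) (by norm_num),
            ← ENNReal.ofReal_one, ← ENNReal.ofReal_add (by norm_num) (by norm_num),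
            show (2 : ENNReal) = ENNReal.ofReal 2 by norm_num]
          exact ENNReal.ofReal_le_ofReal (by norm_num)

/-- The expected inner error after each inner loop. -/
theorem lintegral_afterInner_le (hr : Regular c f g) (hF : IsStochasticGradient νf f F c.σf)
    (hG : IsStochasticGradient νg g G c.σg) (hS : IsSampling νf νg P S) {c₀ : ℝ}
    (hp : p.Accurate c c₀) {x₀ : Vec dx} {y₀ : Vec dy}
    (h0 : innerErr p.lam f g x₀ ⟨y₀, y₀, 0⟩ ≤ p.δ₀) (t : ℕ) :
    ∫⁻ ω, ENNReal.ofReal (innerErr p.lam f g (run p F G (fun s => S s ω) x₀ y₀ t).x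
        (afterInner p F G (fun s => S s ω) t (run p F G (fun s => S s ω) x₀ y₀ t))) ∂P
      ≤ ENNReal.ofReal (c₀ / 48) := by
  have hc := hp.c₀_pos
  set st : Ω → State dx dy := fun ω => run p F G (fun s => S s ω) x₀ y₀ t with hst
  have hδ : ∀ ω, 0 ≤ (st ω).δ := fun ω => run_δ_nonneg hp _ _ _ _
  have h1 := lintegral_weighted_afterInner_le hr hF hG hS hp.toAdmissible x₀ y₀ t
    (W := fun _ => 1) measurable_const
  simp only [one_mul] at h1
  have hpath : ∀ ω, ENNReal.ofReal (innerRate c ^ p.innerSteps (st ω).δ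
      * stateErr p.lam f g (st ω) + innerFloor c p)
      ≤ ENNReal.ofReal (c₀ / 256) * ENNReal.ofReal (stateErr p.lam f g (st ω) / ((st ω).δ + c₀))
        + ENNReal.ofReal (c₀ / 96) := by
    intro ω
    have h2 := hp.rate_le _ (hδ ω)
    have h3 := hp.floor_le
    have h4 : 0 ≤ stateErr p.lam f g (st ω) := innerErr_nonneg _ _ _ _ _
    have h5 := hδ ω
    have h6 : 0 < (st ω).δ + c₀ := by positivity
    rw [← ENNReal.ofReal_mul (by positivity), ← ENNReal.ofReal_add (by positivity) (by positivity)]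
    refine ENNReal.ofReal_le_ofReal (add_le_add ?_ h3)
    rw [← mul_div_assoc, le_div_iff₀ h6]
    have h7 : innerRate c ^ p.innerSteps (st ω).δ * ((st ω).δ + c₀) ≤ c₀ / 256 := by
      have e : innerRate c ^ p.innerSteps (st ω).δ * ((st ω).δ + c₀)
          = c₀ * (innerRate c ^ p.innerSteps (st ω).δ * (1 + (st ω).δ / c₀)) := by
        field_simp; ring
      rw [e]
      nlinarith
    nlinarith [mul_le_mul_of_nonneg_right h7 h4]
  calc _ ≤ _ := h1
    _ ≤ ∫⁻ ω, (ENNReal.ofReal (c₀ / 256)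
          * ENNReal.ofReal (stateErr p.lam f g (st ω) / ((st ω).δ + c₀))
          + ENNReal.ofReal (c₀ / 96)) ∂P := lintegral_mono hpath
    _ = ENNReal.ofReal (c₀ / 256)
          * ∫⁻ ω, ENNReal.ofReal (stateErr p.lam f g (st ω) / ((st ω).δ + c₀)) ∂P
          + ENNReal.ofReal (c₀ / 96) := by
        rw [lintegral_add_right _ measurable_const,
          lintegral_const_mul' _ _ ENNReal.ofReal_ne_top, lintegral_const, measure_univ, mul_one]
    _ ≤ ENNReal.ofReal (c₀ / 256) * ENNReal.ofReal 2 + ENNReal.ofReal (c₀ / 96) := by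
        rw [show ENNReal.ofReal 2 = 2 by norm_num]
        gcongr
        exact lintegral_ratio_le hr hF hG hS hp h0 t
    _ ≤ ENNReal.ofReal (c₀ / 48) := by
        rw [← ENNReal.ofReal_mul (by positivity), ← ENNReal.ofReal_add (by positivity) (by positivity)]
        exact ENNReal.ofReal_le_ofReal (by linarith)

end OuterStep

/-! ### Descent of the hyper-objective -/

section Descent

variable {Ω : Type*} [mΩ : MeasurableSpace Ω] {P : Measure Ω} [IsProbabilityMeasure P]
  {Ξf Ξg : Type*} [MeasurableSpace Ξf] [MeasurableSpace Ξg]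
  {νf : Measure Ξf} {νg : Measure Ξg} {dx dy : ℕ} {c : Consts} {f g : Joint dx dy → ℝ} {p : Params}
  {F : Joint dx dy → Ξf → Joint dx dy} {G : Joint dx dy → Ξg → Joint dx dy}
  {S : Slot → Ω → Ξf × Ξg × Ξg} [Nontrivial (Vec dy)]

/-- The optimality gap `φ(x) - inf φ`. -/
def gap (f g : Joint dx dy → ℝ) (x : Vec dx) : ℝ := hyper f g x - ⨅ x', hyper f g x'

theorem gap_nonneg (hr : Regular c f g) (x : Vec dx) : 0 ≤ gap f g x :=
  sub_nonneg.2 (ciInf_le hr.hyper_bddBelow x)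

theorem measurable_gap (hr : Regular c f g) : Measurable (gap f g) :=
  hr.differentiable_hyper.continuous.measurable.sub_const _

theorem measurable_gradient_hyper : Measurable (gradient (hyper f g)) :=
  (rieszSymm (Vec dx)).continuous.measurable.comp (measurable_fderiv ℝ (hyper f g))

/-- A bound for the variance of the hyper-gradient estimator. -/
def outerNoise (c : Consts) (p : Params) : ℝ :=
  (2 * c.σf ^ 2 + 8 * p.lam ^ 2 * c.σg ^ 2) / p.Bout

/-- The gap after a step from `x` to `x'`, plus multiples of the squared step length and of the
squared gradient at `x`. Its expectation exceeds the gap at `x` by no more than the estimator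
error. -/
def descentQuantity (f g : Joint dx dy → ℝ) (η : ℝ) (x x' : Vec dx) : ℝ :=
  gap f g x' + (4 * η)⁻¹ * ‖x' - x‖ ^ 2 + η / 2 * ‖gradient (hyper f g) x‖ ^ 2

theorem descentQuantity_nonneg (hr : Regular c f g) {η : ℝ} (hη : 0 < η) (x x' : Vec dx) :
    0 ≤ descentQuantity f g η x x' := by
  have := gap_nonneg hr x'
  unfold descentQuantity
  positivity

/-- The hyper-gradient estimator is the surrogate gradient perturbed by centered noise. -/
theorem exists_outer_noise (hF : IsStochasticGradient νf f F c.σf)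
    (hG : IsStochasticGradient νg g G c.σg) (hS : IsSampling νf νg P S) (hB : 0 < p.Bout)
    (t : ℕ) (x : Vec dx) (y z : Vec dy) :
    ∃ N : Ω → Vec dx, IsNoise P N (outerNoise c p) ∧ ∀ ω,
      hyperGradEst p F G (fun s => S s ω) t x y z = surrogateGrad p.lam f g x y z + N ω := by
  have hm := fun i => hS.measurable (.outer t i)
  let fstL := WithLp.fstL 2 ℝ (Vec dx) (Vec dy)
  set N : ℕ → Ω → Vec dx := fun i ω =>
    fstL (F (pt x y) (S (.outer t i) ω).1 - gradient f (pt x y))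
      + p.lam • (fstL (G (pt x y) (S (.outer t i) ω).2.1 - gradient g (pt x y))
        - fstL (G (pt x z) (S (.outer t i) ω).2.2 - gradient g (pt x z))) with hN
  have hN_noise : ∀ i, IsNoise P (N i) (2 * (c.σf ^ 2 + p.lam ^ 2 * (2 * (c.σg ^ 2 + c.σg ^ 2)))) :=
    fun i => ((hF.isNoise (hm i).fst (hS.law_f _) _).clm fstL norm_fst_le_joint).add
      ((((hG.isNoise (hm i).snd.fst (hS.law_g_y _) _).clm fstL norm_fst_le_joint).sub
        ((hG.isNoise (hm i).snd.snd (hS.law_g_z _) _).clm fstL norm_fst_le_joint)).smul p.lam)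
  have hFm : Measurable (F (pt x y)) := hF.measurable.of_uncurry_left
  have hGm : ∀ y, Measurable (G (pt x y)) := fun y => hG.measurable.of_uncurry_left
  have hζ : Measurable fun ξ : Ξf × Ξg × Ξg => fstL (F (pt x y) ξ.1 - gradient f (pt x y))
      + p.lam • (fstL (G (pt x y) ξ.2.1 - gradient g (pt x y))
        - fstL (G (pt x z) ξ.2.2 - gradient g (pt x z))) :=
    (fstL.measurable.comp ((hFm.comp measurable_fst).sub_const _)).add
      (((fstL.measurable.comp (((hGm y).comp measurable_snd.fst).sub_const _)).sub
        (fstL.measurable.comp (((hGm z).comp measurable_snd.snd).sub_const _))).const_smul p.lam)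
  have hN_ind : iIndepFun N P := (iIndepFun_outer_batch hS t).comp _ fun _ => hζ
  refine ⟨fun ω => batchMean p.Bout (fun i => N i ω),
    (IsNoise.batchMean hN_noise hN_ind hB).mono (le_of_eq (by rw [outerNoise]; ring)), fun ω => ?_⟩
  have e : batchMean p.Bout (fun i => N i ω)
      = (batchMean p.Bout (fun i => (F (pt x y) (S (.outer t i) ω).1).fst)
          - (gradient f (pt x y)).fst)
        + p.lam • ((batchMean p.Bout (fun i => (G (pt x y) (S (.outer t i) ω).2.1).fst)
            - (gradient g (pt x y)).fst)
          - (batchMean p.Bout (fun i => (G (pt x z) (S (.outer t i) ω).2.2).fst)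
            - (gradient g (pt x z)).fst)) := by
    rw [← batchMean_sub_const hB (fun i => (F (pt x y) (S (.outer t i) ω).1).fst),
      ← batchMean_sub_const hB (fun i => (G (pt x y) (S (.outer t i) ω).2.1).fst),
      ← batchMean_sub_const hB (fun i => (G (pt x z) (S (.outer t i) ω).2.2).fst),
      ← batchMean_sub, ← batchMean_smul, ← batchMean_add]
    rfl
  dsimp only
  rw [e]
  simp only [hyperGradEst, surrogateGrad]
  module

/-- One outer step from a fixed state. The step size `1 / (12 ℓ κ³)` leaves half of the negative
term `-(η / 2) ‖G_t‖²` of the descent inequality for the squared step length. -/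
theorem lintegral_outerStep_le (hr : Regular c f g) (hF : IsStochasticGradient νf f F c.σf)
    (hG : IsStochasticGradient νg g G c.σg) (hS : IsSampling νf νg P S) (hB : 0 < p.Bout)
    (hη : 0 < p.ηx) (hηL : 12 * (c.ell * c.kappa ^ 3) * p.ηx = 1)
    (t : ℕ) (x : Vec dx) (y z : Vec dy) :
    ∫⁻ ω, ENNReal.ofReal (descentQuantity f g p.ηx x
        (x - p.ηx • hyperGradEst p F G (fun s => S s ω) t x y z)) ∂P
      ≤ ENNReal.ofReal (gap f g x + p.ηx / 2 *
        (‖surrogateGrad p.lam f g x y z - gradient (hyper f g) x‖ ^ 2 + outerNoise c p)) := by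
  obtain ⟨N, hN, hest⟩ := exists_outer_noise (p := p) hF hG hS hB t x y z
  set s := surrogateGrad p.lam f g x y z
  set D := gradient (hyper f g) x with hD
  have h1 := hN.lintegral_le (k := p.ηx / 2) (by positivity)
    (a := gap f g x + p.ηx / 2 * ‖s - D‖ ^ 2) (b := p.ηx • (s - D))
    (fun ω => descentQuantity_nonneg hr hη x
      (x - p.ηx • hyperGradEst p F G (fun s => S s ω) t x y z)) fun ω => by
    rw [hest]
    have h2 := hr.hyper_le_quadratic x (x - p.ηx • (s + N ω))
    have e1 : x - p.ηx • (s + N ω) - x = -(p.ηx • (s + N ω)) := by abel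
    rw [e1, inner_neg_right, real_inner_smul_right, norm_neg, norm_smul,
      Real.norm_of_nonneg hη.le, mul_pow, ← hD] at h2
    have e2 : 3 * (c.ell * c.kappa ^ 3) * (p.ηx ^ 2 * ‖s + N ω‖ ^ 2)
        = p.ηx / 4 * ‖s + N ω‖ ^ 2 := by
      linear_combination (p.ηx / 4 * ‖s + N ω‖ ^ 2) * hηL
    have e3 : (4 * p.ηx)⁻¹ * (p.ηx ^ 2 * ‖s + N ω‖ ^ 2) = p.ηx / 4 * ‖s + N ω‖ ^ 2 := by
      field_simp
    have e4 : ‖s + N ω‖ ^ 2 = ‖s‖ ^ 2 + 2 * inner ℝ s (N ω) + ‖N ω‖ ^ 2 := norm_add_sq_real _ _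
    have e5 : ‖s - D‖ ^ 2 = ‖s‖ ^ 2 - 2 * inner ℝ s D + ‖D‖ ^ 2 := norm_sub_sq_real _ _
    have e6 : inner ℝ D (s + N ω) = inner ℝ s D + inner ℝ D (N ω) := by
      rw [inner_add_right, real_inner_comm]
    have e7 : inner ℝ (p.ηx • (s - D)) (N ω) = p.ηx * (inner ℝ s (N ω) - inner ℝ D (N ω)) := by
      rw [real_inner_smul_left, inner_sub_left]
    rw [descentQuantity, gap, gap, e1, norm_neg, norm_smul, Real.norm_of_nonneg hη.le, mul_pow, e3,
      e7, ← hD, e5]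
    rw [e2, e6, e4] at h2
    rw [e4]
    linarith
  refine h1.trans_eq ?_
  congr 1
  ring

/-- One iteration along the run. -/
theorem lintegral_descent_le (hr : Regular c f g) (hF : IsStochasticGradient νf f F c.σf)
    (hG : IsStochasticGradient νg g G c.σg) (hS : IsSampling νf νg P S) {c₀ β : ℝ}
    (hp : p.Accurate c c₀) (hη : 0 < p.ηx) (hηL : 12 * (c.ell * c.kappa ^ 3) * p.ηx = 1)
    {x₀ : Vec dx} {y₀ : Vec dy} (h0 : innerErr p.lam f g x₀ ⟨y₀, y₀, 0⟩ ≤ p.δ₀)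
    (hβ : 6 * (c.Lf ^ 2 + p.lam ^ 2 * c.Lg ^ 2) * (c₀ / 48)
      + 3 * (4 * (c.ell * c.kappa ^ 3) / p.lam) ^ 2 + outerNoise c p ≤ β) (t : ℕ) :
    ∫⁻ ω, ENNReal.ofReal (descentQuantity f g p.ηx (run p F G (fun s => S s ω) x₀ y₀ t).x
        (run p F G (fun s => S s ω) x₀ y₀ (t + 1)).x) ∂P
      ≤ ∫⁻ ω, ENNReal.ofReal (gap f g (run p F G (fun s => S s ω) x₀ y₀ t).x) ∂P
        + ENNReal.ofReal (p.ηx / 2 * β) := by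
  have hc := hp.c₀_pos
  have hV : 0 ≤ outerNoise c p := by unfold outerNoise; positivity
  set st : Ω → State dx dy := fun ω => run p F G (fun s => S s ω) x₀ y₀ t with hst
  set u : Ω → InnerState dy := fun ω => afterInner p F G (fun s => S s ω) t (st ω) with hu
  have hstm := (measurable_run_past (S := S) hF hG hp.toAdmissible x₀ y₀ t).mono
    (pastAlg_mono S (beforeIter_subset_beforeOuter t))
  have hum := measurable_afterInner_past (S := S) hF hG hp.toAdmissible x₀ y₀ t
  have hstm' := hstm.mono (pastAlg_le hS.measurable _)
  have h1 : ∫⁻ ω, ENNReal.ofReal (descentQuantity f g p.ηx (st ω).x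
        (run p F G (fun s => S s ω) x₀ y₀ (t + 1)).x) ∂P
      ≤ ∫⁻ ω, ENNReal.ofReal (gap f g (st ω).x + p.ηx / 2 *
        (‖surrogateGrad p.lam f g (st ω).x (u ω).y (u ω).z - gradient (hyper f g) (st ω).x‖ ^ 2
          + outerNoise c p)) ∂P := by
    refine lintegral_fresh_le hS.measurable hS.indep (b := fun i => .outer t i)
      (I := beforeOuter t) (X := fun ω => ((st ω).x, (u ω).y, (u ω).z))
      (h := fun a ξ => ENNReal.ofReal (descentQuantity f g p.ηx a.1
        (a.1 - p.ηx • hyperGradEst p F G (fun s => ξ s.index) t a.1 a.2.1 a.2.2)))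
      (h' := fun a => ENNReal.ofReal (gap f g a.1 + p.ηx / 2 *
        (‖surrogateGrad p.lam f g a.1 a.2.1 a.2.2 - gradient (hyper f g) a.1‖ ^ 2
          + outerNoise c p))) (fun i h => lt_irrefl t h) (hstm.x.prodMk (hum.y.prodMk hum.z)) ?_
      fun a => lintegral_outerStep_le hr hF hG hS hp.Bout_pos hη hηL t _ _ _
    have hx : Measurable fun q : (Vec dx × Vec dy × Vec dy) × (ℕ → Ξf × Ξg × Ξg) => q.1.1 :=
      measurable_fst.fst
    have hest := measurable_hyperGradEst (p := p) (t := t) hF.measurable hG.measurable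
      (S := fun s (q : (Vec dx × Vec dy × Vec dy) × (ℕ → Ξf × Ξg × Ξg)) => q.2 s.index)
      (fun i => (measurable_pi_apply i).comp measurable_snd) hx measurable_fst.snd.fst
      measurable_fst.snd.snd
    have hx' := hx.sub (hest.const_smul p.ηx)
    exact ((((measurable_gap hr).comp hx').add
      (((hx'.sub hx).norm.pow_const 2).const_mul (4 * p.ηx)⁻¹)).add
      (((measurable_gradient_hyper.comp hx).norm.pow_const 2).const_mul
        (p.ηx / 2))).ennreal_ofReal
  refine h1.trans ?_
  set L := c.Lf ^ 2 + p.lam ^ 2 * c.Lg ^ 2 with hL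
  have hL0 : 0 ≤ L := by positivity
  set b := 3 * (4 * (c.ell * c.kappa ^ 3) / p.lam) ^ 2 + outerNoise c p with hb
  have hb0 : 0 ≤ b := by positivity
  have h2 : ∀ ω, ENNReal.ofReal (gap f g (st ω).x + p.ηx / 2 *
      (‖surrogateGrad p.lam f g (st ω).x (u ω).y (u ω).z - gradient (hyper f g) (st ω).x‖ ^ 2
        + outerNoise c p)) ≤ ENNReal.ofReal (gap f g (st ω).x)
      + (ENNReal.ofReal (p.ηx / 2 * (6 * L))
        * ENNReal.ofReal (innerErr p.lam f g (st ω).x (u ω)) + ENNReal.ofReal (p.ηx / 2 * b)) := by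
    intro ω
    have h3 := hr.norm_surrogateGrad_sub_sq_le hp.lam_pos hp.lam_large (st ω).x (u ω).y (u ω).z
    have h4 := gap_nonneg hr (st ω).x
    have h5 : 0 ≤ innerErr p.lam f g (st ω).x (u ω) := innerErr_nonneg _ _ _ _ _
    rw [← ENNReal.ofReal_mul (by positivity), ← ENNReal.ofReal_add (by positivity) (by positivity),
      ← ENNReal.ofReal_add h4 (by positivity)]
    refine ENNReal.ofReal_le_ofReal ?_
    have h6 : ‖surrogateGrad p.lam f g (st ω).x (u ω).y (u ω).z
        - gradient (hyper f g) (st ω).x‖ ^ 2 + outerNoise c p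
        ≤ 6 * L * innerErr p.lam f g (st ω).x (u ω) + b := by
      rw [innerErr]; linarith
    have h7 := mul_le_mul_of_nonneg_left h6 (half_pos hη).le
    linarith
  have hgapm : Measurable fun ω => ENNReal.ofReal (gap f g (st ω).x) :=
    ((measurable_gap hr).comp hstm'.x).ennreal_ofReal
  calc _ ≤ _ := lintegral_mono h2
    _ = ∫⁻ ω, ENNReal.ofReal (gap f g (st ω).x) ∂P + (ENNReal.ofReal (p.ηx / 2 * (6 * L))
        * ∫⁻ ω, ENNReal.ofReal (innerErr p.lam f g (st ω).x (u ω)) ∂P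
          + ENNReal.ofReal (p.ηx / 2 * b)) := by
        rw [lintegral_add_left hgapm,
          lintegral_add_right _ measurable_const, lintegral_const_mul' _ _ ENNReal.ofReal_ne_top,
          lintegral_const, measure_univ, mul_one]
    _ ≤ ∫⁻ ω, ENNReal.ofReal (gap f g (st ω).x) ∂P + (ENNReal.ofReal (p.ηx / 2 * (6 * L))
        * ENNReal.ofReal (c₀ / 48) + ENNReal.ofReal (p.ηx / 2 * b)) := by
        gcongr
        exact lintegral_afterInner_le hr hF hG hS hp h0 t
    _ ≤ _ := by
        gcongr
        rw [← ENNReal.ofReal_mul (by positivity),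
          ← ENNReal.ofReal_add (by positivity) (by positivity)]
        refine ENNReal.ofReal_le_ofReal ?_
        have := mul_le_mul_of_nonneg_left hβ (half_pos hη).le
        rw [hb]
        linarith

/-- The summed descent inequality, with real expectations. -/
theorem sum_descent_le (hr : Regular c f g) (hF : IsStochasticGradient νf f F c.σf)
    (hG : IsStochasticGradient νg g G c.σg) (hS : IsSampling νf νg P S) {c₀ β : ℝ}
    (hp : p.Accurate c c₀) (hη : 0 < p.ηx) (hηL : 12 * (c.ell * c.kappa ^ 3) * p.ηx = 1)
    {x₀ : Vec dx} {y₀ : Vec dy} (h0 : innerErr p.lam f g x₀ ⟨y₀, y₀, 0⟩ ≤ p.δ₀) (hβ0 : 0 ≤ β)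
    (hβ : 6 * (c.Lf ^ 2 + p.lam ^ 2 * c.Lg ^ 2) * (c₀ / 48)
      + 3 * (4 * (c.ell * c.kappa ^ 3) / p.lam) ^ 2 + outerNoise c p ≤ β) :
    (∀ t, Integrable (fun ω => ‖gradient (hyper f g) (run p F G (fun s => S s ω) x₀ y₀ t).x‖ ^ 2) P)
    ∧ (∀ t, Integrable (fun ω => ‖(run p F G (fun s => S s ω) x₀ y₀ (t + 1)).x
        - (run p F G (fun s => S s ω) x₀ y₀ t).x‖ ^ 2) P)
    ∧ ∀ n : ℕ, ∑ t ∈ Finset.range n,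
        ((4 * p.ηx)⁻¹ * ∫ ω, ‖(run p F G (fun s => S s ω) x₀ y₀ (t + 1)).x
            - (run p F G (fun s => S s ω) x₀ y₀ t).x‖ ^ 2 ∂P
          + p.ηx / 2 * ∫ ω, ‖gradient (hyper f g) (run p F G (fun s => S s ω) x₀ y₀ t).x‖ ^ 2 ∂P)
      ≤ gap f g x₀ + n * (p.ηx / 2 * β) := by
  set X : ℕ → Ω → Vec dx := fun t ω => (run p F G (fun s => S s ω) x₀ y₀ t).x with hX
  have hXm : ∀ t, Measurable (X t) := fun t =>
    ((measurable_run_past (S := S) hF hG hp.toAdmissible x₀ y₀ t).mono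
      (pastAlg_le hS.measurable _)).x
  have hdm : ∀ t, Measurable fun ω => ‖X (t + 1) ω - X t ω‖ ^ 2 := fun t =>
    ((hXm (t + 1)).sub (hXm t)).norm.pow_const 2
  have hgm : ∀ t, Measurable fun ω => ‖gradient (hyper f g) (X t ω)‖ ^ 2 := fun t =>
    (measurable_gradient_hyper.comp (hXm t)).norm.pow_const 2
  set A : ℕ → ENNReal := fun t => ∫⁻ ω, ENNReal.ofReal (gap f g (X t ω)) ∂P with hA
  set d : ℕ → ENNReal := fun t => ∫⁻ ω, ENNReal.ofReal (‖X (t + 1) ω - X t ω‖ ^ 2) ∂P with hd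
  set e : ℕ → ENNReal := fun t =>
    ∫⁻ ω, ENNReal.ofReal (‖gradient (hyper f g) (X t ω)‖ ^ 2) ∂P with he
  have hi0 : 0 < (4 * p.ηx)⁻¹ := by positivity
  have hstep : ∀ t, A (t + 1) + (ENNReal.ofReal (4 * p.ηx)⁻¹ * d t
      + ENNReal.ofReal (p.ηx / 2) * e t) ≤ A t + ENNReal.ofReal (p.ηx / 2 * β) := by
    intro t
    refine le_trans (le_of_eq ?_) (lintegral_descent_le hr hF hG hS hp hη hηL h0 hβ t)
    rw [hA, hd, he]
    dsimp only
    have hgapm : Measurable fun ω => ENNReal.ofReal (gap f g (X (t + 1) ω)) :=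
      ((measurable_gap hr).comp (hXm (t + 1))).ennreal_ofReal
    rw [← lintegral_const_mul' _ _ ENNReal.ofReal_ne_top,
      ← lintegral_const_mul' _ _ ENNReal.ofReal_ne_top,
      ← lintegral_add_left ((hdm t).ennreal_ofReal.const_mul _),
      ← lintegral_add_left hgapm]
    refine lintegral_congr fun ω => ?_
    have := gap_nonneg hr (X (t + 1) ω)
    rw [← ENNReal.ofReal_mul hi0.le, ← ENNReal.ofReal_mul (by positivity),
      ← ENNReal.ofReal_add (by positivity) (by positivity),
      ← ENNReal.ofReal_add this (by positivity), ← add_assoc]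
    rfl
  have hsum : ∀ n, A n + ∑ t ∈ Finset.range n, (ENNReal.ofReal (4 * p.ηx)⁻¹ * d t
      + ENNReal.ofReal (p.ηx / 2) * e t)
      ≤ ENNReal.ofReal (gap f g x₀ + n * (p.ηx / 2 * β)) := by
    intro n
    induction n with
    | zero =>
      have : A 0 = ENNReal.ofReal (gap f g x₀) := by
        change ∫⁻ ω, ENNReal.ofReal (gap f g x₀) ∂P = _
        rw [lintegral_const, measure_univ, mul_one]
      simp [this]
    | succ n ih =>
      have hg := gap_nonneg hr x₀
      rw [Finset.sum_range_succ, add_comm (∑ t ∈ Finset.range n, _), ← add_assoc]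
      refine (add_le_add_left (hstep n) _).trans ?_
      rw [add_right_comm]
      refine (add_le_add_left ih _).trans ?_
      rw [← ENNReal.ofReal_add (by positivity) (by positivity)]
      refine ENNReal.ofReal_le_ofReal (le_of_eq ?_)
      push_cast
      ring
  have hfin : ∀ t, ENNReal.ofReal (4 * p.ηx)⁻¹ * d t + ENNReal.ofReal (p.ηx / 2) * e t ≠ ⊤ := by
    intro t
    refine ne_top_of_le_ne_top ENNReal.ofReal_ne_top (le_trans ?_ (hsum (t + 1)))
    refine le_trans ?_ le_add_self
    exact Finset.single_le_sum (f := fun t => ENNReal.ofReal (4 * p.ηx)⁻¹ * d t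
      + ENNReal.ofReal (p.ηx / 2) * e t) (fun _ _ => zero_le) (Finset.self_mem_range_succ t)
  have hvint : ∀ {v : Ω → ℝ} {r : ℝ}, 0 < r → Measurable v → (∀ ω, 0 ≤ v ω) →
      ENNReal.ofReal r * ∫⁻ ω, ENNReal.ofReal (v ω) ∂P ≠ ⊤ → Integrable v P := by
    intro v r hr' hv hv0 htop
    refine ⟨hv.aestronglyMeasurable, ?_⟩
    rw [hasFiniteIntegral_iff_ofReal (Filter.Eventually.of_forall hv0)]
    refine lt_top_iff_ne_top.2 fun h => htop ?_
    rw [h, ENNReal.mul_top (ENNReal.ofReal_pos.2 hr').ne']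
  have hd_int : ∀ t, Integrable (fun ω => ‖X (t + 1) ω - X t ω‖ ^ 2) P := fun t =>
    hvint hi0 (hdm t) (fun _ => sq_nonneg _)
      (ne_top_of_le_ne_top (hfin t) le_self_add)
  have he_int : ∀ t, Integrable (fun ω => ‖gradient (hyper f g) (X t ω)‖ ^ 2) P := fun t =>
    hvint (half_pos hη) (hgm t) (fun _ => sq_nonneg _)
      (ne_top_of_le_ne_top (hfin t) le_add_self)
  refine ⟨he_int, hd_int, fun n => ?_⟩
  have hg := gap_nonneg hr x₀
  have h1 : ENNReal.ofReal (∑ t ∈ Finset.range n,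
      ((4 * p.ηx)⁻¹ * ∫ ω, ‖X (t + 1) ω - X t ω‖ ^ 2 ∂P
        + p.ηx / 2 * ∫ ω, ‖gradient (hyper f g) (X t ω)‖ ^ 2 ∂P))
      ≤ ENNReal.ofReal (gap f g x₀ + n * (p.ηx / 2 * β)) := by
    refine le_trans (le_of_eq ?_) (le_trans le_add_self (hsum n))
    have hd0 : ∀ t, 0 ≤ ∫ ω, ‖X (t + 1) ω - X t ω‖ ^ 2 ∂P := fun t =>
      integral_nonneg fun _ => sq_nonneg _
    have he0 : ∀ t, 0 ≤ ∫ ω, ‖gradient (hyper f g) (X t ω)‖ ^ 2 ∂P := fun t =>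
      integral_nonneg fun _ => sq_nonneg _
    rw [ENNReal.ofReal_sum_of_nonneg fun t _ => add_nonneg (mul_nonneg hi0.le (hd0 t))
      (mul_nonneg (half_pos hη).le (he0 t))]
    refine Finset.sum_congr rfl fun t _ => ?_
    rw [ENNReal.ofReal_add (mul_nonneg hi0.le (hd0 t)) (mul_nonneg (half_pos hη).le (he0 t)),
      ENNReal.ofReal_mul hi0.le, ENNReal.ofReal_mul (half_pos hη).le,
      ofReal_integral_eq_lintegral_ofReal (hd_int t) (Filter.Eventually.of_forall fun _ =>
        sq_nonneg _),
      ofReal_integral_eq_lintegral_ofReal (he_int t) (Filter.Eventually.of_forall fun _ =>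
        sq_nonneg _)]
  exact (ENNReal.ofReal_le_ofReal_iff (by positivity)).1 h1

end Descent

/-- Splits the summed descent inequality once the initial gap is comparable to `n η ε²`. -/
theorem sums_le_of_descent {η D N ε gap₀ n : ℝ} (hη : 0 < η) (hD : 0 ≤ D) (hN : 0 ≤ N)
    (hgap : gap₀ ≤ n * (η * (ε ^ 2 / 4)))
    (h : (4 * η)⁻¹ * D + η / 2 * N ≤ gap₀ + n * (η / 2 * (ε ^ 2 / 2))) :
    N ≤ n * ε ^ 2 ∧ D ≤ n * (2 * η ^ 2 * ε ^ 2) := by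
  constructor
  · have h1 : 0 ≤ (4 * η)⁻¹ * D := by positivity
    have h2 : η / 2 * N ≤ η / 2 * (n * ε ^ 2) := by linarith
    exact le_of_mul_le_mul_left h2 (by positivity)
  · have h1 : 0 ≤ η / 2 * N := by positivity
    have h2 : (4 * η)⁻¹ * D ≤ n * (η / 2 * ε ^ 2) := by linarith
    rw [inv_mul_le_iff₀ (by positivity)] at h2
    exact h2.trans_eq (by ring)

/-! ### Counting oracle calls -/

section Calls

variable {Ω : Type*} [mΩ : MeasurableSpace Ω] {P : Measure Ω} [IsProbabilityMeasure P]
  {Ξf Ξg : Type*} [MeasurableSpace Ξf] [MeasurableSpace Ξg]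
  {νf : Measure Ξf} {νg : Measure Ξg} {dx dy : ℕ} {c : Consts} {f g : Joint dx dy → ℝ} {p : Params}
  {F : Joint dx dy → Ξf → Joint dx dy} {G : Joint dx dy → Ξg → Joint dx dy}
  {S : Slot → Ω → Ξf × Ξg × Ξg} [Nontrivial (Vec dy)]

theorem innerLoop_calls (s : Slot → Ξf × Ξg × Ξg) (t : ℕ) (x : Vec dx) (u : InnerState dy) (n : ℕ) :
    (innerLoop p F G s t x u n).calls = u.calls + n * (3 * p.Bin) := by
  induction n with
  | zero => simp [innerLoop]
  | succ n ih => simp only [innerLoop, innerStep, ih]; ring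

theorem run_calls (s : Slot → Ξf × Ξg × Ξg) (x₀ : Vec dx) (y₀ : Vec dy) (n : ℕ) :
    (run p F G s x₀ y₀ n).calls = ∑ t ∈ Finset.range n,
      (p.innerSteps (run p F G s x₀ y₀ t).δ * (3 * p.Bin) + 3 * p.Bout) := by
  induction n with
  | zero => rfl
  | succ n ih =>
    rw [Finset.sum_range_succ, ← ih]
    simp only [run, outerStep, innerLoop_calls]
    ring

/-- The recursion for `δ_t`, summed. -/
theorem sum_run_δ (s : Slot → Ξf × Ξg × Ξg) (x₀ : Vec dx) (y₀ : Vec dy) (n : ℕ) :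
    ∑ t ∈ Finset.range n, (run p F G s x₀ y₀ t).δ + 2 * (run p F G s x₀ y₀ n).δ
      = 2 * p.δ₀ + 2 * ∑ t ∈ Finset.range n, (p.drift * ‖(run p F G s x₀ y₀ (t + 1)).x
          - (run p F G s x₀ y₀ t).x‖ ^ 2 + p.floor) := by
  induction n with
  | zero => simp [run]
  | succ n ih =>
    rw [Finset.sum_range_succ, Finset.sum_range_succ, mul_add, ← add_assoc, ← ih]
    have h : (run p F G s x₀ y₀ (n + 1)).δ = (run p F G s x₀ y₀ n).δ / 2
      + p.drift * ‖(run p F G s x₀ y₀ (n + 1)).x - (run p F G s x₀ y₀ n).x‖ ^ 2 + p.floor := rfl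
    rw [h]
    ring

theorem integrable_run_δ {x₀ : Vec dx} {y₀ : Vec dy}
    (hd : ∀ t, Integrable (fun ω => ‖(run p F G (fun s => S s ω) x₀ y₀ (t + 1)).x
        - (run p F G (fun s => S s ω) x₀ y₀ t).x‖ ^ 2) P) (t : ℕ) :
    Integrable (fun ω => (run p F G (fun s => S s ω) x₀ y₀ t).δ) P := by
  induction t with
  | zero => exact integrable_const p.δ₀
  | succ t ih =>
    exact ((ih.div_const 2).add ((hd t).const_mul p.drift)).add (integrable_const p.floor)

/-- The expected number of oracle calls when `K_t ≤ a + b log (1 + δ_t / c₀)`. The logarithm is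
bounded by its tangent at `M`, which makes the average of `δ_t` over the run the only quantity
that matters. -/
theorem integral_calls_le (hF : IsStochasticGradient νf f F c.σf)
    (hG : IsStochasticGradient νg g G c.σg) (hS : IsSampling νf νg P S) {c₀ : ℝ}
    (hp : p.Accurate c c₀) {x₀ : Vec dx} {y₀ : Vec dy}
    (hd : ∀ t, Integrable (fun ω => ‖(run p F G (fun s => S s ω) x₀ y₀ (t + 1)).x
        - (run p F G (fun s => S s ω) x₀ y₀ t).x‖ ^ 2) P)
    {a b : ℝ} (hb : 0 ≤ b)
    (hK : ∀ δ, 0 ≤ δ → (p.innerSteps δ : ℝ) ≤ a + b * Real.log (1 + δ / c₀)) (n : ℕ) :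
    Integrable (fun ω => ((run p F G (fun s => S s ω) x₀ y₀ n).calls : ℝ)) P ∧
    ∀ M : ℝ, 0 < M →
      n + (2 * p.δ₀ + 2 * (p.drift * (∑ t ∈ Finset.range n,
        ∫ ω, ‖(run p F G (fun s => S s ω) x₀ y₀ (t + 1)).x
          - (run p F G (fun s => S s ω) x₀ y₀ t).x‖ ^ 2 ∂P) + n * p.floor)) / c₀ ≤ n * M →
      ∫ ω, ((run p F G (fun s => S s ω) x₀ y₀ n).calls : ℝ) ∂P
        ≤ n * (3 * p.Bin * (a + b * Real.log M) + 3 * p.Bout) := by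
  have hc := hp.c₀_pos
  set st : ℕ → Ω → State dx dy := fun t ω => run p F G (fun s => S s ω) x₀ y₀ t with hst
  have hd' : ∀ t, Integrable (fun ω => ‖(st (t + 1) ω).x - (st t ω).x‖ ^ 2) P := hd
  have hδ : ∀ t ω, 0 ≤ (st t ω).δ := fun t ω => run_δ_nonneg hp _ _ _ _
  have hδi : ∀ t, Integrable (fun ω => (st t ω).δ) P := integrable_run_δ hd
  have hKm : ∀ t, Measurable fun ω => (p.innerSteps (st t ω).δ : ℝ) := fun t =>
    measurable_from_top.comp (hp.innerSteps_measurable.comp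
      ((measurable_run_past (S := S) hF hG hp.toAdmissible x₀ y₀ t).mono
        (pastAlg_le hS.measurable _)).δ)
  -- the tangent bound
  have htan : ∀ M : ℝ, 0 < M → ∀ t ω, (p.innerSteps (st t ω).δ : ℝ)
      ≤ a + b * (Real.log M + ((1 + (st t ω).δ / c₀) / M - 1)) := by
    intro M hM t ω
    refine (hK _ (hδ t ω)).trans ?_
    have h1 : 0 < 1 + (st t ω).δ / c₀ := by have := hδ t ω; positivity
    have h2 := Real.log_le_sub_one_of_pos (div_pos h1 hM)
    rw [Real.log_div h1.ne' hM.ne'] at h2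
    have h3 : Real.log (1 + (st t ω).δ / c₀) ≤ Real.log M + ((1 + (st t ω).δ / c₀) / M - 1) := by
      linarith
    have := mul_le_mul_of_nonneg_left h3 hb
    linarith
  have hbi : ∀ M : ℝ, ∀ t, Integrable (fun ω =>
      a + b * (Real.log M + ((1 + (st t ω).δ / c₀) / M - 1))) P := fun M t =>
    (integrable_const a).add (((integrable_const _).add
      ((((integrable_const 1).add ((hδi t).div_const c₀)).div_const M).sub
        (integrable_const 1))).const_mul b)
  have hKi : ∀ t, Integrable (fun ω => (p.innerSteps (st t ω).δ : ℝ)) P := fun t =>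
    (hbi 1 t).mono' (hKm t).aestronglyMeasurable (Filter.Eventually.of_forall fun ω => by
      rw [Real.norm_of_nonneg (Nat.cast_nonneg _)]
      exact htan 1 one_pos t ω)
  have hcalls : ∀ ω, ((st n ω).calls : ℝ) = ∑ t ∈ Finset.range n,
      ((p.innerSteps (st t ω).δ : ℝ) * (3 * p.Bin) + 3 * p.Bout) := fun ω => by
    rw [hst]; dsimp only; rw [run_calls]; push_cast; rfl
  have hterm : ∀ t, Integrable (fun ω =>
      (p.innerSteps (st t ω).δ : ℝ) * (3 * p.Bin) + 3 * p.Bout) P := fun t =>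
    ((hKi t).mul_const _).add (integrable_const _)
  change Integrable (fun ω => ((st n ω).calls : ℝ)) P ∧ _
  refine ⟨?_, fun M hM hMn => ?_⟩
  · simp_rw [hcalls]
    exact integrable_finsetSum _ fun t _ => hterm t
  change ∫ ω, ((st n ω).calls : ℝ) ∂P ≤ _
  simp_rw [hcalls]
  rw [integral_finsetSum _ fun t _ => hterm t]
  have hKe : ∀ t, ∫ ω, (p.innerSteps (st t ω).δ : ℝ) ∂P
      ≤ a + b * (Real.log M + ((1 + (∫ ω, (st t ω).δ ∂P) / c₀) / M - 1)) := fun t => by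
    refine (integral_mono (hKi t) (hbi M t) (htan M hM t)).trans_eq ?_
    have h1 : Integrable (fun ω => (st t ω).δ / c₀) P := (hδi t).div_const c₀
    have h2 : Integrable (fun ω => 1 + (st t ω).δ / c₀) P := (integrable_const 1).add h1
    have h3 : Integrable (fun ω => (1 + (st t ω).δ / c₀) / M) P := h2.div_const M
    have h4 : Integrable (fun ω => (1 + (st t ω).δ / c₀) / M - 1) P := h3.sub (integrable_const 1)
    have h5 : Integrable (fun ω => Real.log M + ((1 + (st t ω).δ / c₀) / M - 1)) P :=
      (integrable_const _).add h4
    rw [integral_add (integrable_const a) (h5.const_mul b), integral_const_mul,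
      integral_add (integrable_const _) h4, integral_sub h3 (integrable_const 1),
      integral_div, integral_add (integrable_const 1) h1, integral_div]
    simp
  have hδsum : ∑ t ∈ Finset.range n, ∫ ω, (st t ω).δ ∂P ≤ 2 * p.δ₀ + 2 * (p.drift *
      (∑ t ∈ Finset.range n, ∫ ω, ‖(st (t + 1) ω).x - (st t ω).x‖ ^ 2 ∂P) + n * p.floor) := by
    have h1 : ∀ ω, ∑ t ∈ Finset.range n, (st t ω).δ ≤ 2 * p.δ₀ + 2 * ∑ t ∈ Finset.range n,
        (p.drift * ‖(st (t + 1) ω).x - (st t ω).x‖ ^ 2 + p.floor) := fun ω => by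
      have h2 := sum_run_δ (p := p) (F := F) (G := G) (fun s => S s ω) x₀ y₀ n
      have h3 := hδ n ω
      change ∑ t ∈ Finset.range n, (st t ω).δ + 2 * (st n ω).δ = 2 * p.δ₀ +
        2 * ∑ t ∈ Finset.range n, (p.drift * ‖(st (t + 1) ω).x - (st t ω).x‖ ^ 2 + p.floor) at h2
      linarith
    have h4 : ∀ t, Integrable (fun ω => p.drift * ‖(st (t + 1) ω).x - (st t ω).x‖ ^ 2 + p.floor) P :=
      fun t => ((hd t).const_mul _).add (integrable_const _)
    have h5 : Integrable (fun ω => ∑ t ∈ Finset.range n,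
        (p.drift * ‖(st (t + 1) ω).x - (st t ω).x‖ ^ 2 + p.floor)) P :=
      integrable_finsetSum _ fun t _ => h4 t
    have h7 : Integrable (fun ω => 2 * p.δ₀ + 2 * ∑ t ∈ Finset.range n,
        (p.drift * ‖(st (t + 1) ω).x - (st t ω).x‖ ^ 2 + p.floor)) P :=
      (integrable_const (2 * p.δ₀)).add (h5.const_mul 2)
    rw [← integral_finsetSum _ fun t _ => hδi t]
    refine (integral_mono (integrable_finsetSum _ fun t _ => hδi t) h7 h1).trans_eq ?_
    have h6 : ∀ t, ∫ ω, (p.drift * ‖(st (t + 1) ω).x - (st t ω).x‖ ^ 2 + p.floor) ∂P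
        = p.drift * ∫ ω, ‖(st (t + 1) ω).x - (st t ω).x‖ ^ 2 ∂P + p.floor := fun t => by
      rw [integral_add ((hd' t).const_mul _) (integrable_const _), integral_const_mul]
      simp
    rw [integral_add (integrable_const _) (h5.const_mul 2), integral_const, probReal_univ, one_smul,
      integral_const_mul, integral_finsetSum _ fun t _ => h4 t]
    simp_rw [h6]
    rw [Finset.sum_add_distrib, ← Finset.mul_sum]
    simp
  have hKsum : ∑ t ∈ Finset.range n, ∫ ω, (p.innerSteps (st t ω).δ : ℝ) ∂P
      ≤ n * (a + b * Real.log M) := by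
    have h1 : ∑ t ∈ Finset.range n, (1 + (∫ ω, (st t ω).δ ∂P) / c₀) ≤ n * M := by
      rw [Finset.sum_add_distrib, ← Finset.sum_div]
      simp only [Finset.sum_const, Finset.card_range, nsmul_eq_mul, mul_one]
      refine le_trans ?_ hMn
      gcongr
    calc _ ≤ ∑ t ∈ Finset.range n,
          (a + b * (Real.log M + ((1 + (∫ ω, (st t ω).δ ∂P) / c₀) / M - 1))) :=
        Finset.sum_le_sum fun t _ => hKe t
      _ = n * (a + b * Real.log M)
          + b * ((∑ t ∈ Finset.range n, (1 + (∫ ω, (st t ω).δ ∂P) / c₀)) / M - n) := by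
        rw [Finset.sum_add_distrib, ← Finset.mul_sum, Finset.sum_add_distrib,
          Finset.sum_sub_distrib, ← Finset.sum_div]
        simp only [Finset.sum_const, Finset.card_range, nsmul_eq_mul, mul_one]
        ring
      _ ≤ n * (a + b * Real.log M) := by
        have h2 : (∑ t ∈ Finset.range n, (1 + (∫ ω, (st t ω).δ ∂P) / c₀)) / M - n ≤ 0 := by
          rw [sub_nonpos, div_le_iff₀ hM]; exact h1
        nlinarith [mul_nonneg hb (neg_nonneg.2 h2)]
  have hterm_eq : ∀ t, ∫ ω, ((p.innerSteps (st t ω).δ : ℝ) * (3 * p.Bin) + 3 * p.Bout) ∂P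
      = (∫ ω, (p.innerSteps (st t ω).δ : ℝ) ∂P) * (3 * p.Bin) + 3 * p.Bout := fun t => by
    rw [integral_add ((hKi t).mul_const _) (integrable_const _), integral_mul_const]
    simp
  simp_rw [hterm_eq]
  rw [Finset.sum_add_distrib, ← Finset.sum_mul]
  simp only [Finset.sum_const, Finset.card_range, nsmul_eq_mul]
  have h3 := mul_le_mul_of_nonneg_right hKsum (by positivity : (0 : ℝ) ≤ 3 * p.Bin)
  linarith

end Calls

/-! ### The parameter setting -/

section Setting

/-- The numerical factors of the parameter setting. -/
def factors : Factors where
  η := 1 / 12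
  lam := 32
  T := 48
  out := 96
  inn := 3
  K := 32
  δ := 4
  η_pos := by norm_num
  lam_pos := by norm_num
  T_pos := by norm_num
  out_pos := by norm_num
  inn_pos := by norm_num
  K_pos := by norm_num
  δ_pos := by norm_num

/-- The squared Lipschitz constant `L_f² + λ² L_g²` that turns inner errors into errors of the
surrogate gradient. -/
def penaltyLipSq (c : Consts) (lam : ℝ) : ℝ := c.Lf ^ 2 + lam ^ 2 * c.Lg ^ 2

variable {dx dy : ℕ} {c : Consts} {f g : Joint dx dy → ℝ} {Δ R ε : ℝ}

theorem Regular.one_le_kappa [Nontrivial (Vec dy)] (hr : Regular c f g) : 1 ≤ c.kappa :=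
  Consts.one_le_kappa hr.μ_pos hr.μ_le_Lg

theorem Regular.ell_pos [Nontrivial (Vec dy)] (hr : Regular c f g) : 0 < c.ell :=
  Consts.ell_pos hr.μ_pos hr.μ_le_Lg

theorem kappa_le_penalty_mul_R (hR : 0 < R) :
    32 * c.kappa ≤ penalty factors c Δ R ε * R := by
  have h : c.kappa / R ≤ max (c.kappa / R)
      (max (c.ell * c.kappa ^ 2 / Δ) (c.ell * c.kappa ^ 3 / ε)) := le_max_left _ _
  rw [div_le_iff₀ hR] at h
  simp only [penalty, factors]
  linarith

theorem ell_kappa_le_penalty_mul_ε (hε : 0 < ε) :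
    32 * (c.ell * c.kappa ^ 3) ≤ penalty factors c Δ R ε * ε := by
  have h : c.ell * c.kappa ^ 3 / ε ≤ max (c.kappa / R)
      (max (c.ell * c.kappa ^ 2 / Δ) (c.ell * c.kappa ^ 3 / ε)) :=
    (le_max_right _ _).trans (le_max_right _ _)
  rw [div_le_iff₀ hε] at h
  simp only [penalty, factors]
  linarith

theorem kappa_le_penalty (hκ : 0 ≤ c.kappa) (hε : 0 < ε) (hεL : ε ≤ c.ell * c.kappa ^ 2) :
    32 * c.kappa ≤ penalty factors c Δ R ε := by
  have h := ell_kappa_le_penalty_mul_ε (c := c) (Δ := Δ) (R := R) hε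
  refine le_of_mul_le_mul_right ?_ hε
  nlinarith [mul_le_mul_of_nonneg_left hεL hκ]

theorem one_le_batchOut : 1 ≤ batchOut factors c Δ R ε := le_max_left _ _

theorem noise_le_batchOut (hε : 0 < ε) :
    96 * (c.σf ^ 2 + penalty factors c Δ R ε ^ 2 * c.σg ^ 2)
      ≤ ε ^ 2 * batchOut factors c Δ R ε := by
  have h : factors.out * ((c.σf ^ 2 + penalty factors c Δ R ε ^ 2 * c.σg ^ 2) / ε ^ 2)
      ≤ (batchOut factors c Δ R ε : ℝ) :=
    (Nat.le_ceil _).trans (Nat.cast_le.2 (le_max_right _ _))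
  simp only [factors] at h
  rw [← mul_div_assoc, div_le_iff₀ (by positivity)] at h
  simp only [factors]
  linarith

theorem batchOut_le_batchIn (hμ : 0 < c.μ) (hlam : 0 < penalty factors c Δ R ε) :
    3 * penaltyLipSq c (penalty factors c Δ R ε) * batchOut factors c Δ R ε
      ≤ penalty factors c Δ R ε ^ 2 * c.μ ^ 2 * batchIn factors c Δ R ε := by
  have h := Nat.le_ceil (factors.inn * ((c.Lf ^ 2 + penalty factors c Δ R ε ^ 2 * c.Lg ^ 2)
    / (penalty factors c Δ R ε ^ 2 * c.μ ^ 2) * batchOut factors c Δ R ε))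
  change _ ≤ (batchIn factors c Δ R ε : ℝ) at h
  have h1 : factors.inn = 3 := rfl
  rw [h1, div_mul_eq_mul_div, ← mul_div_assoc, div_le_iff₀ (by positivity)] at h
  unfold penaltyLipSq
  linarith

/-- The geometric rate of the inner loop, run for `K_t` steps, beats the factor by which the
estimate `δ_t` exceeds the target accuracy. -/
theorem rate_pow_innerSteps_le {κg κ A : ℝ} (hκg : 1 ≤ κg) (hκ : 1 ≤ κ) (hA : 1 ≤ A) {K : ℕ}
    (hK : 32 * (κg * Real.log (2 * κ * A)) ≤ K) :
    (1 - 1 / (4 * κg)) ^ K * A ≤ 1 / 256 := by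
  have hκg0 : 0 < κg := by linarith
  have hB : 2 ≤ 2 * κ * A := by nlinarith
  have hB0 : 0 < 2 * κ * A := by linarith
  have h1 : (0 : ℝ) ≤ 1 - 1 / (4 * κg) := by
    rw [sub_nonneg, div_le_one (by positivity)]; linarith
  have h2 : 1 - 1 / (4 * κg) ≤ Real.exp (-(1 / (4 * κg))) := by
    have := Real.add_one_le_exp (-(1 / (4 * κg))); linarith
  have h3 : (1 - 1 / (4 * κg)) ^ K ≤ Real.exp (K * -(1 / (4 * κg))) := by
    rw [Real.exp_nat_mul]; exact pow_le_pow_left₀ h1 h2 K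
  -- The factor `32` in `K` makes the rate at least the eighth power of `1 / (2 κ A)`.
  have h4 : K * -(1 / (4 * κg)) ≤ -(8 * Real.log (2 * κ * A)) := by
    have : 8 * Real.log (2 * κ * A) ≤ K * (1 / (4 * κg)) := by
      rw [mul_one_div, le_div_iff₀ (by positivity)]; linarith
    linarith
  have h5 : Real.exp (-(8 * Real.log (2 * κ * A))) = ((2 * κ * A) ^ 8)⁻¹ := by
    rw [Real.exp_neg, mul_comm, Real.exp_mul, Real.exp_log hB0]
    norm_cast
  have h6 : (1 - 1 / (4 * κg)) ^ K ≤ ((2 * κ * A) ^ 8)⁻¹ :=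
    h3.trans ((Real.exp_le_exp.2 h4).trans_eq h5)
  have h7 : 256 * A ≤ (2 * κ * A) ^ 8 := by
    have e : (2 * κ * A) ^ 8 = 256 * A * (κ ^ 8 * A ^ 7) := by ring
    rw [e]
    exact le_mul_of_one_le_right (by linarith)
      (one_le_mul_of_one_le_of_one_le (one_le_pow₀ hκ) (one_le_pow₀ hA))
  calc _ ≤ ((2 * κ * A) ^ 8)⁻¹ * A := by gcongr
    _ ≤ 1 / 256 := by
      rw [inv_mul_le_iff₀ (by positivity)]; linarith

variable [Nontrivial (Vec dy)]

theorem penalty_pos (hr : Regular c f g) (hε : 0 < ε) (hεL : ε ≤ c.ell * c.kappa ^ 2) :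
    0 < penalty factors c Δ R ε := by
  have h1 := hr.one_le_kappa
  have h2 := kappa_le_penalty (Δ := Δ) (R := R) (by linarith) hε hεL
  linarith

theorem penaltyLipSq_pos (hr : Regular c f g) {lam : ℝ} (hlam : 0 < lam) :
    0 < penaltyLipSq c lam := by
  have := hr.Lg_pos
  unfold penaltyLipSq; positivity

theorem setting_admissible (hr : Regular c f g) (hε : 0 < ε) (hεL : ε ≤ c.ell * c.kappa ^ 2) :
    (setting factors c Δ R ε).Admissible c where
  lam_pos := penalty_pos hr hε hεL
  lam_large := by
    have h1 := kappa_le_penalty (Δ := Δ) (R := R) (by linarith [hr.one_le_kappa]) hε hεL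
    have h2 := Consts.kappa_mul_μ hr.μ_pos
    have h3 := c.Lf_le_ell
    have h4 := mul_le_mul_of_nonneg_right h1 hr.μ_pos.le
    have h5 := hr.ell_pos
    change 2 * c.Lf ≤ penalty factors c Δ R ε * c.μ
    nlinarith
  ηy_eq := rfl
  ηz_eq := rfl
  Bin_pos := by
    have hlam := penalty_pos (Δ := Δ) (R := R) hr hε hεL
    have h := batchOut_le_batchIn hr.μ_pos hlam
    have h1 := penaltyLipSq_pos hr hlam
    have h2 : (1 : ℝ) ≤ batchOut factors c Δ R ε := by exact_mod_cast one_le_batchOut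
    have h3 : 0 < penalty factors c Δ R ε ^ 2 * c.μ ^ 2 * batchIn factors c Δ R ε :=
      lt_of_lt_of_le (by positivity) h
    change 0 < batchIn factors c Δ R ε
    rcases Nat.eq_zero_or_pos (batchIn factors c Δ R ε) with h0 | h0
    · simp [h0] at h3
    · exact h0
  Bout_pos := one_le_batchOut
  innerSteps_measurable := by
    refine Nat.measurable_ceil.comp ?_
    fun_prop

/-- The target `ε² / (L_f² + λ² L_g²)` for the squared inner error, which changes the surrogate gradient
by about `ε`. -/
def targetErr (c : Consts) (lam ε : ℝ) : ℝ := ε ^ 2 / penaltyLipSq c lam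

theorem innerFloor_setting_le (hr : Regular c f g) (hε : 0 < ε)
    (hεL : ε ≤ c.ell * c.kappa ^ 2) :
    innerFloor c (setting factors c Δ R ε)
      ≤ targetErr c (penalty factors c Δ R ε) ε / 96 := by
  have hlam := penalty_pos (Δ := Δ) (R := R) hr hε hεL
  have hBin := (setting_admissible (Δ := Δ) (R := R) hr hε hεL).Bin_pos
  have hμ := hr.μ_pos
  have hLg := hr.Lg_pos
  have hμL := hr.μ_le_Lg
  have hL := penaltyLipSq_pos hr hlam
  have h1 := noise_le_batchOut (c := c) (Δ := Δ) (R := R) hε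
  have h2 := batchOut_le_batchIn (Δ := Δ) (R := R) (ε := ε) hμ hlam
  have hBin' : (0 : ℝ) < batchIn factors c Δ R ε := Nat.cast_pos.2 hBin
  unfold targetErr innerFloor innerNoise
  change 3 * (c.σf ^ 2 / penalty factors c Δ R ε ^ 2 + c.σg ^ 2)
    / (4 * c.Lg ^ 2 * batchIn factors c Δ R ε) / (c.μ / (4 * c.Lg)) ≤ _
  generalize penalty factors c Δ R ε = lam at *
  generalize penaltyLipSq c lam = L at *
  generalize (batchOut factors c Δ R ε : ℝ) = Bo at *
  generalize (batchIn factors c Δ R ε : ℝ) = Bi at *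
  have e : 3 * (c.σf ^ 2 / lam ^ 2 + c.σg ^ 2) / (4 * c.Lg ^ 2 * Bi) / (c.μ / (4 * c.Lg))
      = 3 * (c.σf ^ 2 + lam ^ 2 * c.σg ^ 2) / (lam ^ 2 * c.Lg * c.μ * Bi) := by
    field_simp
  rw [e, div_div, div_le_div_iff₀ (by positivity) (by positivity)]
  have h3 := mul_le_mul_of_nonneg_left h1 (by positivity : 0 ≤ 3 * L)
  have h4 := mul_le_mul_of_nonneg_left h2 (by positivity : 0 ≤ ε ^ 2)
  have h5 : ε ^ 2 * (lam ^ 2 * c.μ ^ 2 * Bi) ≤ ε ^ 2 * (lam ^ 2 * c.Lg * c.μ * Bi) := by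
    have : c.μ ^ 2 ≤ c.Lg * c.μ := by nlinarith
    rw [mul_assoc (lam ^ 2) c.Lg c.μ]
    gcongr
  linarith

theorem setting_accurate (hr : Regular c f g) (hR : 0 ≤ R) (hε : 0 < ε)
    (hεL : ε ≤ c.ell * c.kappa ^ 2) :
    (setting factors c Δ R ε).Accurate c (targetErr c (penalty factors c Δ R ε) ε) where
  toAdmissible := setting_admissible hr hε hεL
  c₀_pos := div_pos (by positivity) (penaltyLipSq_pos hr (penalty_pos hr hε hεL))
  rate_le := fun δ hδ => by
    have hL := penaltyLipSq_pos hr (penalty_pos (Δ := Δ) (R := R) hr hε hεL)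
    have hμ := hr.μ_pos
    have hA : 1 + δ / targetErr c (penalty factors c Δ R ε) ε
        = 1 + (c.Lf ^ 2 + penalty factors c Δ R ε ^ 2 * c.Lg ^ 2) * δ / ε ^ 2 := by
      unfold targetErr
      rw [penaltyLipSq] at hL ⊢
      field_simp
    have hA1 : 1 ≤ 1 + (c.Lf ^ 2 + penalty factors c Δ R ε ^ 2 * c.Lg ^ 2) * δ / ε ^ 2 :=
      le_add_of_nonneg_right (by positivity)
    have hrate : innerRate c = 1 - 1 / (4 * (c.Lg / c.μ)) := by
      have := hr.Lg_pos
      unfold innerRate; field_simp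
    rw [hA, hrate]
    exact rate_pow_innerSteps_le ((one_le_div hμ).2 hr.μ_le_Lg) hr.one_le_kappa hA1
      (Nat.le_ceil _)
  floor_le := innerFloor_setting_le hr hε hεL
  drift_eq := rfl
  δ₀_nonneg := mul_nonneg factors.δ_pos.le hR
  noise_nonneg := by
    have := hr.Lg_pos
    change 0 ≤ c.σg ^ 2 / (2 * c.Lg * batchIn factors c Δ R ε)
    positivity

theorem initial_innerErr_le (hr : Regular c f g) (hε : 0 < ε) (hεL : ε ≤ c.ell * c.kappa ^ 2)
    {x₀ : Vec dx} {y₀ : Vec dy} (hRe : R = ‖y₀ - yStar g x₀‖ ^ 2) (hR : 0 < R) :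
    innerErr (setting factors c Δ R ε).lam f g x₀ ⟨y₀, y₀, 0⟩ ≤ (setting factors c Δ R ε).δ₀ := by
  change ‖y₀ - yPen (penalty factors c Δ R ε) f g x₀‖ ^ 2 + ‖y₀ - yStar g x₀‖ ^ 2 ≤ 4 * R
  have hlam := penalty_pos (Δ := Δ) (R := R) hr hε hεL
  have hadm := setting_admissible (Δ := Δ) (R := R) hr hε hεL
  have h1 := hr.norm_yPen_sub_yStar_le hlam hadm.lam_large x₀
  change _ ≤ c.kappa / penalty factors c Δ R ε at h1
  have hκ := hr.one_le_kappa
  have h2 : c.kappa / penalty factors c Δ R ε ≤ R / 32 := by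
    rw [div_le_div_iff₀ hlam (by norm_num)]
    linarith [kappa_le_penalty_mul_R (c := c) (Δ := Δ) (ε := ε) hR]
  have h3 : c.kappa / penalty factors c Δ R ε ≤ 1 / 32 := by
    rw [div_le_div_iff₀ hlam (by norm_num)]
    linarith [kappa_le_penalty (c := c) (Δ := Δ) (R := R) (by linarith) hε hεL]
  -- Together `q² ≤ (R / 32) (1 / 32)`, which is linear in `R` whatever the size of `R`.
  set q := ‖yPen (penalty factors c Δ R ε) f g x₀ - yStar g x₀‖ with hq
  have hq0 : 0 ≤ q := norm_nonneg _
  have h4 : q ^ 2 ≤ R / 1024 := by nlinarith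
  have h5 : ‖y₀ - yPen (penalty factors c Δ R ε) f g x₀‖ ≤ ‖y₀ - yStar g x₀‖ + q := by
    rw [hq, norm_sub_rev (yPen _ f g x₀)]
    exact norm_sub_le_norm_sub_add_norm_sub _ _ _
  set r := ‖y₀ - yStar g x₀‖
  have h6 : ‖y₀ - yPen (penalty factors c Δ R ε) f g x₀‖ ^ 2 ≤ (r + q) ^ 2 :=
    pow_le_pow_left₀ (norm_nonneg _) h5 2
  nlinarith [sq_nonneg (r - q)]

theorem gradient_error_setting_le (hr : Regular c f g) (hε : 0 < ε)
    (hεL : ε ≤ c.ell * c.kappa ^ 2) :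
    6 * (c.Lf ^ 2 + (setting factors c Δ R ε).lam ^ 2 * c.Lg ^ 2)
        * (targetErr c (penalty factors c Δ R ε) ε / 48)
      + 3 * (4 * (c.ell * c.kappa ^ 3) / (setting factors c Δ R ε).lam) ^ 2
      + outerNoise c (setting factors c Δ R ε) ≤ ε ^ 2 / 2 := by
  have hlam := penalty_pos (Δ := Δ) (R := R) hr hε hεL
  have hL := penaltyLipSq_pos hr hlam
  have h1 : 6 * (c.Lf ^ 2 + penalty factors c Δ R ε ^ 2 * c.Lg ^ 2)
      * (targetErr c (penalty factors c Δ R ε) ε / 48) = ε ^ 2 / 8 := by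
    rw [targetErr]
    change 6 * penaltyLipSq c _ * _ = _
    field_simp
    norm_num
  have h2 : 4 * (c.ell * c.kappa ^ 3) / penalty factors c Δ R ε ≤ ε / 8 := by
    rw [div_le_div_iff₀ hlam (by norm_num)]
    linarith [ell_kappa_le_penalty_mul_ε (c := c) (Δ := Δ) (R := R) hε]
  have h3 : 0 ≤ 4 * (c.ell * c.kappa ^ 3) / penalty factors c Δ R ε := by
    have := hr.ell_pos
    have := hr.one_le_kappa
    positivity
  have h4 : (4 * (c.ell * c.kappa ^ 3) / penalty factors c Δ R ε) ^ 2 ≤ (ε / 8) ^ 2 :=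
    pow_le_pow_left₀ h3 h2 2
  have h5 : outerNoise c (setting factors c Δ R ε) ≤ ε ^ 2 / 12 := by
    have hB : (0 : ℝ) < batchOut factors c Δ R ε := by
      exact_mod_cast (one_le_batchOut (c := c) (Δ := Δ) (R := R) (ε := ε))
    have h6 := noise_le_batchOut (c := c) (Δ := Δ) (R := R) hε
    change (2 * c.σf ^ 2 + 8 * penalty factors c Δ R ε ^ 2 * c.σg ^ 2)
      / batchOut factors c Δ R ε ≤ _
    rw [div_le_iff₀ hB]
    linarith [sq_nonneg c.σf]
  change 6 * (c.Lf ^ 2 + penalty factors c Δ R ε ^ 2 * c.Lg ^ 2) * _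
    + 3 * (4 * (c.ell * c.kappa ^ 3) / penalty factors c Δ R ε) ^ 2 + _ ≤ _
  rw [h1]
  nlinarith [sq_nonneg ε]

end Setting

/-! ### The uniformly chosen iterate -/

/-- Averaging over an index that is uniform in `{0, …, n-1}` and independent of the rest. -/
theorem integral_prod_uniformOn {Ω : Type*} [MeasurableSpace Ω] {P : Measure Ω}
    [IsProbabilityMeasure P] {v : ℕ → Ω → ℝ} (hm : ∀ t, Measurable (v t))
    (hi : ∀ t, Integrable (v t) P) {n : ℕ} (hn : 0 < n) :
    Integrable (fun w : Ω × ℕ => v w.2 w.1) (P.prod (uniformOn (Set.Iio n))) ∧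
    ∫ w, v w.2 w.1 ∂(P.prod (uniformOn (Set.Iio n)))
      = (n : ℝ)⁻¹ * ∑ t ∈ Finset.range n, ∫ ω, v t ω ∂P := by
  have hset : Set.Iio n = (↑(Finset.range n) : Set ℕ) := by ext; simp
  have hne : (Set.Iio n).Nonempty := ⟨0, hn⟩
  have : IsProbabilityMeasure (uniformOn (Set.Iio n)) :=
    isProbabilityMeasure_uniformOn (Set.finite_Iio n) hne
  have hcount : ∀ h : ℕ → ℝ, IntegrableOn h (↑(Finset.range n) : Set ℕ) Measure.count := fun h => by
    rw [← Set.biUnion_of_singleton (↑(Finset.range n) : Set ℕ)]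
    exact integrableOn_finset_iUnion.2 fun t _ => 
      integrableOn_singleton (by finiteness) (by simp)
  have hvint : ∀ h : ℕ → ℝ, Integrable h (uniformOn (Set.Iio n)) := fun h => by
    rw [uniformOn, ProbabilityTheory.cond, hset]
    refine Integrable.smul_measure ?_ (by simp [hn.ne'])
    exact hcount h
  have hmeas : Measurable fun w : Ω × ℕ => v w.2 w.1 :=
    measurable_from_prod_countable_left hm
  have hI : Integrable (fun w : Ω × ℕ => v w.2 w.1) (P.prod (uniformOn (Set.Iio n))) :=
    (integrable_prod_iff' hmeas.aestronglyMeasurable).2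
      ⟨Filter.Eventually.of_forall hi, hvint _⟩
  refine ⟨hI, ?_⟩
  rw [integral_prod_symm _ hI, uniformOn, ProbabilityTheory.cond, hset, integral_smul_measure,
    setIntegral_finset _ (hcount _), Measure.count_apply_finset]
  simp

/-- A bound on the mean square bounds the mean of a uniformly chosen term. -/
theorem integral_prod_uniformOn_le {Ω : Type*} [MeasurableSpace Ω] {P : Measure Ω}
    [IsProbabilityMeasure P] {v : ℕ → Ω → ℝ} (hm : ∀ t, Measurable (v t))
    (hi : ∀ t, Integrable (fun ω => v t ω ^ 2) P) {n : ℕ} (hn : 0 < n) {ε : ℝ} (hε : 0 < ε)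
    (hsum : ∑ t ∈ Finset.range n, ∫ ω, v t ω ^ 2 ∂P ≤ n * ε ^ 2) :
    Integrable (fun w : Ω × ℕ => v w.2 w.1) (P.prod (uniformOn (Set.Iio n))) ∧
    ∫ w, v w.2 w.1 ∂(P.prod (uniformOn (Set.Iio n))) ≤ ε := by
  have hbd : ∀ t ω, |v t ω| ≤ v t ω ^ 2 * (1 / (2 * ε)) + ε / 2 := fun t ω => by
    have h : v t ω ^ 2 * (1 / (2 * ε)) + ε / 2 - |v t ω| = (|v t ω| - ε) ^ 2 * (1 / (2 * ε)) := by
      rw [← sq_abs (v t ω)]; field_simp; ring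
    have : 0 ≤ (|v t ω| - ε) ^ 2 * (1 / (2 * ε)) := by positivity
    linarith
  have hbi : ∀ t, Integrable (fun ω => v t ω ^ 2 * (1 / (2 * ε)) + ε / 2) P := fun t =>
    ((hi t).mul_const _).add (integrable_const _)
  have hvi : ∀ t, Integrable (v t) P := fun t =>
    (hbi t).mono' (hm t).aestronglyMeasurable (Filter.Eventually.of_forall (hbd t))
  obtain ⟨h1, h2⟩ := integral_prod_uniformOn hm hvi hn
  refine ⟨h1, h2.trans_le ?_⟩
  have hn' : (0 : ℝ) < n := Nat.cast_pos.2 hn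
  have h3 : ∀ t, ∫ ω, v t ω ∂P ≤ (∫ ω, v t ω ^ 2 ∂P) * (1 / (2 * ε)) + ε / 2 := fun t => by
    refine (integral_mono (hvi t) (hbi t) fun ω => (le_abs_self _).trans (hbd t ω)).trans_eq ?_
    rw [integral_add ((hi t).mul_const _) (integrable_const _), integral_mul_const]
    simp
  rw [inv_mul_le_iff₀ hn']
  calc _ ≤ ∑ t ∈ Finset.range n, ((∫ ω, v t ω ^ 2 ∂P) * (1 / (2 * ε)) + ε / 2) :=
        Finset.sum_le_sum fun t _ => h3 t
    _ = (∑ t ∈ Finset.range n, ∫ ω, v t ω ^ 2 ∂P) * (1 / (2 * ε)) + n * (ε / 2) := by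
        rw [Finset.sum_add_distrib, ← Finset.sum_mul]; simp
    _ ≤ n * ε ^ 2 * (1 / (2 * ε)) + n * (ε / 2) := by gcongr
    _ = n * ε := by field_simp; ring

/-! ### Complexity of the parameter setting -/

section Complexity

variable {dx dy : ℕ} {c : Consts} {f g : Joint dx dy → ℝ} {Δ R ε : ℝ} [Nontrivial (Vec dy)]

theorem iterations_pos (hr : Regular c f g) (hΔ : 0 < Δ) (hε : 0 < ε) :
    0 < iterations factors c Δ ε := by
  have h1 := hr.ell_pos
  have h2 := hr.one_le_kappa
  have h3 := factors.T_pos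
  exact Nat.ceil_pos.2 (by positivity)

theorem setting_ηx_pos (hr : Regular c f g) : 0 < (setting factors c Δ R ε).ηx := by
  have h1 := hr.ell_pos
  have h2 := hr.one_le_kappa
  have h3 := factors.η_pos
  change 0 < factors.η / (c.ell * c.kappa ^ 3)
  positivity

theorem setting_ηx_mul (hr : Regular c f g) :
    12 * (c.ell * c.kappa ^ 3) * (setting factors c Δ R ε).ηx = 1 := by
  have h1 := hr.ell_pos
  have h2 := hr.one_le_kappa
  change 12 * (c.ell * c.kappa ^ 3) * (1 / 12 / (c.ell * c.kappa ^ 3)) = 1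
  field_simp

/-- The number of iterations makes the initial gap comparable to the error per step. -/
theorem gap_le_iterations (hr : Regular c f g) (hε : 0 < ε) :
    Δ ≤ iterations factors c Δ ε * ((setting factors c Δ R ε).ηx * (ε ^ 2 / 4)) := by
  have h1 := hr.ell_pos
  have h2 := hr.one_le_kappa
  have h3 : 48 * (Δ * (c.ell * c.kappa ^ 3 / ε ^ 2)) ≤ iterations factors c Δ ε := Nat.le_ceil _
  have h4 := setting_ηx_mul (Δ := Δ) (R := R) (ε := ε) hr
  have h5 := setting_ηx_pos (Δ := Δ) (R := R) (ε := ε) hr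
  calc Δ = 48 * (Δ * (c.ell * c.kappa ^ 3 / ε ^ 2)) *
        ((setting factors c Δ R ε).ηx * (ε ^ 2 / 4)) := by
        field_simp; linear_combination (-4 * Δ) * h4
    _ ≤ _ := by gcongr

theorem penaltyLipSq_le (hr : Regular c f g) (hε : 0 < ε) (hεL : ε ≤ c.ell * c.kappa ^ 2) :
    penaltyLipSq c (penalty factors c Δ R ε) ≤ 2 * penalty factors c Δ R ε ^ 2 * c.ell ^ 2 := by
  have h1 := hr.one_le_kappa
  have h2 : 1 ≤ penalty factors c Δ R ε := by
    linarith [kappa_le_penalty (Δ := Δ) (R := R) (by linarith) hε hεL]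
  have h3 : c.Lf ^ 2 ≤ c.ell ^ 2 := pow_le_pow_left₀ hr.Lf_nonneg c.Lf_le_ell 2
  have h4 : c.Lg ^ 2 ≤ c.ell ^ 2 := pow_le_pow_left₀ hr.Lg_pos.le c.Lg_le_ell 2
  have h5 : 1 ≤ penalty factors c Δ R ε ^ 2 := one_le_pow₀ h2
  unfold penaltyLipSq
  nlinarith [sq_nonneg c.ell, sq_nonneg (penalty factors c Δ R ε)]

/-- A bound for the average over the run of `1 + δ_t / c₀`, where `c₀` is the target for the squared
inner error. -/
def meanRatio (c : Consts) (lam R ε : ℝ) : ℝ :=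
  1 + 16 * R * lam ^ 2 * c.ell ^ 2 / ε ^ 2 + 2 * lam ^ 2 + c.ell

theorem floor_setting_div_le (hr : Regular c f g) (hε : 0 < ε) (hεL : ε ≤ c.ell * c.kappa ^ 2) :
    2 * (setting factors c Δ R ε).floor / targetErr c (penalty factors c Δ R ε) ε ≤ c.ell := by
  have hlam := penalty_pos (Δ := Δ) (R := R) hr hε hεL
  have hBin := (setting_admissible (Δ := Δ) (R := R) hr hε hεL).Bin_pos
  have hμ := hr.μ_pos
  have hLg := hr.Lg_pos
  have hμL := hr.μ_le_Lg
  have hLl := c.Lg_le_ell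
  have hL := penaltyLipSq_pos hr hlam
  have h1 := noise_le_batchOut (c := c) (Δ := Δ) (R := R) hε
  have h2 := batchOut_le_batchIn (Δ := Δ) (R := R) (ε := ε) hμ hlam
  have hBin' : (0 : ℝ) < batchIn factors c Δ R ε := Nat.cast_pos.2 hBin
  change 2 * (c.σg ^ 2 / (2 * c.Lg * batchIn factors c Δ R ε)) / _ ≤ _
  unfold targetErr
  generalize penalty factors c Δ R ε = lam at *
  generalize penaltyLipSq c lam = L at *
  generalize (batchOut factors c Δ R ε : ℝ) = Bo at *
  generalize (batchIn factors c Δ R ε : ℝ) = Bi at *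
  have e : 2 * (c.σg ^ 2 / (2 * c.Lg * Bi)) / (ε ^ 2 / L)
      = lam ^ 2 * c.σg ^ 2 * L / (c.Lg * Bi * ε ^ 2 * lam ^ 2) := by
    field_simp
  rw [e, div_le_iff₀ (by positivity)]
  have h3 := mul_le_mul_of_nonneg_left h1 (by positivity : 0 ≤ 3 * L)
  have h4 := mul_le_mul_of_nonneg_left h2 (by positivity : 0 ≤ ε ^ 2)
  have h5 : c.μ ^ 2 ≤ c.ell * c.Lg := by nlinarith
  have h6 : lam ^ 2 * Bi * ε ^ 2 * c.μ ^ 2 ≤ lam ^ 2 * Bi * ε ^ 2 * (c.ell * c.Lg) := by gcongr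
  have h7 : 0 ≤ L * c.σf ^ 2 := by positivity
  have h8 : 0 ≤ L * (lam ^ 2 * c.σg ^ 2) := by positivity
  linarith

theorem mean_ratio_le (hr : Regular c f g) (hR : 0 ≤ R) (hε : 0 < ε)
    (hεL : ε ≤ c.ell * c.kappa ^ 2) {n : ℕ} (hn : 0 < n) {D : ℝ}
    (hD : D ≤ n * (2 * (setting factors c Δ R ε).ηx ^ 2 * ε ^ 2)) :
    n + (2 * (setting factors c Δ R ε).δ₀ + 2 * ((setting factors c Δ R ε).drift * D
      + n * (setting factors c Δ R ε).floor)) / targetErr c (penalty factors c Δ R ε) ε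
      ≤ n * meanRatio c (penalty factors c Δ R ε) R ε := by
  have hlam := penalty_pos (Δ := Δ) (R := R) hr hε hεL
  have hL := penaltyLipSq_pos hr hlam
  have hL2 := penaltyLipSq_le (Δ := Δ) (R := R) hr hε hεL
  have hfl := floor_setting_div_le (Δ := Δ) (R := R) hr hε hεL
  have hη := setting_ηx_mul (Δ := Δ) (R := R) (ε := ε) hr
  have hℓ := hr.ell_pos
  have hκ := hr.one_le_kappa
  have hμ := hr.μ_pos
  have hLg := hr.Lg_pos
  have hn1 : (1 : ℝ) ≤ n := by exact_mod_cast hn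
  have hdrift : (setting factors c Δ R ε).drift ≤ 34 * c.kappa ^ 2 := by
    change 34 * c.Lg ^ 2 / c.μ ^ 2 ≤ _
    rw [div_le_iff₀ (by positivity), mul_assoc, ← mul_pow, Consts.kappa_mul_μ hμ]
    have := pow_le_pow_left₀ hLg.le c.Lg_le_ell 2
    linarith
  have hdrift0 : 0 ≤ (setting factors c Δ R ε).drift := by
    change 0 ≤ 34 * c.Lg ^ 2 / c.μ ^ 2
    positivity
  have hδ₀ : (setting factors c Δ R ε).δ₀ = 4 * R := rfl
  rw [hδ₀]
  unfold meanRatio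
  generalize (setting factors c Δ R ε).drift = dr at *
  generalize (setting factors c Δ R ε).floor = fl at *
  generalize (setting factors c Δ R ε).ηx = η at *
  have hc₀ : ∀ a : ℝ, a / targetErr c (penalty factors c Δ R ε) ε
      = a * penaltyLipSq c (penalty factors c Δ R ε) / ε ^ 2 := fun a => by
    unfold targetErr; field_simp
  rw [hc₀] at hfl ⊢
  generalize penalty factors c Δ R ε = lam at *
  generalize penaltyLipSq c lam = L at *
  have e : (2 * (4 * R) + 2 * (dr * D + n * fl)) * L / ε ^ 2
      = 8 * R * L / ε ^ 2 + 2 * (dr * D * L / ε ^ 2) + n * (2 * fl * L / ε ^ 2) := by ring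
  rw [e]
  have h1 : 8 * R * L / ε ^ 2 ≤ n * (16 * R * lam ^ 2 * c.ell ^ 2 / ε ^ 2) := by
    refine le_trans ?_ (le_mul_of_one_le_left (by positivity) hn1)
    have : 8 * R * L ≤ 16 * R * lam ^ 2 * c.ell ^ 2 := by nlinarith
    gcongr
  have h2 : dr * D * L / ε ^ 2 ≤ n * lam ^ 2 := by
    have h3 : dr * D * L / ε ^ 2 ≤ 34 * c.kappa ^ 2 * (n * (2 * η ^ 2 * ε ^ 2))
        * (2 * lam ^ 2 * c.ell ^ 2) / ε ^ 2 := by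
      have h4 : dr * D ≤ 34 * c.kappa ^ 2 * (n * (2 * η ^ 2 * ε ^ 2)) :=
        (mul_le_mul_of_nonneg_left hD hdrift0).trans
          (mul_le_mul_of_nonneg_right hdrift (by positivity))
      have h5 : dr * D * L ≤ 34 * c.kappa ^ 2 * (n * (2 * η ^ 2 * ε ^ 2)) * L :=
        mul_le_mul_of_nonneg_right h4 hL.le
      have h6 : 34 * c.kappa ^ 2 * (n * (2 * η ^ 2 * ε ^ 2)) * L
          ≤ 34 * c.kappa ^ 2 * (n * (2 * η ^ 2 * ε ^ 2)) * (2 * lam ^ 2 * c.ell ^ 2) :=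
        mul_le_mul_of_nonneg_left hL2 (by positivity)
      have := h5.trans h6
      gcongr
    have h7 : (12 * (c.ell * c.kappa ^ 1) * η) ^ 2 ≤ 1 := by
      have hη0 : 0 ≤ η := by
        by_contra hneg
        have : 12 * (c.ell * c.kappa ^ 3) * η ≤ 0 :=
          mul_nonpos_of_nonneg_of_nonpos (by positivity) (by linarith)
        linarith
      have h8 : 12 * (c.ell * c.kappa ^ 1) * η ≤ 12 * (c.ell * c.kappa ^ 3) * η := by
        have := pow_le_pow_right₀ hκ (by norm_num : 1 ≤ 3)
        gcongr
      rw [hη] at h8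
      exact pow_le_one₀ (by positivity) h8
    refine h3.trans ?_
    have e2 : 34 * c.kappa ^ 2 * (n * (2 * η ^ 2 * ε ^ 2)) * (2 * lam ^ 2 * c.ell ^ 2) / ε ^ 2
        = n * lam ^ 2 * (136 / 144 * (12 * (c.ell * c.kappa ^ 1) * η) ^ 2) := by
      field_simp; ring
    rw [e2]
    exact mul_le_of_le_one_right (by positivity) (by linarith)
  have h3 : n * (2 * fl * L / ε ^ 2) ≤ n * c.ell :=
    mul_le_mul_of_nonneg_left hfl (by positivity)
  linarith

theorem innerSteps_setting_le (hr : Regular c f g) (hε : 0 < ε) (hεL : ε ≤ c.ell * c.kappa ^ 2)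
    {δ : ℝ} (hδ : 0 ≤ δ) :
    ((setting factors c Δ R ε).innerSteps δ : ℝ)
      ≤ (32 * (c.kappa * Real.log (2 * c.kappa)) + 1)
        + 32 * c.kappa * Real.log (1 + δ / targetErr c (penalty factors c Δ R ε) ε) := by
  have hL := penaltyLipSq_pos hr (penalty_pos (Δ := Δ) (R := R) hr hε hεL)
  have hμ := hr.μ_pos
  have hκ := hr.one_le_kappa
  have hLg := hr.Lg_pos
  have hA : 1 + (c.Lf ^ 2 + penalty factors c Δ R ε ^ 2 * c.Lg ^ 2) * δ / ε ^ 2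
      = 1 + δ / targetErr c (penalty factors c Δ R ε) ε := by
    unfold targetErr
    rw [penaltyLipSq] at hL ⊢
    field_simp
  have hA1 : 1 ≤ 1 + δ / targetErr c (penalty factors c Δ R ε) ε :=
    le_add_of_nonneg_right (div_nonneg hδ (div_nonneg (sq_nonneg _) hL.le))
  change ((⌈32 * (c.Lg / c.μ * Real.log (2 * c.kappa *
    (1 + (c.Lf ^ 2 + penalty factors c Δ R ε ^ 2 * c.Lg ^ 2) * δ / ε ^ 2)))⌉₊ : ℕ) : ℝ) ≤ _
  rw [hA, Real.log_mul (by positivity) (by positivity)]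
  have h1 : 0 ≤ Real.log (2 * c.kappa) := Real.log_nonneg (by linarith)
  have h2 : 0 ≤ Real.log (1 + δ / targetErr c (penalty factors c Δ R ε) ε) :=
    Real.log_nonneg hA1
  refine (Nat.ceil_lt_add_one (by positivity)).le.trans ?_
  have h3 : c.Lg / c.μ ≤ c.kappa := div_le_div_of_nonneg_right c.Lg_le_ell hμ.le
  have := mul_le_mul_of_nonneg_right h3 (add_nonneg h1 h2)
  linarith

end Complexity

/-! ### The bounds in `ε` -/

section Orders

variable {dx dy : ℕ} {c : Consts} {f g : Joint dx dy → ℝ} {Δ R ε : ℝ} [Nontrivial (Vec dy)]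

/-- The factor by which `1 / R` and `1 / Δ` enter the bound for the penalty. -/
def initScale (Δ R : ℝ) : ℝ := 1 + 1 / R + 1 / Δ

/-- The factor in front of `κ log (ℓ κ / ε)` in the bound for the mean number of inner steps. -/
def logFactor (Δ R : ℝ) : ℝ :=
  290 + 64 * Real.log (2 + 16384 * R * initScale Δ R ^ 2 + 2048 * initScale Δ R ^ 2)

/-- The constant in the complexity bounds. -/
def complexityConst (Δ R σf σg : ℝ) : ℝ :=
  21 * (48 * Δ + 1) * (96 * σf ^ 2 + 98304 * initScale Δ R ^ 2 * σg ^ 2 + 1)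
    * (logFactor Δ R + 2)

theorem one_le_initScale (hΔ : 0 < Δ) (hR : 0 < R) : 1 ≤ initScale Δ R := by
  have h1 : 0 < 1 / R := by positivity
  have h2 : 0 < 1 / Δ := by positivity
  unfold initScale; linarith

theorem logFactor_ge (hR : 0 < R) : 290 ≤ logFactor Δ R := by
  have : 0 ≤ Real.log (2 + 16384 * R * initScale Δ R ^ 2 + 2048 * initScale Δ R ^ 2) := by
    apply Real.log_nonneg
    have h1 : 0 ≤ 16384 * R * initScale Δ R ^ 2 := by positivity
    have h2 : 0 ≤ 2048 * initScale Δ R ^ 2 := by positivity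
    linarith
  unfold logFactor; linarith

theorem iterations_le (hr : Regular c f g) (hΔ : 0 < Δ) (hε : 0 < ε) (hε1 : ε ≤ 1)
    (hεL : ε ≤ c.ell * c.kappa ^ 2) :
    (iterations factors c Δ ε : ℝ) ≤ (48 * Δ + 1) * (c.ell * c.kappa ^ 3 / ε ^ 2) := by
  have hℓ := hr.ell_pos
  have hκ := hr.one_le_kappa
  have h1 : (iterations factors c Δ ε : ℝ) ≤ 48 * (Δ * (c.ell * c.kappa ^ 3 / ε ^ 2)) + 1 := by
    refine (Nat.ceil_lt_add_one ?_).le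
    have := factors.T_pos
    positivity
  have h2 : 1 ≤ c.ell * c.kappa ^ 3 / ε ^ 2 := by
    rw [one_le_div (by positivity)]
    have h3 : ε ^ 2 ≤ ε := by nlinarith
    have h4 : c.ell * c.kappa ^ 2 ≤ c.ell * c.kappa ^ 3 := by
      have := pow_le_pow_right₀ hκ (by norm_num : 2 ≤ 3)
      gcongr
    linarith
  linarith

theorem penalty_le (hr : Regular c f g) (hΔ : 0 < Δ) (hR : 0 < R) (hε : 0 < ε) (hε1 : ε ≤ 1)
    (hεL : ε ≤ c.ell * c.kappa ^ 2) :
    penalty factors c Δ R ε ≤ 32 * initScale Δ R * (c.ell * c.kappa ^ 3 / ε) := by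
  have hℓ := hr.ell_pos
  have hκ := hr.one_le_kappa
  set Y := c.ell * c.kappa ^ 3 / ε with hY
  have hY0 : 0 < Y := by positivity
  have h1 : c.kappa ≤ Y := by
    rw [hY, le_div_iff₀ hε]
    have := mul_le_mul_of_nonneg_left hεL (by linarith : 0 ≤ c.kappa)
    linarith
  have h2 : c.ell * c.kappa ^ 2 ≤ Y := by
    rw [hY, le_div_iff₀ hε]
    have h3 : ε ≤ c.kappa := hε1.trans hκ
    have := mul_le_mul_of_nonneg_left h3 (by positivity : 0 ≤ c.ell * c.kappa ^ 2)
    linarith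
  have h3 : c.kappa / R ≤ 1 / R * Y := by
    rw [div_eq_mul_one_div, mul_comm]; gcongr
  have h4 : c.ell * c.kappa ^ 2 / Δ ≤ 1 / Δ * Y := by
    rw [div_eq_mul_one_div, mul_comm]; gcongr
  have h5 : 0 ≤ 1 / R * Y := by positivity
  have h6 : 0 ≤ 1 / Δ * Y := by positivity
  have h7 : max (c.kappa / R) (max (c.ell * c.kappa ^ 2 / Δ) Y) ≤ initScale Δ R * Y := by
    unfold initScale
    refine max_le ?_ (max_le ?_ ?_) <;> linarith
  change 32 * max (c.kappa / R) (max (c.ell * c.kappa ^ 2 / Δ) Y) ≤ _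
  linarith

theorem two_kappa_le (hr : Regular c f g) (hε : 0 < ε) (hεℓ : 2 * ε ≤ c.ell) :
    2 * c.kappa ≤ c.ell * c.kappa / ε := by
  have hκ := hr.one_le_kappa
  rw [le_div_iff₀ hε]
  have := mul_le_mul_of_nonneg_right hεℓ (by linarith : 0 ≤ c.kappa)
  linarith

theorem meanRatio_le (hr : Regular c f g) (hΔ : 0 < Δ) (hR : 0 < R) (hε : 0 < ε) (hε1 : ε ≤ 1)
    (hεℓ : 2 * ε ≤ c.ell) (hεL : ε ≤ c.ell * c.kappa ^ 2) :
    meanRatio c (penalty factors c Δ R ε) R ε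
      ≤ (2 + 16384 * R * initScale Δ R ^ 2 + 2048 * initScale Δ R ^ 2)
        * (c.ell * c.kappa / ε) ^ 8 := by
  have hℓ := hr.ell_pos
  have hκ := hr.one_le_kappa
  have hlam := penalty_pos (Δ := Δ) (R := R) hr hε hεL
  have hpen := penalty_le hr hΔ hR hε hε1 hεL
  have hX2 := two_kappa_le hr hε hεℓ
  have hs := one_le_initScale hΔ hR
  set X := c.ell * c.kappa / ε with hX
  have hX1 : 1 ≤ X := by linarith
  have h1 : c.ell * c.kappa ^ 3 / ε ≤ X ^ 3 := by
    have e : X ^ 3 = c.ell * c.kappa ^ 3 / ε * (c.ell / ε) ^ 2 := by rw [hX]; field_simp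
    rw [e]
    refine le_mul_of_one_le_right (by positivity) (one_le_pow₀ ?_)
    rw [one_le_div hε]; linarith
  have h2 : c.ell / ε ≤ X := by
    rw [hX]; gcongr; exact le_mul_of_one_le_right hℓ.le hκ
  have h3 : c.ell ≤ X := by
    refine le_trans ?_ h2
    rw [le_div_iff₀ hε]; exact mul_le_of_le_one_right hℓ.le hε1
  have h4 : penalty factors c Δ R ε ≤ 32 * initScale Δ R * X ^ 3 := hpen.trans (by gcongr)
  have h5 : penalty factors c Δ R ε ^ 2 ≤ 1024 * initScale Δ R ^ 2 * X ^ 6 :=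
    (pow_le_pow_left₀ hlam.le h4 2).trans_eq (by ring)
  have h6 : 16 * R * penalty factors c Δ R ε ^ 2 * c.ell ^ 2 / ε ^ 2
      ≤ 16384 * R * initScale Δ R ^ 2 * X ^ 8 := by
    have e : 16 * R * penalty factors c Δ R ε ^ 2 * c.ell ^ 2 / ε ^ 2
        = 16 * R * penalty factors c Δ R ε ^ 2 * (c.ell / ε) ^ 2 := by
      field_simp
    rw [e]
    calc _ ≤ 16 * R * (1024 * initScale Δ R ^ 2 * X ^ 6) * X ^ 2 := by gcongr
      _ = _ := by ring
  have h7 : 2 * penalty factors c Δ R ε ^ 2 ≤ 2048 * initScale Δ R ^ 2 * X ^ 8 := by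
    have : X ^ 6 ≤ X ^ 8 := pow_le_pow_right₀ hX1 (by norm_num)
    calc _ ≤ 2 * (1024 * initScale Δ R ^ 2 * X ^ 6) := by gcongr
      _ ≤ 2 * (1024 * initScale Δ R ^ 2 * X ^ 8) := by gcongr
      _ = _ := by ring
  have h8 : 1 ≤ X ^ 8 := one_le_pow₀ hX1
  have h9 : c.ell ≤ X ^ 8 := h3.trans (le_self_pow₀ hX1 (by norm_num))
  unfold meanRatio
  linarith

theorem meanRatio_pos (hr : Regular c f g) (hR : 0 < R) (lam : ℝ) :
    0 < meanRatio c lam R ε := by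
  have hℓ := hr.ell_pos
  unfold meanRatio; positivity

theorem half_le_log (hr : Regular c f g) (hε : 0 < ε) (hεℓ : 2 * ε ≤ c.ell) :
    1 / 2 ≤ Real.log (c.ell * c.kappa / ε) := by
  have h1 : 2 ≤ c.ell * c.kappa / ε := by
    linarith [two_kappa_le hr hε hεℓ, hr.one_le_kappa]
  have h2 : Real.log 2 ≤ Real.log (c.ell * c.kappa / ε) := Real.log_le_log (by norm_num) h1
  linarith [Real.log_two_gt_d9]

/-- The bound for the mean number of inner steps per iteration. -/
theorem mean_innerSteps_le (hr : Regular c f g) (hΔ : 0 < Δ) (hR : 0 < R) (hε : 0 < ε)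
    (hε1 : ε ≤ 1) (hεℓ : 2 * ε ≤ c.ell) (hεL : ε ≤ c.ell * c.kappa ^ 2) :
    (32 * (c.kappa * Real.log (2 * c.kappa)) + 1)
        + 32 * c.kappa * Real.log (meanRatio c (penalty factors c Δ R ε) R ε)
      ≤ logFactor Δ R * (c.kappa * Real.log (c.ell * c.kappa / ε)) := by
  have hκ := hr.one_le_kappa
  have hX2 := two_kappa_le hr hε hεℓ
  have hlog := half_le_log hr hε hεℓ
  have hM := Real.log_le_log (meanRatio_pos hr hR _) (meanRatio_le hr hΔ hR hε hε1 hεℓ hεL)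
  have hX0 : 0 < c.ell * c.kappa / ε := by linarith
  have hQ1 : 1 ≤ 2 + 16384 * R * initScale Δ R ^ 2 + 2048 * initScale Δ R ^ 2 := by
    have h1 : 0 ≤ 16384 * R * initScale Δ R ^ 2 := by positivity
    have h2 : 0 ≤ 2048 * initScale Δ R ^ 2 := by positivity
    linarith
  have h1 : Real.log (2 * c.kappa) ≤ Real.log (c.ell * c.kappa / ε) :=
    Real.log_le_log (by linarith) hX2
  unfold logFactor
  generalize 2 + 16384 * R * initScale Δ R ^ 2 + 2048 * initScale Δ R ^ 2 = q at *
  rw [Real.log_mul (by positivity) (by positivity), Real.log_pow] at hM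
  have hq := Real.log_nonneg hQ1
  generalize Real.log (c.ell * c.kappa / ε) = l at *
  push_cast at hM
  have h2 : Real.log q ≤ 2 * (Real.log q * l) := by nlinarith
  have h3 := mul_le_mul_of_nonneg_left h1 (by linarith : 0 ≤ c.kappa)
  have h4 := mul_le_mul_of_nonneg_left (hM.trans (add_le_add_left h2 _))
    (by linarith : 0 ≤ c.kappa)
  have h5 : 1 ≤ 2 * (c.kappa * l) := by nlinarith
  linarith

theorem batchIn_le (hr : Regular c f g) (hε : 0 < ε) (hεL : ε ≤ c.ell * c.kappa ^ 2) :
    (batchIn factors c Δ R ε : ℝ) ≤ 7 * c.kappa ^ 2 * batchOut factors c Δ R ε := by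
  have hμ := hr.μ_pos
  have hκ := hr.one_le_kappa
  have hlam := penalty_pos (Δ := Δ) (R := R) hr hε hεL
  have hL := penaltyLipSq_le (Δ := Δ) (R := R) hr hε hεL
  have hB : (1 : ℝ) ≤ batchOut factors c Δ R ε := by
    exact_mod_cast (one_le_batchOut (c := c) (Δ := Δ) (R := R) (ε := ε))
  have h1 : penaltyLipSq c (penalty factors c Δ R ε) / (penalty factors c Δ R ε ^ 2 * c.μ ^ 2)
      ≤ 2 * c.kappa ^ 2 := by
    rw [div_le_iff₀ (by positivity)]
    have h2 : c.kappa ^ 2 * c.μ ^ 2 = c.ell ^ 2 := by rw [← mul_pow, Consts.kappa_mul_μ hμ]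
    calc _ ≤ _ := hL
      _ = 2 * c.kappa ^ 2 * (penalty factors c Δ R ε ^ 2 * c.μ ^ 2) := by rw [← h2]; ring
  have h2 : (batchIn factors c Δ R ε : ℝ) ≤ 3 * (penaltyLipSq c (penalty factors c Δ R ε)
      / (penalty factors c Δ R ε ^ 2 * c.μ ^ 2) * batchOut factors c Δ R ε) + 1 := by
    refine (Nat.ceil_lt_add_one ?_).le
    have := factors.inn_pos
    positivity
  have h3 := mul_le_mul_of_nonneg_right h1 (by linarith : (0 : ℝ) ≤ batchOut factors c Δ R ε)
  have h4 : 1 ≤ c.kappa ^ 2 * batchOut factors c Δ R ε :=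
    one_le_mul_of_one_le_of_one_le (one_le_pow₀ hκ) hB
  linarith

theorem batchOut_le (hε : 0 < ε) (hε1 : ε ≤ 1) :
    (batchOut factors c Δ R ε : ℝ)
      ≤ (96 * (c.σf ^ 2 + penalty factors c Δ R ε ^ 2 * c.σg ^ 2) + 1) / ε ^ 2 := by
  have h1 : (1 : ℝ) ≤ 1 / ε ^ 2 := by
    rw [one_le_div (by positivity)]; exact pow_le_one₀ hε.le hε1
  have h2 : 0 ≤ (96 * (c.σf ^ 2 + penalty factors c Δ R ε ^ 2 * c.σg ^ 2)) / ε ^ 2 := by positivity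
  rw [add_div]
  unfold batchOut
  rw [Nat.cast_max]
  refine max_le (by push_cast; linarith) ?_
  refine (Nat.ceil_lt_add_one ?_).le.trans ?_
  · have := factors.out_pos
    positivity
  · change 96 * _ + 1 ≤ _
    rw [mul_div_assoc]
    linarith

theorem batchOut_le_of_noise (hr : Regular c f g) (hΔ : 0 < Δ) (hR : 0 < R) (hε : 0 < ε)
    (hε1 : ε ≤ 1) (hεL : ε ≤ c.ell * c.kappa ^ 2) :
    (batchOut factors c Δ R ε : ℝ)
      ≤ (96 * c.σf ^ 2 + 98304 * initScale Δ R ^ 2 * c.σg ^ 2 + 1)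
        * (c.ell ^ 2 * c.kappa ^ 6 / ε ^ 4) := by
  have hℓ := hr.ell_pos
  have hκ := hr.one_le_kappa
  have hlam := penalty_pos (Δ := Δ) (R := R) hr hε hεL
  have h1 := pow_le_pow_left₀ hlam.le (penalty_le hr hΔ hR hε hε1 hεL) 2
  have h2 : 1 ≤ (c.ell * c.kappa ^ 3 / ε) ^ 2 := by
    refine one_le_pow₀ ?_
    rw [one_le_div hε]
    have := pow_le_pow_right₀ hκ (by norm_num : 2 ≤ 3)
    exact hεL.trans (mul_le_mul_of_nonneg_left this hℓ.le)
  have e : c.ell ^ 2 * c.kappa ^ 6 / ε ^ 4 = (c.ell * c.kappa ^ 3 / ε) ^ 2 / ε ^ 2 := by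
    field_simp
  refine (batchOut_le hε hε1).trans ?_
  rw [e, ← mul_div_assoc]
  generalize c.ell * c.kappa ^ 3 / ε = Y at *
  have h3 := mul_le_mul_of_nonneg_right h1 (by positivity : 0 ≤ 96 * c.σg ^ 2)
  have h4 := mul_le_mul_of_nonneg_left h2 (by positivity : 0 ≤ 96 * c.σf ^ 2 + 1)
  gcongr
  linarith

/-- The bound for the expected oracle calls in terms of a bound `b w` for the outer batch size: `b`
collects the constants and `w` the powers of `ℓ`, `κ` and `ε`. -/
theorem calls_bound_le (hr : Regular c f g) (hΔ : 0 < Δ) (hR : 0 < R) (hε : 0 < ε)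
    (hε1 : ε ≤ 1) (hεℓ : 2 * ε ≤ c.ell) (hεL : ε ≤ c.ell * c.kappa ^ 2) {b w : ℝ}
    (hb : batchOut factors c Δ R ε ≤ b * w) :
    iterations factors c Δ ε * (3 * batchIn factors c Δ R ε
      * ((32 * (c.kappa * Real.log (2 * c.kappa)) + 1)
        + 32 * c.kappa * Real.log (meanRatio c (penalty factors c Δ R ε) R ε))
      + 3 * batchOut factors c Δ R ε)
    ≤ 21 * (48 * Δ + 1) * b * (logFactor Δ R + 2)
      * (c.ell * c.kappa ^ 6 / ε ^ 2 * w * Real.log (c.ell * c.kappa / ε)) := by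
  have hℓ := hr.ell_pos
  have hκ := hr.one_le_kappa
  have hT := iterations_le hr hΔ hε hε1 hεL
  have hK := mean_innerSteps_le hr hΔ hR hε hε1 hεℓ hεL
  have hI := batchIn_le (Δ := Δ) (R := R) hr hε hεL
  have hl := half_le_log hr hε hεℓ
  have hlf := logFactor_ge (Δ := Δ) hR
  have hT0 : (0 : ℝ) ≤ iterations factors c Δ ε := Nat.cast_nonneg _
  generalize (iterations factors c Δ ε : ℝ) = T at *
  generalize (32 * (c.kappa * Real.log (2 * c.kappa)) + 1)
        + 32 * c.kappa * Real.log (meanRatio c (penalty factors c Δ R ε) R ε) = K at *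
  have hBi : (0 : ℝ) ≤ batchIn factors c Δ R ε := Nat.cast_nonneg _
  have hBo : (0 : ℝ) ≤ batchOut factors c Δ R ε := Nat.cast_nonneg _
  generalize (batchIn factors c Δ R ε : ℝ) = Bi at *
  generalize (batchOut factors c Δ R ε : ℝ) = Bo at *
  generalize Real.log (c.ell * c.kappa / ε) = l at *
  have h1 : 3 * Bi * K ≤ 3 * (7 * c.kappa ^ 2 * Bo) * (logFactor Δ R * (c.kappa * l)) := by
    calc 3 * Bi * K ≤ 3 * Bi * (logFactor Δ R * (c.kappa * l)) := by gcongr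
      _ ≤ _ := by gcongr
  have h2 : 3 * Bo ≤ 3 * (7 * c.kappa ^ 2 * Bo) * (2 * (c.kappa * l)) := by
    have h3 : 1 ≤ c.kappa ^ 3 * (2 * l) :=
      one_le_mul_of_one_le_of_one_le (one_le_pow₀ hκ) (by linarith)
    have := mul_le_mul_of_nonneg_left h3 hBo
    have h4 : 0 ≤ Bo * (c.kappa ^ 3 * (2 * l)) := by positivity
    linarith
  have h3 : 3 * Bi * K + 3 * Bo ≤ 21 * c.kappa ^ 3 * Bo * (logFactor Δ R + 2) * l := by
    linarith
  have h4 : 21 * c.kappa ^ 3 * Bo * (logFactor Δ R + 2) * l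
      ≤ 21 * c.kappa ^ 3 * (b * w) * (logFactor Δ R + 2) * l := by
    have : 0 ≤ l := by linarith
    gcongr
  calc T * (3 * Bi * K + 3 * Bo)
      ≤ (48 * Δ + 1) * (c.ell * c.kappa ^ 3 / ε ^ 2)
        * (21 * c.kappa ^ 3 * (b * w) * (logFactor Δ R + 2) * l) := by
        have h5 : 0 ≤ 21 * c.kappa ^ 3 * (b * w) * (logFactor Δ R + 2) * l := by
          have : 0 ≤ b * w := hBo.trans hb
          have : 0 ≤ l := by linarith
          positivity
        have h6 : 0 ≤ (48 * Δ + 1) * (c.ell * c.kappa ^ 3 / ε ^ 2) := by positivity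
        exact (mul_le_mul_of_nonneg_left (h3.trans h4) hT0).trans (mul_le_mul_of_nonneg_right hT h5)
    _ = _ := by ring

end Orders

end F2BSA

end

/-- The output is `x_j` with `j` uniform in `{0, …, T-1}` and independent of the samples. The
factors `a` are absolute; `C` depends only on `Δ, R, σ_f, σ_g`. -/
theorem theorem4p2 :
    ∃ (a : F2BSA.Factors) (C : ℝ → ℝ → ℝ → ℝ → ℝ),
    ∀ (dx dy : ℕ) (c : F2BSA.Consts) (f g : F2BSA.Joint dx dy → ℝ), F2BSA.Regular c f g →
    ∀ (x₀ : F2BSA.Vec dx) (y₀ : F2BSA.Vec dy) (Δ R ε : ℝ),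
      Δ = F2BSA.hyper f g x₀ - ⨅ x, F2BSA.hyper f g x →
      R = ‖y₀ - F2BSA.yStar g x₀‖ ^ 2 →
      0 < Δ → 0 < R → 0 < ε → ε ≤ c.ell * c.kappa ^ 2 →
    ∀ (Ξf Ξg Ω : Type*) [MeasurableSpace Ξf] [MeasurableSpace Ξg] [MeasurableSpace Ω]
      (νf : Measure Ξf) (νg : Measure Ξg) (P : Measure Ω)
      [IsProbabilityMeasure νf] [IsProbabilityMeasure νg] [IsProbabilityMeasure P]
      (F : F2BSA.Joint dx dy → Ξf → F2BSA.Joint dx dy)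
      (G : F2BSA.Joint dx dy → Ξg → F2BSA.Joint dx dy)
      (S : F2BSA.Slot → Ω → Ξf × Ξg × Ξg),
      0 ≤ c.σf → 0 ≤ c.σg →
      F2BSA.IsStochasticGradient νf f F c.σf →
      F2BSA.IsStochasticGradient νg g G c.σg →
      F2BSA.IsSampling νf νg P S →
    let T : ℕ := F2BSA.iterations a c Δ ε
    let st : ℕ → Ω → F2BSA.State dx dy := fun t ω =>
      F2BSA.run (F2BSA.setting a c Δ R ε) F G (fun s => S s ω) x₀ y₀ t
    let Q : Measure (Ω × ℕ) := P.prod (uniformOn (Set.Iio T))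
    Differentiable ℝ (F2BSA.hyper f g) ∧
    0 < T ∧
    Integrable (fun w => ‖gradient (F2BSA.hyper f g) (st w.2 w.1).x‖) Q ∧
    ∫ w, ‖gradient (F2BSA.hyper f g) (st w.2 w.1).x‖ ∂Q ≤ ε ∧
    Integrable (fun ω => ((st T ω).calls : ℝ)) P ∧
    (ε ≤ 1 → 2 * ε ≤ c.ell →
      (T : ℝ) ≤ C Δ R c.σf c.σg * (c.ell * c.kappa ^ 3 / ε ^ 2) ∧
      (0 < c.σf → c.σg = 0 →
        ∫ ω, ((st T ω).calls : ℝ) ∂P ≤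
          C Δ R c.σf c.σg *
            (c.ell * c.kappa ^ 6 / ε ^ 4 * Real.log (c.ell * c.kappa / ε))) ∧
      (0 < c.σf → 0 < c.σg →
        ∫ ω, ((st T ω).calls : ℝ) ∂P ≤
          C Δ R c.σf c.σg *
            (c.ell ^ 3 * c.kappa ^ 12 / ε ^ 6 * Real.log (c.ell * c.kappa / ε)))) := by
  refine ⟨F2BSA.factors, F2BSA.complexityConst, ?_⟩
  intro dx dy c f g hr x₀ y₀ Δ R ε hΔe hRe hΔ hR hε hεL Ξf Ξg Ω _ _ _ νf νg P _ _ _ F G S _ _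
    hF hG hS T st Q
  -- `R > 0` excludes the case of a trivial lower-level space.
  have : Nontrivial (F2BSA.Vec dy) := by
    refine nontrivial_of_ne y₀ (F2BSA.yStar g x₀) fun h => ?_
    rw [h, sub_self, norm_zero] at hRe
    norm_num [hRe] at hR
  have hacc := F2BSA.setting_accurate (Δ := Δ) hr hR.le hε hεL
  have hηpos := F2BSA.setting_ηx_pos (Δ := Δ) (R := R) (ε := ε) hr
  have hTpos : 0 < T := F2BSA.iterations_pos hr hΔ hε
  obtain ⟨hgrad, hstep, hsum⟩ := F2BSA.sum_descent_le hr hF hG hS hacc hηpos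
    (F2BSA.setting_ηx_mul hr) (F2BSA.initial_innerErr_le hr hε hεL hRe hR) (by positivity)
    (F2BSA.gradient_error_setting_le hr hε hεL)
  have hgap : F2BSA.gap f g x₀ ≤ T * ((F2BSA.setting F2BSA.factors c Δ R ε).ηx * (ε ^ 2 / 4)) := by
    rw [F2BSA.gap, ← hΔe]
    exact F2BSA.gap_le_iterations hr hε
  have hsumT := hsum T
  rw [Finset.sum_add_distrib, ← Finset.mul_sum, ← Finset.mul_sum] at hsumT
  obtain ⟨hNle, hDle⟩ := F2BSA.sums_le_of_descent hηpos
    (Finset.sum_nonneg fun t _ => integral_nonneg fun ω => sq_nonneg _)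
    (Finset.sum_nonneg fun t _ => integral_nonneg fun ω => sq_nonneg _) hgap hsumT
  have hmeas : ∀ t, Measurable fun ω => ‖gradient (F2BSA.hyper f g) (st t ω).x‖ := fun t =>
    (F2BSA.measurable_gradient_hyper.comp ((F2BSA.measurable_run_past (S := S) hF hG
      hacc.toAdmissible x₀ y₀ t).mono (F2BSA.pastAlg_le hS.measurable _)).x).norm
  obtain ⟨hvint, hle⟩ := F2BSA.integral_prod_uniformOn_le
    (v := fun t ω => ‖gradient (F2BSA.hyper f g) (st t ω).x‖) hmeas hgrad hTpos hε hNle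
  have hκ := hr.one_le_kappa
  obtain ⟨hcalls, hcallsle⟩ := F2BSA.integral_calls_le hF hG hS hacc hstep
    (b := 32 * c.kappa) (by positivity)
    (fun δ hδ => F2BSA.innerSteps_setting_le hr hε hεL hδ) T
  refine ⟨hr.differentiable_hyper, hTpos, hvint, hle, hcalls, fun hε1 hεℓ => ?_⟩
  have hbound := hcallsle _ (F2BSA.meanRatio_pos hr hR _)
    (F2BSA.mean_ratio_le hr hR.le hε hεL hTpos hDle)
  have hlf := F2BSA.logFactor_ge (Δ := Δ) hR
  have hℓ := hr.ell_pos
  refine ⟨?_, fun _ hσg => ?_, fun _ _ => ?_⟩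
  · refine (F2BSA.iterations_le hr hΔ hε hε1 hεL).trans ?_
    gcongr
    have h1 : 1 ≤ 96 * c.σf ^ 2 + 98304 * F2BSA.initScale Δ R ^ 2 * c.σg ^ 2 + 1 :=
      le_add_of_nonneg_left (by positivity)
    have h2 : 1 ≤ F2BSA.logFactor Δ R + 2 := by linarith
    have h3 := one_le_mul_of_one_le_of_one_le h1 h2
    have h4 : 0 ≤ 48 * Δ + 1 := by positivity
    unfold F2BSA.complexityConst
    nlinarith
  · have hb : (F2BSA.batchOut F2BSA.factors c Δ R ε : ℝ)
        ≤ (96 * c.σf ^ 2 + 98304 * F2BSA.initScale Δ R ^ 2 * c.σg ^ 2 + 1) * (1 / ε ^ 2) := by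
      have := F2BSA.batchOut_le (c := c) (Δ := Δ) (R := R) hε hε1
      rw [hσg] at this ⊢
      convert this using 1
      ring
    refine hbound.trans ((F2BSA.calls_bound_le hr hΔ hR hε hε1 hεℓ hεL hb).trans_eq ?_)
    unfold F2BSA.complexityConst
    field_simp
  · have hb := F2BSA.batchOut_le_of_noise hr hΔ hR hε hε1 hεL
    refine hbound.trans ((F2BSA.calls_bound_le hr hΔ hR hε hε1 hεℓ hεL hb).trans_eq ?_)
    unfold F2BSA.complexityConst
    field_simp
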